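/- Let $q$ be a power of an odd prime and let $K/\mathbb{F}_q$ be an algebraic (hence Galois) extension with profinite Galois group $G$. For open subgroups $H\le G$ let $\underline{A}(G/H)=A(H)$ be the Burnside ring of finite continuous $H$-sets; with restriction of $H$-sets, transfer $X\mapsto H\times_L X$, norm $X\mapsto \mathrm{Map}_L(H,X)$ (extended to virtual sets as a polynomial map) for $L\le H$, and conjugation, these form the Burnside Tambara functor $\underline{A}$ of $G$. A Tambara ideal is a family of ring ideals $\mathscr{I}(G/H)\subseteq A(H)$ closed under restriction, transfer and conjugation and such that $N_L^H(\mathscr I(G/L))\subseteq \mathscr I(G/H)+N_L^H(0)$; $(\!(S)\!)$ denotes the smallest Tambara ideal containing a set $S$ of elements of the rings $A(H)$, and a Tambara ideal is strongly principal if it equals $(\!(a)\!)$ for a single $a\in A(H)$ for some open subgroup $H$. The trace ideal $\mathrm{TI}(K/\mathbb{F}_q)$ is the family of kernels of the Dress maps $A(H)\to GW(K^H)$, $[H/L]\mapsto[x\in K^L\mapsto \mathrm{tr}_{K^L/K^H}(x^2)]$, where $GW$ is the Grothendieck–Witt ring. For a procyclic group $H$ write $t_k\in A(H)$ for the class of the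 transitive $H$-set with $k$ elements. Then the following hold. 1. Let $K=\mathbb{F}_{q^N}$, $N\ge 1$, with $N=2^\mu p_1^{\sigma_1}\cdots p_s^{\sigma_s}$ where the $p_i$ are distinct odd primes and $\sigma_i\ge1$, so $G=C_N$. Put $\hat N=2^{\min(\mu,2)}p_1\cdots p_s$ and let $C_{\hat N}\le G$ be the subgroup of order $\hat N$. Then $\mathrm{TI}(\mathbb{F}_{q^N}/\mathbb{F}_q)$ is strongly principal, and $$\mathrm{TI}(\mathbb{F}_{q^N}/\mathbb{F}_q)=\Big(\!\!\Big(X_2+\sum_{i=1}^s (t_{p_i}-p_i)\Big)\!\!\Big),$$ generated by a single element of $A(C_{\hat N})$, where $X_2=0$ if $\mu=0$, $X_2=2(t_2-2)$ if $\mu=1$, and $X_2=t_4-t_2-2$ if $\mu\ge2$. 2. Let $K=Q$ be the quadratic closure of $\mathbb{F}_q$ (the smallest algebraic extension in which every element is a square). Then $\mathrm{TI}(Q/\mathbb{F}_q)$ is the Tambara ideal generated by the elements $t_4-t_2-2\in A(H)$, where $H$ runs over the open subgroups of index $2^n$, $n\ge 0$, of $G=\mathrm{Gal}(Q/\mathbb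 F_q)$. 3. Let $K$ be the algebraic closure of $\mathbb{F}_q$. Then $\mathrm{TI}(K/\mathbb{F}_q)$ is the Tambara ideal generated by the elements $t_4-t_2-2\in A(H)$, where $H$ runs over the open subgroups of index $2^n$, $n\ge0$, together with the elements $t_p-p\in A(H)$, where $p$ runs over the odd primes and $H$ over the open subgroups of index $p^n$, $n\ge0$, of $G=\mathrm{Gal}(K/\mathbb F_q)$. -/

import Mathlib

universe u v
set_option linter.unusedSectionVars false
namespace TraceIdeal
open Algebra

section Grothendieck
variable (S : Type u) [CommSemiring S]

/-- The Grothendieck ring of a commutative semiring: formal differences of its elements. -/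
def GrothendieckRing : Type u := GrothendieckAddGroup S

namespace GrothendieckRing

noncomputable instance : AddCommGroup (GrothendieckRing S) :=
  inferInstanceAs (AddCommGroup (GrothendieckAddGroup S))

variable {S}

/-- The canonical map from the semiring. -/
noncomputable def of : S →+ GrothendieckRing S := GrothendieckAddGroup.of

/-- The additive extension of an additive map to formal differences. -/
noncomputable def lift {B : Type v} [AddCommGroup B] (f : S →+ B) : GrothendieckRing S →+ B :=
  GrothendieckAddGroup.lift f

@[simp] theorem lift_of {B : Type v} [AddCommGroup B] (f : S →+ B) (a : S) :
    lift f (of a) = f a :=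
  DFunLike.congr_fun (GrothendieckAddGroup.lift.symm_apply_apply f) a

theorem of_sub_of (a b : S) : (of a - of b : GrothendieckRing S) =
    (AddLocalization.mk a ⟨b, AddSubmonoid.mem_top b⟩ : GrothendieckAddGroup S) := by
  refine sub_eq_of_eq_add ?_
  have h : (AddLocalization.mk a ⟨b, AddSubmonoid.mem_top b⟩ + AddLocalization.mk b 0 :
      GrothendieckAddGroup S) = AddLocalization.mk a 0 := by
    rw [AddLocalization.mk_add, AddLocalization.mk_eq_mk_iff, AddLocalization.r_iff_exists]
    exact ⟨0, by simp [add_comm]⟩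
  exact h.symm

theorem exists_eq_sub (x : GrothendieckRing S) : ∃ a b : S, x = of a - of b := by
  refine AddLocalization.induction_on (p := fun x => ∃ a b : S, x = of a - of b) x fun y => ?_
  exact ⟨y.1, y.2, (of_sub_of _ _).symm⟩

theorem of_eq_of_iff {a b : S} : (of a : GrothendieckRing S) = of b ↔ ∃ c, c + a = c + b := by
  change AddLocalization.mk a 0 = AddLocalization.mk b 0 ↔ _
  rw [AddLocalization.mk_eq_mk_iff, AddLocalization.r_iff_exists]
  simp

theorem hom_ext {B : Type v} [AddCommGroup B] {f g : GrothendieckRing S →+ B}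
    (h : ∀ a, f (of a) = g (of a)) : f = g := by
  ext x
  obtain ⟨a, b, rfl⟩ := exists_eq_sub x
  simp [h]

/-- The multiplication, as a biadditive map. -/
noncomputable def mulHom : GrothendieckRing S →+ GrothendieckRing S →+ GrothendieckRing S :=
  lift
    { toFun := fun a => lift (of.comp (AddMonoidHom.mulLeft a))
      map_zero' := hom_ext fun b => by simp
      map_add' := fun a a' => hom_ext fun b => by simp [add_mul] }

noncomputable instance : Mul (GrothendieckRing S) := ⟨fun x y => mulHom x y⟩
noncomputable instance : One (GrothendieckRing S) := ⟨of 1⟩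

theorem of_mul_of (a b : S) : (of a * of b : GrothendieckRing S) = of (a * b) := by
  change mulHom (of a) (of b) = _
  simp [mulHom]

theorem gadd_mul (x y z : GrothendieckRing S) : (x + y) * z = x * z + y * z := by
  change mulHom _ _ = mulHom _ _ + mulHom _ _
  simp

theorem gmul_add (x y z : GrothendieckRing S) : x * (y + z) = x * y + x * z := by
  change mulHom _ _ = mulHom _ _ + mulHom _ _
  simp

theorem gsub_mul (x y z : GrothendieckRing S) : (x - y) * z = x * z - y * z := by
  change mulHom _ _ = mulHom _ _ - mulHom _ _
  simp

theorem gmul_sub (x y z : GrothendieckRing S) : x * (y - z) = x * y - x * z := by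
  change mulHom _ _ = mulHom _ _ - mulHom _ _
  simp

theorem gmul_comm (x y : GrothendieckRing S) : x * y = y * x := by
  obtain ⟨a, b, rfl⟩ := exists_eq_sub x
  obtain ⟨c, d, rfl⟩ := exists_eq_sub y
  simp only [gsub_mul, gmul_sub, of_mul_of, mul_comm]
  abel

theorem gmul_assoc (x y z : GrothendieckRing S) : x * y * z = x * (y * z) := by
  obtain ⟨a, b, rfl⟩ := exists_eq_sub x
  obtain ⟨c, d, rfl⟩ := exists_eq_sub y
  obtain ⟨e, f, rfl⟩ := exists_eq_sub z
  simp only [gsub_mul, gmul_sub, of_mul_of, mul_assoc]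

theorem gone_mul (x : GrothendieckRing S) : 1 * x = x := by
  obtain ⟨a, b, rfl⟩ := exists_eq_sub x
  change of 1 * _ = _
  simp only [gmul_sub, of_mul_of, one_mul]

noncomputable instance : CommRing (GrothendieckRing S) where
  __ := (inferInstance : AddCommGroup (GrothendieckRing S))
  mul_assoc := gmul_assoc
  mul_comm := gmul_comm
  one_mul := gone_mul
  mul_one x := by rw [gmul_comm, gone_mul]
  left_distrib := gmul_add
  right_distrib := gadd_mul
  zero_mul x := by change mulHom 0 x = 0; simp
  mul_zero x := by change mulHom x 0 = 0; simp

/-- The value at `a - b` of the extension of a polynomial map `f` of degree at most `n`: the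
value at `-1` of the integer-valued polynomial `k ↦ f (a + k b)`. -/
def extendAt {B : Type v} [AddCommGroup B] (n : ℕ) (f : S → B) (a b : S) : B :=
  ∑ j ∈ Finset.range (n + 1), ((-1 : ℤ) ^ j * (n + 1).choose (j + 1)) • f (a + j • b)

/-- The map `f` is polynomial of degree at most `n`: its `(n + 1)`-st differences
`k ↦ f (a + k b)` vanish. -/
def IsPolynomial {B : Type v} [AddCommGroup B] (n : ℕ) (f : S → B) : Prop :=
  ∀ a b : S, ∑ i ∈ Finset.range (n + 2), ((-1 : ℤ) ^ i * (n + 1).choose i) • f (a + i • b) = 0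

theorem extendAt_add_right {B : Type v} [AddCommGroup B] {n : ℕ} {f : S → B}
    (hf : IsPolynomial n f) (a b : S) : extendAt n f (a + b) b = f a := by
  have h := hf a b
  rw [Finset.sum_range_succ'] at h
  simp only [pow_zero, Nat.choose_zero_right, Nat.cast_one, mul_one, one_smul, zero_smul,
    add_zero] at h
  rw [eq_comm, ← sub_eq_zero, ← h, extendAt, sub_eq_add_neg, add_comm, ← Finset.sum_neg_distrib]
  congr 1
  refine Finset.sum_congr rfl fun j _ => ?_
  rw [← neg_smul, add_smul, one_smul, add_comm (j • b) b, add_assoc, pow_succ]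
  congr 1
  ring

theorem extendAt_add_add {B : Type v} [AddCommGroup B] {n : ℕ} {f : S → B}
    (hf : IsPolynomial n f) (a b c : S) : extendAt n f (a + c) (b + c) = extendAt n f a b := by
  have h : ∀ x, f x = extendAt n f (x + (b + c)) (b + c) :=
    fun x => (extendAt_add_right hf x (b + c)).symm
  have h1 : extendAt n f a b = ∑ j ∈ Finset.range (n + 1),
      ((-1 : ℤ) ^ j * (n + 1).choose (j + 1)) •
        extendAt n f (a + j • b + (b + c)) (b + c) :=
    Finset.sum_congr rfl fun j _ => by rw [← h]
  rw [h1]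
  simp only [extendAt, Finset.smul_sum]
  rw [Finset.sum_comm]
  refine Finset.sum_congr rfl fun k _ => ?_
  rw [← extendAt_add_right hf (a + c + k • (b + c)) b, extendAt, Finset.smul_sum]
  refine Finset.sum_congr rfl fun j _ => ?_
  rw [smul_comm]
  congr 3
  abel

/-- The extension of a polynomial map of degree at most `n` to formal differences. -/
noncomputable def extend {B : Type v} [AddCommGroup B] (n : ℕ) (f : S → B)
    (hf : IsPolynomial n f) (x : GrothendieckRing S) : B :=
  AddLocalization.liftOn x (fun a b => extendAt n f a b) (by
    intro a c b d h
    obtain ⟨e, he⟩ := AddLocalization.r_iff_exists.1 h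
    change (e : S) + (d + a) = e + (b + c) at he
    rw [← extendAt_add_add hf a b (d + e), ← extendAt_add_add hf c (d : S) (b + e)]
    congr 1
    · rw [show a + ((d : S) + e) = e + (d + a) by abel, he]; abel
    · abel)

theorem extend_sub {B : Type v} [AddCommGroup B] {n : ℕ} {f : S → B}
    (hf : IsPolynomial n f) (a b : S) : extend n f hf (of a - of b) = extendAt n f a b := by
  rw [of_sub_of]
  rfl

theorem extend_of {B : Type v} [AddCommGroup B] {n : ℕ} {f : S → B}
    (hf : IsPolynomial n f) (a : S) : extend n f hf (of a) = f a := by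
  have := extend_sub hf (a + 0) 0
  rwa [extendAt_add_right hf, map_zero, sub_zero, add_zero] at this

end GrothendieckRing
end Grothendieck

/-! ### Finite sets with a continuous action -/

/-- A finite discrete set with a continuous left action of `H`: all stabilizers are open. -/
structure FinGSet (H : Type v) [Group H] [TopologicalSpace H] : Type (v + 1) where
  (carrier : Type v)
  [finite : Finite carrier]
  [action : MulAction H carrier]
  (isOpen_stabilizer : ∀ x : carrier, IsOpen (MulAction.stabilizer H x : Set H))

namespace FinGSet

section Basic
variable {H : Type v} [Group H] [TopologicalSpace H]

instance : CoeSort (FinGSet H) (Type v) := ⟨FinGSet.carrier⟩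
instance (X : FinGSet H) : Finite X := X.finite
instance (X : FinGSet H) : MulAction H X := X.action

/-- Isomorphisms of finite `H`-sets. -/
structure Iso (X Y : FinGSet H) where
  toEquiv : X ≃ Y
  map_smul : ∀ (h : H) (x : X), toEquiv (h • x) = h • toEquiv x

namespace Iso

def refl (X : FinGSet H) : Iso X X := ⟨Equiv.refl _, fun _ _ => rfl⟩

def symm {X Y : FinGSet H} (e : Iso X Y) : Iso Y X :=
  ⟨e.toEquiv.symm, fun h y => by
    rw [Equiv.symm_apply_eq, e.map_smul, Equiv.apply_symm_apply]⟩

def trans {X Y Z : FinGSet H} (e : Iso X Y) (f : Iso Y Z) : Iso X Z :=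
  ⟨e.toEquiv.trans f.toEquiv, fun h x => by simp [e.map_smul, f.map_smul]⟩

noncomputable def ofBijective {X Y : FinGSet H} (f : X → Y) (hf : Function.Bijective f)
    (hs : ∀ (h : H) (x : X), f (h • x) = h • f x) : Iso X Y :=
  ⟨Equiv.ofBijective f hf, hs⟩

end Iso

instance setoid (H : Type v) [Group H] [TopologicalSpace H] : Setoid (FinGSet H) where
  r X Y := Nonempty (Iso X Y)
  iseqv := ⟨fun X => ⟨Iso.refl X⟩, fun ⟨e⟩ => ⟨e.symm⟩, fun ⟨e⟩ ⟨f⟩ => ⟨e.trans f⟩⟩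

/-- The empty `H`-set. -/
def empty (H : Type v) [Group H] [TopologicalSpace H] : FinGSet H where
  carrier := PEmpty
  action := { smul := fun _ x => x, one_smul := fun _ => rfl, mul_smul := fun _ _ _ => rfl }
  isOpen_stabilizer x := x.elim

/-- The one-point `H`-set. -/
def point (H : Type v) [Group H] [TopologicalSpace H] : FinGSet H where
  carrier := PUnit
  action := { smul := fun _ x => x, one_smul := fun _ => rfl, mul_smul := fun _ _ _ => rfl }
  isOpen_stabilizer _ := by
    convert isOpen_univ
    ext
    simp [MulAction.mem_stabilizer_iff]

/-- Disjoint union. -/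
def sum (X Y : FinGSet H) : FinGSet H where
  carrier := X ⊕ Y
  isOpen_stabilizer := by
    rintro (x | y)
    · convert X.isOpen_stabilizer x using 1
      ext h
      simp [MulAction.mem_stabilizer_iff]
    · convert Y.isOpen_stabilizer y using 1
      ext h
      simp [MulAction.mem_stabilizer_iff]

/-- Cartesian product with the diagonal action. -/
def prod (X Y : FinGSet H) : FinGSet H where
  carrier := X × Y
  isOpen_stabilizer := by
    rintro ⟨x, y⟩
    convert (X.isOpen_stabilizer x).inter (Y.isOpen_stabilizer y) using 1
    ext h
    simp [MulAction.mem_stabilizer_iff]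

/-- The invariant subset of `X` cut out by an invariant predicate. -/
def sub (X : FinGSet H) (p : X → Prop) (hp : ∀ (h : H) (x : X), p (h • x) ↔ p x) :
    FinGSet H where
  carrier := {x : X // p x}
  action :=
    { smul := fun h x => ⟨h • x.1, (hp h x.1).2 x.2⟩
      one_smul := fun x => Subtype.ext (one_smul H x.1)
      mul_smul := fun g h x => Subtype.ext (mul_smul g h x.1) }
  isOpen_stabilizer x := by
    convert X.isOpen_stabilizer x.1 using 1
    ext h
    exact Subtype.ext_iff

/-- The disjoint union of copies of `Y` indexed by `κ`. -/
def copies (κ : Type) [Finite κ] (Y : FinGSet H) : FinGSet H where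
  carrier := κ × Y
  action :=
    { smul := fun h x => (x.1, h • x.2)
      one_smul := fun x => Prod.ext rfl (one_smul H x.2)
      mul_smul := fun g h x => Prod.ext rfl (mul_smul g h x.2) }
  isOpen_stabilizer x := by
    convert Y.isOpen_stabilizer x.2 using 1
    ext h
    exact ⟨fun h => congrArg Prod.snd h, fun h => Prod.ext rfl h⟩

/-- The transitive `H`-set `H / U` for an open subgroup `U` of finite index. -/
def coset [IsTopologicalGroup H] [CompactSpace H] (U : OpenSubgroup H) : FinGSet H where
  carrier := H ⧸ U.toSubgroup
  isOpen_stabilizer x := by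
    induction x using QuotientGroup.induction_on with
    | H g =>
      have : (MulAction.stabilizer H (g : H ⧸ U.toSubgroup) : Set H) =
          (fun h => g⁻¹ * h * g) ⁻¹' (U : Set H) := by
        ext h
        simp only [SetLike.mem_coe, MulAction.mem_stabilizer_iff, Set.mem_preimage]
        rw [eq_comm, MulAction.Quotient.smul_coe, QuotientGroup.eq, smul_eq_mul, mul_assoc]
        rfl
      rw [this]
      exact U.isOpen.preimage (by fun_prop)

end Basic

/-! ### Restriction, induction and coinduction of sets -/

section Change
variable {L H : Type v} [Group L] [TopologicalSpace L] [Group H] [TopologicalSpace H]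

/-- Pull back the action along a continuous homomorphism. -/
def res (i : L →* H) (hi : Continuous i) (X : FinGSet H) : FinGSet L where
  carrier := X
  action := MulAction.compHom X i
  isOpen_stabilizer x := (X.isOpen_stabilizer x).preimage hi

variable (i : L →* H)

/-- The equivalence relation `(h l, x) ~ (h, l x)` on `H × X`. -/
def indSetoid (X : FinGSet L) : Setoid (H × X) where
  r a b := ∃ l : L, a.1 = b.1 * i l ∧ b.2 = l • a.2
  iseqv :=
    ⟨fun _ => ⟨1, by simp⟩,
     fun {a b} ⟨l, h1, h2⟩ => ⟨l⁻¹, by simp [h1], by simp [h2]⟩,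
     fun {a b c} ⟨l, h1, h2⟩ ⟨m, h3, h4⟩ =>
      ⟨m * l, by rw [h1, h3, map_mul, mul_assoc], by rw [h4, h2, mul_smul]⟩⟩

instance indAction (X : FinGSet L) : MulAction H (Quotient (indSetoid i X)) where
  smul g := Quotient.map (fun a => (g * a.1, a.2))
    fun a b ⟨l, h1, h2⟩ => ⟨l, by simp [h1, mul_assoc], h2⟩
  one_smul q := Quotient.inductionOn q fun a => congrArg (Quotient.mk _) (by simp)
  mul_smul g h q := Quotient.inductionOn q fun a => congrArg (Quotient.mk _) (by simp [mul_assoc])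

theorem ind_smul_mk (X : FinGSet L) (g h : H) (x : X) :
    g • (Quotient.mk (indSetoid i X) (h, x)) = Quotient.mk (indSetoid i X) (g * h, x) := rfl

theorem ind_mk_eq {X : FinGSet L} {a b : H × X} :
    Quotient.mk (indSetoid i X) a = Quotient.mk (indSetoid i X) b ↔
      ∃ l : L, a.1 = b.1 * i l ∧ b.2 = l • a.2 := Quotient.eq

theorem isOpen_range (ho : IsOpenMap i) : IsOpen (i.range : Set H) := by
  rw [MonoidHom.coe_range]; exact ho.isOpen_range

/-- The `L`-equivariant maps `H → X`. -/
structure EquivariantMap (X : FinGSet L) : Type v where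
  toFun : H → X
  map_mul : ∀ (l : L) (h : H), toFun (i l * h) = l • toFun h

theorem EquivariantMap.ext' {X : FinGSet L} {f g : EquivariantMap i X} (h : ∀ x, f.1 x = g.1 x) :
    f = g := by
  cases f; cases g; congr; exact funext h

instance coindAction (X : FinGSet L) : MulAction H (EquivariantMap i X) where
  smul g f := ⟨fun h => f.1 (h * g), fun l h => by rw [mul_assoc, f.2]⟩
  one_smul f := EquivariantMap.ext' i fun h => congrArg f.1 (mul_one h)
  mul_smul g g' f := EquivariantMap.ext' i fun h => congrArg f.1 (mul_assoc h g g').symm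

theorem coind_smul_apply {X : FinGSet L} (g : H) (f : EquivariantMap i X) (h : H) :
    (g • f).1 h = f.1 (h * g) := rfl

theorem EquivariantMap.ext_out {X : FinGSet L} {f g : EquivariantMap i X}
    (h : ∀ c : H ⧸ i.range, f.1 c.out⁻¹ = g.1 c.out⁻¹) : f = g := by
  refine EquivariantMap.ext' i fun x => ?_
  obtain ⟨⟨_, l, rfl⟩, hr⟩ := QuotientGroup.mk_out_eq_mul i.range x⁻¹
  have hx : x = i l * ((x⁻¹ : H) : H ⧸ i.range).out⁻¹ := by
    rw [hr]; simp
  rw [hx, f.2, g.2, h]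

variable [IsTopologicalGroup H] [CompactSpace H]

theorem finite_quotient_range (ho : IsOpenMap i) : Finite (H ⧸ i.range) :=
  Subgroup.quotient_finite_of_isOpen _ (isOpen_range i ho)

/-- The induced `H`-set `H ×_L X` along an open homomorphism `i : L → H`. -/
def ind (ho : IsOpenMap i) (X : FinGSet L) : FinGSet H where
  carrier := Quotient (indSetoid i X)
  finite := by
    have := finite_quotient_range i ho
    refine Finite.of_surjective
      (fun p : (H ⧸ i.range) × X => Quotient.mk (indSetoid i X) (p.1.out, p.2)) fun q => ?_
    induction q using Quotient.inductionOn with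
    | h a =>
      obtain ⟨h, x⟩ := a
      obtain ⟨⟨_, l, rfl⟩, hr⟩ := QuotientGroup.mk_out_eq_mul i.range h
      refine ⟨((h : H ⧸ i.range), l⁻¹ • x), (ind_mk_eq i).2 ⟨l, hr, by simp⟩⟩
  isOpen_stabilizer q := by
    induction q using Quotient.inductionOn with
    | h a =>
      obtain ⟨h, x⟩ := a
      have hopen : IsOpen ((fun g => h⁻¹ * g * h) ⁻¹' (i '' (MulAction.stabilizer L x : Set L))) :=
        (ho _ (X.isOpen_stabilizer x)).preimage (by fun_prop)
      refine Subgroup.isOpen_of_mem_nhds _ (g := 1) (Filter.mem_of_superset (hopen.mem_nhds ?_) ?_)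
      · exact ⟨1, one_mem _, by simp⟩
      · rintro g ⟨l, hl, hg⟩
        change g • Quotient.mk (indSetoid i X) (h, x) = _
        rw [ind_smul_mk, ind_mk_eq]
        refine ⟨l, ?_, (MulAction.mem_stabilizer_iff.1 hl).symm⟩
        simp only at hg ⊢
        rw [hg]; group

/-- The coinduced `H`-set `Map_L(H, X)` along an open homomorphism `i : L → H`,
with `(g • f)(h) = f (h g)`. -/
def coind (ho : IsOpenMap i) (X : FinGSet L) : FinGSet H where
  carrier := EquivariantMap i X
  finite := by
    have := finite_quotient_range i ho
    exact Finite.of_injective (fun (f : EquivariantMap i X) (c : H ⧸ i.range) => f.1 c.out⁻¹)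
      fun f g h => EquivariantMap.ext_out i fun c => congrFun h c
  isOpen_stabilizer f := by
    have := finite_quotient_range i ho
    have hopen : IsOpen (⋂ c : H ⧸ i.range, (fun g : H => c.out⁻¹ * g * c.out) ⁻¹'
        (i '' (MulAction.stabilizer L (f.1 c.out⁻¹) : Set L))) :=
      isOpen_iInter_of_finite fun c => (ho _ (X.isOpen_stabilizer _)).preimage (by fun_prop)
    refine Subgroup.isOpen_of_mem_nhds _ (g := 1) (Filter.mem_of_superset (hopen.mem_nhds ?_) ?_)
    · exact Set.mem_iInter.2 fun c => ⟨1, one_mem _, by simp⟩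
    · intro g hg
      refine EquivariantMap.ext_out i fun c => ?_
      obtain ⟨l, hl, hlg⟩ := Set.mem_iInter.1 hg c
      simp only at hlg
      rw [coind_smul_apply, show c.out⁻¹ * g = i l * c.out⁻¹ by rw [hlg]; group, f.2]
      exact hl

end Change

end FinGSet

/-! ### The Burnside semiring -/

/-- Isomorphism classes of finite `H`-sets. -/
def BurnsideSemiring (H : Type v) [Group H] [TopologicalSpace H] : Type (v + 1) :=
  Quotient (FinGSet.setoid H)

namespace BurnsideSemiring
open FinGSet

section Basic
variable {H : Type v} [Group H] [TopologicalSpace H]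

/-- The isomorphism class of a finite `H`-set. -/
def mk (X : FinGSet H) : BurnsideSemiring H := Quotient.mk (FinGSet.setoid H) X

theorem mk_eq_mk {X Y : FinGSet H} : mk X = mk Y ↔ Nonempty (Iso X Y) := Quotient.eq

theorem mk_eq {X Y : FinGSet H} (e : Iso X Y) : mk X = mk Y := mk_eq_mk.2 ⟨e⟩

theorem ind_on {p : BurnsideSemiring H → Prop} (h : ∀ X, p (mk X)) (x) : p x :=
  Quotient.inductionOn x h

instance : Zero (BurnsideSemiring H) := ⟨mk (FinGSet.empty H)⟩
instance : One (BurnsideSemiring H) := ⟨mk (FinGSet.point H)⟩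
instance : Add (BurnsideSemiring H) :=
  ⟨Quotient.map₂ FinGSet.sum fun _ _ ⟨e⟩ _ _ ⟨f⟩ => ⟨⟨Equiv.sumCongr e.toEquiv f.toEquiv, by
    rintro h (x | y)
    · exact congrArg Sum.inl (e.map_smul h x)
    · exact congrArg Sum.inr (f.map_smul h y)⟩⟩⟩
instance : Mul (BurnsideSemiring H) :=
  ⟨Quotient.map₂ FinGSet.prod fun _ _ ⟨e⟩ _ _ ⟨f⟩ => ⟨⟨Equiv.prodCongr e.toEquiv f.toEquiv,
    fun h x => Prod.ext (e.map_smul h x.1) (f.map_smul h x.2)⟩⟩⟩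

theorem mk_add_mk (X Y : FinGSet H) : mk X + mk Y = mk (X.sum Y) := rfl
theorem mk_mul_mk (X Y : FinGSet H) : mk X * mk Y = mk (X.prod Y) := rfl

instance : CommSemiring (BurnsideSemiring H) where
  nsmul := nsmulRec
  add_assoc a b c := by
    induction a using ind_on with | _ X
    induction b using ind_on with | _ Y
    induction c using ind_on with | _ Z
    exact mk_eq ⟨Equiv.sumAssoc _ _ _, by rintro h ((x | x) | x) <;> rfl⟩
  zero_add a := by
    induction a using ind_on with | _ X
    exact mk_eq ⟨Equiv.emptySum PEmpty X, by rintro h (x | x); exacts [x.elim, rfl]⟩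
  add_zero a := by
    induction a using ind_on with | _ X
    exact mk_eq ⟨Equiv.sumEmpty X PEmpty, by rintro h (x | x); exacts [rfl, x.elim]⟩
  add_comm a b := by
    induction a using ind_on with | _ X
    induction b using ind_on with | _ Y
    exact mk_eq ⟨Equiv.sumComm _ _, by rintro h (x | x) <;> rfl⟩
  mul_assoc a b c := by
    induction a using ind_on with | _ X
    induction b using ind_on with | _ Y
    induction c using ind_on with | _ Z
    exact mk_eq ⟨Equiv.prodAssoc _ _ _, fun _ _ => rfl⟩
  one_mul a := by
    induction a using ind_on with | _ X
    exact mk_eq ⟨Equiv.punitProd X, fun _ _ => rfl⟩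
  mul_one a := by
    induction a using ind_on with | _ X
    exact mk_eq ⟨Equiv.prodPUnit X, fun _ _ => rfl⟩
  mul_comm a b := by
    induction a using ind_on with | _ X
    induction b using ind_on with | _ Y
    exact mk_eq ⟨Equiv.prodComm _ _, fun _ _ => rfl⟩
  left_distrib a b c := by
    induction a using ind_on with | _ X
    induction b using ind_on with | _ Y
    induction c using ind_on with | _ Z
    exact mk_eq ⟨Equiv.prodSumDistrib _ _ _, by rintro h ⟨x, y | y⟩ <;> rfl⟩
  right_distrib a b c := by
    induction a using ind_on with | _ X
    induction b using ind_on with | _ Y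
    induction c using ind_on with | _ Z
    exact mk_eq ⟨Equiv.sumProdDistrib _ _ _, by rintro h ⟨x | x, y⟩ <;> rfl⟩
  zero_mul a := by
    induction a using ind_on with | _ X
    exact mk_eq ⟨Equiv.pemptyProd X, fun _ x => x.1.elim⟩
  mul_zero a := by
    induction a using ind_on with | _ X
    exact mk_eq ⟨Equiv.prodPEmpty X, fun _ x => x.2.elim⟩

theorem mk_eq_zero (X : FinGSet H) (h : IsEmpty X) : mk X = 0 :=
  mk_eq ⟨Equiv.equivPEmpty X, fun _ x => h.elim x⟩

theorem mk_copies (j : ℕ) (Y : FinGSet H) : mk (copies (Fin j) Y) = j • mk Y := by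
  induction j with
  | zero => rw [zero_smul]; exact mk_eq_zero _ ⟨fun x => x.1.elim0⟩
  | succ j ih =>
    rw [succ_nsmul, ← ih, mk_add_mk]
    refine mk_eq (Iso.symm ⟨((Equiv.sumCongr (Equiv.refl _) (Equiv.punitProd.{0} Y).symm).trans
      (Equiv.sumProdDistrib (Fin j) PUnit.{1} Y).symm).trans
      (Equiv.prodCongr ((Equiv.sumCongr (Equiv.refl _) (Equiv.ofUnique _ _)).trans
        (finSumFinEquiv (m := j) (n := 1))) (Equiv.refl Y)), ?_⟩)
    rintro h (x | x) <;> rfl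

theorem mk_sub_congr (X : FinGSet H) (p q : X → Prop) (hp hq) (h : ∀ x, p x ↔ q x) :
    mk (X.sub p hp) = mk (X.sub q hq) := by
  obtain rfl : p = q := funext fun x => propext (h x)
  rfl

theorem mk_sub_or (X : FinGSet H) (p q r : X → Prop) (hp hq hr)
    (hd : ∀ x, p x → ¬ q x) (hpq : ∀ x, r x ↔ p x ∨ q x) :
    mk (X.sub r hr) = mk (X.sub p hp) + mk (X.sub q hq) := by
  rw [mk_add_mk]
  refine (mk_eq (Iso.ofBijective (X := (X.sub p hp).sum (X.sub q hq)) (Y := X.sub r hr)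
    (Sum.elim (fun x => ⟨x.1, (hpq _).2 (Or.inl x.2)⟩) (fun x => ⟨x.1, (hpq _).2 (Or.inr x.2)⟩))
    ⟨?_, ?_⟩ ?_)).symm
  · rintro (x | x) (y | y) hxy
    · exact congrArg Sum.inl (Subtype.ext (congrArg (fun z : {x // r x} => z.1) hxy : x.1 = y.1))
    · exact (hd x.1 x.2 ((Subtype.ext_iff.1 hxy : x.1 = y.1) ▸ y.2)).elim
    · exact (hd y.1 y.2 ((Subtype.ext_iff.1 hxy : x.1 = y.1) ▸ x.2)).elim
    · exact congrArg Sum.inr (Subtype.ext (congrArg (fun z : {x // r x} => z.1) hxy : x.1 = y.1))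
  · rintro ⟨x, hx⟩
    rcases (hpq x).1 hx with h | h
    · exact ⟨Sum.inl ⟨x, h⟩, rfl⟩
    · exact ⟨Sum.inr ⟨x, h⟩, rfl⟩
  · rintro h (x | x) <;> rfl

theorem mk_eq_sum_fibers {ι : Type*} [Fintype ι] [DecidableEq ι] (X : FinGSet H) (c : X → ι)
    (hc : ∀ (h : H) (x : X), c (h • x) = c x) :
    mk X = ∑ t, mk (X.sub (fun x => c x = t) fun h x => by rw [hc]) := by
  have key : ∀ s : Finset ι, mk (X.sub (fun x => c x ∈ s) fun h x => by rw [hc]) =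
      ∑ t ∈ s, mk (X.sub (fun x => c x = t) fun h x => by rw [hc]) := by
    intro s
    induction s using Finset.induction_on with
    | empty => exact mk_eq_zero _ ⟨fun x => by simpa using x.2⟩
    | insert t s hts ih =>
      rw [Finset.sum_insert hts, ← ih]
      exact mk_sub_or X _ _ _ _ _ _ (fun x h1 h2 => hts (h1 ▸ h2)) fun x => Finset.mem_insert
  rw [← key]
  exact mk_eq (Iso.symm (Iso.ofBijective (X := X.sub _ _) (fun x => x.1)
    ⟨fun x y h => Subtype.ext h, fun x => ⟨⟨x, Finset.mem_univ _⟩, rfl⟩⟩ fun _ _ => rfl))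

end Basic

section Change
variable {L H : Type v} [Group L] [TopologicalSpace L] [Group H] [TopologicalSpace H]

/-- Restriction of isomorphism classes. -/
def res (i : L →* H) (hi : Continuous i) : BurnsideSemiring H →+* BurnsideSemiring L where
  toFun := Quotient.map (FinGSet.res i hi) fun _ _ ⟨e⟩ => ⟨⟨e.toEquiv, fun h x => e.map_smul _ x⟩⟩
  map_zero' := mk_eq_zero _ (inferInstanceAs (IsEmpty PEmpty))
  map_one' := mk_eq ⟨Equiv.refl PUnit, fun _ _ => rfl⟩
  map_add' a b := by
    induction a using ind_on with | _ X
    induction b using ind_on with | _ Y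
    exact mk_eq ⟨Equiv.refl (X ⊕ Y), by rintro h (x | x) <;> rfl⟩
  map_mul' a b := by
    induction a using ind_on with | _ X
    induction b using ind_on with | _ Y
    exact mk_eq ⟨Equiv.refl (X × Y), fun _ _ => rfl⟩

variable [IsTopologicalGroup H] [CompactSpace H] (i : L →* H) (ho : IsOpenMap i)

theorem ind_congr {X Y : FinGSet L} (e : Iso X Y) : mk (ind i ho X) = mk (ind i ho Y) := by
  refine mk_eq ⟨Quotient.congr (Equiv.prodCongr (Equiv.refl H) e.toEquiv) ?_, ?_⟩
  · rintro ⟨a, x⟩ ⟨b, y⟩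
    refine exists_congr fun l => and_congr Iff.rfl ?_
    change y = l • x ↔ e.toEquiv y = l • e.toEquiv x
    rw [← e.map_smul, e.toEquiv.apply_eq_iff_eq]
  · intro h q
    induction q using Quotient.inductionOn with | _ a
    rfl

/-- Induction of isomorphism classes. -/
def ind : BurnsideSemiring L →+ BurnsideSemiring H where
  toFun := Quotient.lift (fun X => mk (FinGSet.ind i ho X)) fun _ _ ⟨e⟩ => ind_congr i ho e
  map_zero' := mk_eq_zero _ ⟨fun q => Quotient.inductionOn q fun a => a.2.elim⟩
  map_add' a b := by
    induction a using ind_on with | _ X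
    induction b using ind_on with | _ Y
    refine (mk_eq (Iso.ofBijective
      (X := (FinGSet.ind i ho X).sum (FinGSet.ind i ho Y)) (Y := FinGSet.ind i ho (X.sum Y))
      (Sum.elim
        (Quotient.map (fun a => (a.1, Sum.inl a.2))
          fun a b ⟨l, h1, h2⟩ => ⟨l, h1, congrArg Sum.inl h2⟩)
        (Quotient.map (fun a => (a.1, Sum.inr a.2))
          fun a b ⟨l, h1, h2⟩ => ⟨l, h1, congrArg Sum.inr h2⟩)) ⟨?_, ?_⟩ ?_)).symm
    · rintro (p | p) (q | q) <;> induction p using Quotient.inductionOn with | _ a <;>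
        induction q using Quotient.inductionOn with | _ b <;> intro h <;>
        obtain ⟨l, h1, h2⟩ := (ind_mk_eq i).1 h
      · exact congrArg Sum.inl ((ind_mk_eq i).2 ⟨l, h1, Sum.inl_injective h2⟩)
      · exact (Sum.inr_ne_inl h2).elim
      · exact (Sum.inl_ne_inr h2).elim
      · exact congrArg Sum.inr ((ind_mk_eq i).2 ⟨l, h1, Sum.inr_injective h2⟩)
    · intro q
      induction q using Quotient.inductionOn with | _ a
      obtain ⟨h, x | y⟩ := a
      · exact ⟨Sum.inl (Quotient.mk (indSetoid i X) (h, x)), rfl⟩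
      · exact ⟨Sum.inr (Quotient.mk (indSetoid i Y) (h, y)), rfl⟩
    · rintro h (q | q) <;> induction q using Quotient.inductionOn with | _ a <;> rfl

theorem coind_congr {X Y : FinGSet L} (e : Iso X Y) : mk (coind i ho X) = mk (coind i ho Y) := by
  refine mk_eq ⟨⟨fun f => ⟨fun h => e.toEquiv (f.1 h), fun l h => ?_⟩,
    fun f => ⟨fun h => e.toEquiv.symm (f.1 h), fun l h => ?_⟩, fun f => ?_, fun f => ?_⟩, ?_⟩
  · rw [f.2, e.map_smul]
  · rw [f.2]; exact e.symm.map_smul _ _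
  · exact EquivariantMap.ext' i fun h => e.toEquiv.symm_apply_apply _
  · exact EquivariantMap.ext' i fun h => e.toEquiv.apply_symm_apply _
  · intro h f; rfl

/-- Coinduction `X ↦ Map_L(H, X)` of isomorphism classes. -/
def coind : BurnsideSemiring L → BurnsideSemiring H :=
  Quotient.lift (fun X => mk (FinGSet.coind i ho X)) fun _ _ ⟨e⟩ => coind_congr i ho e

theorem coind_mk (X : FinGSet L) : coind i ho (mk X) = mk (FinGSet.coind i ho X) := rfl

end Change

end BurnsideSemiring

/-! ### Coinduction is a polynomial map -/

section Polynomial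
open FinGSet BurnsideSemiring
variable {L H : Type v} [Group L] [TopologicalSpace L] [Group H] [TopologicalSpace H]
  [IsTopologicalGroup H] [CompactSpace H] (i : L →* H) (ho : IsOpenMap i)

/-- The set of colours `k` such that `f` meets the copy of `Y` with colour `k`. -/
def colours {κ : Type} [Finite κ] {X Y : FinGSet L} (f : EquivariantMap i (X.sum (copies κ Y))) :
    Set κ := {k | ∃ h y, f.1 h = Sum.inr (k, y)}

theorem colours_smul {κ : Type} [Finite κ] {X Y : FinGSet L} (g : H)
    (f : EquivariantMap i (X.sum (copies κ Y))) : colours i (g • f) = colours i f := by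
  ext k
  constructor
  · rintro ⟨h, y, hy⟩
    exact ⟨h * g, y, hy⟩
  · rintro ⟨h, y, hy⟩
    refine ⟨h * g⁻¹, y, ?_⟩
    rw [coind_smul_apply, inv_mul_cancel_right, hy]

/-- The equivariant maps `H → X ⊔ (κ × Y)` in which exactly the colours in `T` occur. -/
def colourFiber (κ : Type) [Finite κ] (X Y : FinGSet L) (T : Set κ) : FinGSet H :=
  (FinGSet.coind i ho (X.sum (copies κ Y))).sub (fun f => colours i f = T)
    fun g f => ⟨fun h => (colours_smul i g f).symm.trans h, fun h => (colours_smul i g f).trans h⟩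

theorem colourFiber_eq {κ : Type} [Finite κ] (X Y : FinGSet L) {j : ℕ} (e : Fin j → κ)
    (he : Function.Injective e) :
    mk (colourFiber i ho κ X Y (Set.range e)) = mk (colourFiber i ho (Fin j) X Y Set.univ) := by
  let φ : (X.sum (copies (Fin j) Y)) → (X.sum (copies κ Y)) :=
    Sum.elim Sum.inl fun p => Sum.inr (e p.1, p.2)
  have φinj : Function.Injective φ := by
    rintro (x | ⟨k, y⟩) (x' | ⟨k', y'⟩) h
    · exact congrArg Sum.inl (Sum.inl_injective h)
    · exact (Sum.inl_ne_inr h).elim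
    · exact (Sum.inr_ne_inl h).elim
    · have := Prod.ext_iff.1 (Sum.inr_injective h)
      exact congrArg Sum.inr (Prod.ext (he this.1) this.2)
  have φsmul : ∀ (l : L) x, φ (l • x) = l • φ x := by
    rintro l (x | x) <;> rfl
  let Φ : EquivariantMap i (X.sum (copies (Fin j) Y)) → EquivariantMap i (X.sum (copies κ Y)) :=
    fun f => ⟨fun h => φ (f.1 h), fun l h => by rw [f.2, φsmul]⟩
  have Φcol : ∀ f, colours i (Φ f) = e '' colours i f := by
    intro f
    ext k
    constructor
    · rintro ⟨h, y, hy⟩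
      change φ (f.1 h) = _ at hy
      rcases hf : f.1 h with x | ⟨k', y'⟩
      · rw [hf] at hy; exact (Sum.inl_ne_inr hy).elim
      · rw [hf] at hy
        exact ⟨k', ⟨h, y', hf⟩, (Prod.ext_iff.1 (Sum.inr_injective hy)).1⟩
    · rintro ⟨k', ⟨h, y, hy⟩, rfl⟩
      exact ⟨h, y, by change φ (f.1 h) = _; rw [hy]; rfl⟩
  refine (mk_eq (Iso.ofBijective (X := colourFiber i ho (Fin j) X Y Set.univ)
    (Y := colourFiber i ho κ X Y (Set.range e))
    (fun f => ⟨Φ f.1, ?_⟩) ⟨?_, ?_⟩ ?_)).symm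
  · exact (Φcol f.1).trans (by rw [show colours i f.1 = Set.univ from f.2, Set.image_univ])
  · intro f g h
    have h' : Φ f.1 = Φ g.1 := Subtype.ext_iff.1 h
    exact Subtype.ext (EquivariantMap.ext' i fun x =>
      φinj (congrFun (congrArg EquivariantMap.toFun h') x))
  · rintro ⟨f, hf⟩
    have hex : ∀ h, ∃ z, φ z = f.1 h := by
      intro h
      rcases hfh : f.1 h with x | ⟨k, y⟩
      · exact ⟨Sum.inl x, rfl⟩
      · have hk : k ∈ colours i f := ⟨h, y, hfh⟩
        rw [show colours i f = Set.range e from hf] at hk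
        obtain ⟨m, rfl⟩ := hk
        exact ⟨Sum.inr (m, y), rfl⟩
    choose g hg using hex
    let g' : EquivariantMap i (X.sum (copies (Fin j) Y)) :=
      ⟨g, fun l h => φinj (by rw [hg, φsmul, hg, f.2])⟩
    have hΦ : Φ g' = f := EquivariantMap.ext' i hg
    refine ⟨⟨g', ?_⟩, Subtype.ext hΦ⟩
    refine he.image_injective ?_
    rw [← Φcol, hΦ, show colours i f = Set.range e from hf, Set.image_univ]
  · intro g f
    refine Subtype.ext (EquivariantMap.ext' i fun x => ?_)
    rfl

theorem colourFiber_eq_zero (X Y : FinGSet L) {j : ℕ} (hj : i.range.index < j) :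
    mk (colourFiber i ho (Fin j) X Y Set.univ) = 0 := by
  refine mk_eq_zero _ ⟨fun ⟨f, hf⟩ => ?_⟩
  have := finite_quotient_range i ho
  have hex : ∀ k : Fin j, ∃ c : H ⧸ i.range, ∃ y, f.1 c.out⁻¹ = Sum.inr (k, y) := by
    intro k
    obtain ⟨h, y, hy⟩ : k ∈ colours i f := by
      rw [show colours i f = Set.univ from hf]; trivial
    obtain ⟨⟨_, l, rfl⟩, hr⟩ := QuotientGroup.mk_out_eq_mul i.range h⁻¹
    refine ⟨(h⁻¹ : H), l⁻¹ • y, ?_⟩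
    rw [hr]
    have : (h⁻¹ * i l)⁻¹ = i l⁻¹ * h := by simp
    simp only [this]
    rw [f.2, hy]
    rfl
  choose c y hc using hex
  have hinj : Function.Injective c := by
    intro k k' h
    have := (hc k).symm.trans (h ▸ hc k')
    exact (Prod.ext_iff.1 (Sum.inr_injective this)).1
  have := Nat.card_le_card_of_injective c hinj
  rw [Nat.card_fin] at this
  exact absurd this (not_le.2 hj)

theorem coind_add_nsmul (a b : BurnsideSemiring L) : ∃ s : ℕ → BurnsideSemiring H,
    (∀ j, i.range.index < j → s j = 0) ∧
    ∀ m, BurnsideSemiring.coind i ho (a + m • b) =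
      ∑ j ∈ Finset.range (m + 1), m.choose j • s j := by
  induction a using ind_on with | _ X
  induction b using ind_on with | _ Y
  refine ⟨fun j => mk (colourFiber i ho (Fin j) X Y Set.univ),
    fun j hj => colourFiber_eq_zero i ho X Y hj, fun m => ?_⟩
  classical
  rw [← mk_copies, mk_add_mk, coind_mk,
    mk_eq_sum_fibers _ (fun f => (Set.toFinite (colours i f)).toFinset) fun g f =>
      Set.Finite.toFinset_inj.2 (colours_smul i g f)]
  have h2 := Finset.sum_powerset_apply_card
    (fun j => mk (colourFiber i ho (Fin j) X Y Set.univ)) (x := (Finset.univ : Finset (Fin m)))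
  rw [Finset.card_univ, Fintype.card_fin] at h2
  rw [← h2, Finset.powerset_univ]
  refine Finset.sum_congr rfl fun T _ => ?_
  rw [← colourFiber_eq i ho X Y (T.orderEmbOfFin rfl) (T.orderEmbOfFin rfl).injective]
  refine mk_sub_congr _ _ _ _ _ fun f => ?_
  rw [Finset.range_orderEmbOfFin, ← Finset.coe_inj, Set.Finite.coe_toFinset]

theorem sum_choose_mul_choose {n j : ℕ} (hj : j ≤ n) :
    ∑ m ∈ Finset.range (n + 2), ((-1 : ℤ) ^ m * (n + 1).choose m) * m.choose j = 0 := by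
  have h := fwdDiff_iter_choose_zero j (n + 1)
  rw [fwdDiff_iter_eq_sum_shift, if_neg (by omega)] at h
  have h2 : ∑ m ∈ Finset.range (n + 2), ((-1 : ℤ) ^ m * (n + 1).choose m) * m.choose j =
      (-1) ^ (n + 1) * ∑ k ∈ Finset.range (n + 1 + 1), ((-1 : ℤ) ^ (n + 1 - k) *
        (n + 1).choose k) • (((0 + k • 1 : ℕ).choose j : ℕ) : ℤ) := by
    rw [Finset.mul_sum]
    refine Finset.sum_congr rfl fun m hm => ?_
    have hm' : m ≤ n + 1 := by simpa [Nat.lt_succ_iff] using hm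
    have h3 : (-1 : ℤ) ^ (n + 1) * (-1) ^ (n + 1 - m) = (-1) ^ m := by
      conv_lhs => rw [← Nat.sub_add_cancel hm', pow_add]
      rw [Nat.sub_add_cancel hm', mul_right_comm, ← pow_add, ← two_mul, pow_mul]
      simp
    simp only [smul_eq_mul, mul_one, zero_add]
    rw [← h3]; ring
  rw [h2, h, mul_zero]

theorem isPolynomial_coind : GrothendieckRing.IsPolynomial i.range.index
    fun a : BurnsideSemiring L =>
      (GrothendieckRing.of (BurnsideSemiring.coind i ho a) :
        GrothendieckRing (BurnsideSemiring H)) := by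
  intro a b
  obtain ⟨s, hs, hm⟩ := coind_add_nsmul i ho a b
  set n := i.range.index
  have h1 : ∀ m ∈ Finset.range (n + 2),
      (GrothendieckRing.of (BurnsideSemiring.coind i ho (a + m • b)) :
        GrothendieckRing (BurnsideSemiring H)) =
      ∑ j ∈ Finset.range (n + 1), (m.choose j : ℤ) • GrothendieckRing.of (s j) := by
    intro m hmn
    rw [hm, map_sum]
    have h2 : ∀ j, GrothendieckRing.of (m.choose j • s j) =
        (m.choose j : ℤ) • GrothendieckRing.of (s j) := fun j => by
      rw [map_nsmul, natCast_zsmul]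
    simp only [h2]
    have hbig : ∀ k, m + 1 ≤ k → ∑ j ∈ Finset.range k,
        (m.choose j : ℤ) • (GrothendieckRing.of (s j)) = ∑ j ∈ Finset.range (m + 1),
        (m.choose j : ℤ) • (GrothendieckRing.of (s j)) := by
      intro k hk
      refine (Finset.sum_subset (Finset.range_mono hk) fun j _ hj => ?_).symm
      rw [Nat.choose_eq_zero_of_lt (by simpa using hj)]
      simp
    have hbig' : ∀ k, n + 1 ≤ k → ∑ j ∈ Finset.range k,
        (m.choose j : ℤ) • (GrothendieckRing.of (s j)) = ∑ j ∈ Finset.range (n + 1),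
        (m.choose j : ℤ) • (GrothendieckRing.of (s j)) := by
      intro k hk
      refine (Finset.sum_subset (Finset.range_mono hk) fun j _ hj => ?_).symm
      rw [hs j (by simpa using hj)]
      simp
    rw [← hbig (m + n + 1) (by omega), hbig' (m + n + 1) (by omega)]
  refine (Finset.sum_congr rfl fun m hmn => congrArg _ (h1 m hmn)).trans ?_
  simp only [Finset.smul_sum, smul_smul]
  rw [Finset.sum_comm]
  refine Finset.sum_eq_zero fun j hj => ?_
  rw [← Finset.sum_smul, sum_choose_mul_choose (by simpa [Nat.lt_succ_iff] using hj), zero_smul]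

end Polynomial

/-! ### The Burnside ring and its structure maps -/

/-- The Burnside ring `A(H)`: the Grothendieck ring of the semiring of isomorphism classes of
finite `H`-sets, with disjoint union and Cartesian product. -/
abbrev BurnsideRing (H : Type v) [Group H] [TopologicalSpace H] : Type (v + 1) :=
  GrothendieckRing (BurnsideSemiring H)

namespace BurnsideRing

/-- The class of a finite `H`-set in the Burnside ring. -/
noncomputable def cls {H : Type v} [Group H] [TopologicalSpace H] (X : FinGSet H) :
    BurnsideRing H :=
  GrothendieckRing.of (BurnsideSemiring.mk X)

open scoped Classical in
/-- The class `t_k` of the transitive `H`-set of cardinality `k`.  It is meant for procyclic `H`,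
where such a set is unique up to isomorphism and exists as soon as `H` has an open subgroup of
index `k`; the value is `0` if there is no such set. -/
noncomputable def t (H : Type v) [Group H] [TopologicalSpace H] (k : ℕ) : BurnsideRing H :=
  if h : ∃ X : FinGSet H, MulAction.IsPretransitive H X ∧ Nat.card X = k then cls h.choose else 0

variable {L H : Type v} [Group L] [TopologicalSpace L] [Group H] [TopologicalSpace H]

/-- Restriction along a continuous homomorphism. -/
noncomputable def res (i : L →* H) (hi : Continuous i) : BurnsideRing H →+ BurnsideRing L :=
  GrothendieckRing.lift (GrothendieckRing.of.comp (BurnsideSemiring.res i hi).toAddMonoidHom)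

variable [IsTopologicalGroup H] [CompactSpace H] (i : L →* H) (ho : IsOpenMap i)

/-- Transfer: the additive extension of `X ↦ H ×_L X`. -/
noncomputable def tr : BurnsideRing L →+ BurnsideRing H :=
  GrothendieckRing.lift (GrothendieckRing.of.comp (BurnsideSemiring.ind i ho))

/-- Norm: the extension of `X ↦ Map_L(H, X)` from `L`-sets to virtual `L`-sets as a polynomial
map, of degree at most the index of `L` in `H`. -/
noncomputable def norm : BurnsideRing L → BurnsideRing H :=
  GrothendieckRing.extend i.range.index _ (isPolynomial_coind i ho)

theorem res_cls (hi : Continuous i) (X : FinGSet H) : res i hi (cls X) = cls (X.res i hi) :=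
  GrothendieckRing.lift_of _ _

theorem tr_cls (X : FinGSet L) : tr i ho (cls X) = cls (X.ind i ho) :=
  GrothendieckRing.lift_of _ _

theorem norm_cls (X : FinGSet L) : norm i ho (cls X) = cls (X.coind i ho) :=
  GrothendieckRing.extend_of _ _

end BurnsideRing

/-! ### Ideals of the Burnside Tambara functor -/

section Tambara
variable {G : Type v} [Group G] [TopologicalSpace G] [IsTopologicalGroup G] [CompactSpace G]

instance (H : OpenSubgroup G) : CompactSpace H :=
  isCompact_iff_compactSpace.1 H.isClosed.isCompact

instance (H : OpenSubgroup G) : IsTopologicalGroup H :=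
  inferInstanceAs (IsTopologicalGroup H.toSubgroup)

variable {L H : OpenSubgroup G}

theorem continuous_inclusion (h : L ≤ H) : Continuous (SubgroupClass.inclusion h) :=
  _root_.continuous_inclusion h

theorem isOpenMap_inclusion (h : L ≤ H) : IsOpenMap (SubgroupClass.inclusion h) :=
  (L.isOpen.isOpenMap_inclusion h)

/-- The subgroup `H^g = g⁻¹ H g`. -/
def conjSubgroup (g : G) (H : OpenSubgroup G) : OpenSubgroup G :=
  H.comap (MulAut.conj g).toMonoidHom (by
    change Continuous fun x => g * x * g⁻¹
    fun_prop)

/-- The isomorphism `H^g → H`, `x ↦ g x g⁻¹`. -/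
def conjHom (g : G) (H : OpenSubgroup G) : conjSubgroup g H →* H where
  toFun x := ⟨g * x.1 * g⁻¹, x.2⟩
  map_one' := Subtype.ext (by simp)
  map_mul' x y := Subtype.ext (by simp [mul_assoc])

theorem continuous_conjHom (g : G) (H : OpenSubgroup G) : Continuous (conjHom g H) :=
  Continuous.subtype_mk (by fun_prop) _

/-- Restriction `A(H) → A(L)`. -/
noncomputable def resA (h : L ≤ H) : BurnsideRing H →+ BurnsideRing L :=
  BurnsideRing.res _ (continuous_inclusion h)

/-- Transfer `A(L) → A(H)`. -/
noncomputable def trA (h : L ≤ H) : BurnsideRing L →+ BurnsideRing H :=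
  BurnsideRing.tr _ (isOpenMap_inclusion h)

/-- Norm `A(L) → A(H)`. -/
noncomputable def normA (h : L ≤ H) : BurnsideRing L → BurnsideRing H :=
  BurnsideRing.norm _ (isOpenMap_inclusion h)

/-- Conjugation `A(H) → A(H^g)`. -/
noncomputable def conjA (g : G) (H : OpenSubgroup G) :
    BurnsideRing H →+ BurnsideRing (conjSubgroup g H) :=
  BurnsideRing.res _ (continuous_conjHom g H)

variable (G) in
/-- An ideal of the Burnside Tambara functor of `G`, given by its values at the transitive
`G`-sets `G / H`. -/
structure TambaraIdeal : Type (v + 1) where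
  ideal : ∀ H : OpenSubgroup G, Ideal (BurnsideRing H)
  res_mem : ∀ (L H : OpenSubgroup G) (h : L ≤ H) (x : BurnsideRing H),
    x ∈ ideal H → resA h x ∈ ideal L
  tr_mem : ∀ (L H : OpenSubgroup G) (h : L ≤ H) (x : BurnsideRing L),
    x ∈ ideal L → trA h x ∈ ideal H
  norm_mem : ∀ (L H : OpenSubgroup G) (h : L ≤ H) (x : BurnsideRing L),
    x ∈ ideal L → normA h x - normA h 0 ∈ ideal H
  conj_mem : ∀ (g : G) (H : OpenSubgroup G) (x : BurnsideRing H),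
    x ∈ ideal H → conjA g H x ∈ ideal (conjSubgroup g H)

variable (G) in
/-- Elements of the Burnside Tambara functor at the transitive `G`-sets. -/
abbrev TambaraElement : Type (v + 1) := Σ H : OpenSubgroup G, BurnsideRing H

/-- The Tambara ideal contains the given elements. -/
def TambaraIdeal.Contains (I : TambaraIdeal G) (S : Set (TambaraElement G)) : Prop :=
  ∀ x ∈ S, x.2 ∈ I.ideal x.1

/-- The Tambara ideal generated by `S`: the intersection of all Tambara ideals containing `S`. -/
noncomputable def tambaraSpan (S : Set (TambaraElement G)) : TambaraIdeal G where
  ideal H := ⨅ (I : TambaraIdeal G) (_ : I.Contains S), I.ideal H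
  res_mem L H h x hx := by
    simp only [Submodule.mem_iInf] at hx ⊢
    exact fun I hI => I.res_mem L H h x (hx I hI)
  tr_mem L H h x hx := by
    simp only [Submodule.mem_iInf] at hx ⊢
    exact fun I hI => I.tr_mem L H h x (hx I hI)
  norm_mem L H h x hx := by
    simp only [Submodule.mem_iInf] at hx ⊢
    exact fun I hI => I.norm_mem L H h x (hx I hI)
  conj_mem g H x hx := by
    simp only [Submodule.mem_iInf] at hx ⊢
    exact fun I hI => I.conj_mem g H x (hx I hI)

/-- The family `T` of additive subgroups of the Burnside rings is the Tambara ideal generated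
by `S`. -/
def IsGeneratedBy (T : ∀ H : OpenSubgroup G, AddSubgroup (BurnsideRing H))
    (S : Set (TambaraElement G)) : Prop :=
  ∀ H, T H = Submodule.toAddSubgroup ((tambaraSpan S).ideal H)

/-- The family `T` is a strongly principal Tambara ideal: it is generated by one element at
a transitive `G`-set. -/
def IsStronglyPrincipal (T : ∀ H : OpenSubgroup G, AddSubgroup (BurnsideRing H)) : Prop :=
  ∃ (H : OpenSubgroup G) (a : BurnsideRing H), IsGeneratedBy T {⟨H, a⟩}

end Tambara

/-! ### The Grothendieck-Witt group -/

theorem polarBilin_nondegenerate {E V : Type*} [Field E] [AddCommGroup V] [Module E V]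
    {Q : QuadraticForm E V} (h : Q.polarBilin.SeparatingLeft) : Q.polarBilin.Nondegenerate :=
  ⟨h, fun y hy => h y fun x => (QuadraticMap.polar_comm Q y x).trans (hy x)⟩

/-- A regular quadratic form on a finite-dimensional `E`-vector space. -/
structure QuadSpace (E : Type v) [Field E] : Type (v + 1) where
  (carrier : Type v)
  [addCommGroup : AddCommGroup carrier]
  [module : Module E carrier]
  [finite : FiniteDimensional E carrier]
  (form : QuadraticForm E carrier)
  (regular : form.polarBilin.Nondegenerate)

namespace QuadSpace
variable {E : Type v} [Field E]

instance : CoeSort (QuadSpace E) (Type v) := ⟨QuadSpace.carrier⟩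
instance (V : QuadSpace E) : AddCommGroup V := V.addCommGroup
instance (V : QuadSpace E) : Module E V := V.module
instance (V : QuadSpace E) : FiniteDimensional E V := V.finite

/-- Isometry of quadratic spaces. -/
instance setoid (E : Type v) [Field E] : Setoid (QuadSpace E) where
  r V W := V.form.Equivalent W.form
  iseqv := ⟨fun _ => .refl _, fun h => h.symm, fun h h' => h.trans h'⟩

/-- The orthogonal sum. -/
def sum (V W : QuadSpace E) : QuadSpace E where
  carrier := V × W
  form := V.form.prod W.form
  regular := polarBilin_nondegenerate <| by
    rintro ⟨x, y⟩ h
    refine Prod.ext (V.regular.1 x fun x' => ?_) (W.regular.1 y fun y' => ?_)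
    · simpa using h (x', 0)
    · simpa using h (0, y')

/-- The zero-dimensional form. -/
def zero (E : Type v) [Field E] : QuadSpace E where
  carrier := PUnit.{v + 1}
  form := 0
  regular := polarBilin_nondegenerate fun _ _ => rfl

end QuadSpace

/-- Isometry classes of regular quadratic forms over `E`. -/
def QuadClass (E : Type v) [Field E] : Type (v + 1) := Quotient (QuadSpace.setoid E)

namespace QuadClass
variable {E : Type v} [Field E]

/-- The isometry class of a quadratic space. -/
def mk (V : QuadSpace E) : QuadClass E := Quotient.mk (QuadSpace.setoid E) V

theorem mk_eq {V W : QuadSpace E} (e : V.form.IsometryEquiv W.form) : mk V = mk W :=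
  Quotient.sound ⟨e⟩

theorem ind_on {p : QuadClass E → Prop} (h : ∀ V, p (mk V)) (x) : p x :=
  Quotient.inductionOn x h

instance : Zero (QuadClass E) := ⟨mk (QuadSpace.zero E)⟩
instance : Add (QuadClass E) :=
  ⟨Quotient.map₂ QuadSpace.sum fun _ _ h _ _ h' => QuadraticMap.Equivalent.prod h h'⟩

instance : AddCommMonoid (QuadClass E) where
  nsmul := nsmulRec
  add_assoc a b c := by
    induction a using ind_on with | _ X
    induction b using ind_on with | _ Y
    induction c using ind_on with | _ Z
    exact mk_eq ⟨LinearEquiv.prodAssoc E X Y Z, fun x => (add_assoc _ _ _).symm⟩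
  add_comm a b := by
    induction a using ind_on with | _ X
    induction b using ind_on with | _ Y
    exact mk_eq (QuadraticMap.IsometryEquiv.prodComm _ _)
  zero_add a := by
    induction a using ind_on with | _ X
    exact mk_eq (V := (QuadSpace.zero E).sum X) ⟨LinearEquiv.uniqueProd (R := E) (M := X) (M₂ := PUnit.{v + 1}),
      fun x => (zero_add _).symm⟩
  add_zero a := by
    induction a using ind_on with | _ X
    exact mk_eq (V := X.sum (QuadSpace.zero E)) ⟨LinearEquiv.prodUnique (R := E) (M := X) (M₂ := PUnit.{v + 1}),
      fun x => (add_zero _).symm⟩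

end QuadClass

/-- The additive group of the Grothendieck-Witt ring of `E`.  The multiplication plays no role for
the kernels of maps into it. -/
abbrev GW (E : Type v) [Field E] : Type (v + 1) := GrothendieckAddGroup (QuadClass E)

/-! ### Trace forms and the Dress map -/

/-- The trace form `x ↦ tr_{M/E}(x²)` of a finite separable extension `M / E`. -/
noncomputable def traceQuadSpace (E : Type v) (M : Type v) [Field E] [Field M] [Algebra E M]
    [FiniteDimensional E M] [Algebra.IsSeparable E M] [NeZero (2 : E)] : QuadSpace E where
  carrier := M
  form := (Algebra.traceForm E M).toQuadraticMap
  regular := polarBilin_nondegenerate <| by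
    intro x hx
    refine (traceForm_nondegenerate E M).1 x fun y => ?_
    have h := hx y
    rw [LinearMap.BilinMap.polarBilin_toQuadraticMap, LinearMap.add_apply, LinearMap.add_apply,
      LinearMap.flip_apply, Algebra.traceForm_apply, Algebra.traceForm_apply, mul_comm y x,
      ← two_mul] at h
    exact (mul_eq_zero.1 h).resolve_left (NeZero.ne _)

theorem traceQuadSpace_congr {E M M' : Type v} [Field E] [Field M] [Algebra E M]
    [FiniteDimensional E M] [Algebra.IsSeparable E M] [NeZero (2 : E)] [Field M'] [Algebra E M']
    [FiniteDimensional E M'] [Algebra.IsSeparable E M'] (e : M ≃ₐ[E] M') :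
    QuadClass.mk (traceQuadSpace E M) = QuadClass.mk (traceQuadSpace E M') :=
  QuadClass.mk_eq ⟨e.toLinearEquiv, fun (x : M) => by
    change Algebra.trace E M' (e x * e x) = Algebra.trace E M (x * x)
    rw [← map_mul, Algebra.trace_eq_of_algEquiv]⟩

section Dress
variable (F : Type u) (K : Type v) [Field F] [Field K] [Algebra F K] [IsGalois F K]
  [NeZero (2 : F)]

/-- The field `K^H`. -/
abbrev fixedFld (H : OpenSubgroup Gal(K/F)) : IntermediateField F K :=
  IntermediateField.fixedField H.toSubgroup

variable {F K}

instance (E : IntermediateField F K) : NeZero (2 : E) := by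
  constructor
  have h := (map_ne_zero (algebraMap F E)).2 (NeZero.ne (2 : F))
  rwa [map_ofNat] at h

theorem fixedFld_mono {L H : OpenSubgroup Gal(K/F)} (h : L ≤ H) : fixedFld F K H ≤ fixedFld F K L :=
  fun _ hx g => hx ⟨g.1, h g.2⟩

/-- The field `K^L`, as an extension of `K^H`, for `L ≤ H`. -/
abbrev fixedExt {L H : OpenSubgroup Gal(K/F)} (h : L ≤ H) :
    IntermediateField (fixedFld F K H) K :=
  IntermediateField.extendScalars (fixedFld_mono h)

instance (L : OpenSubgroup Gal(K/F)) : FiniteDimensional F (fixedFld F K L) := by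
  rw [← InfiniteGalois.isOpen_iff_finite,
    InfiniteGalois.fixingSubgroup_fixedField ⟨L.toSubgroup, L.isClosed⟩]
  exact L.isOpen

instance {L H : OpenSubgroup Gal(K/F)} (h : L ≤ H) :
    FiniteDimensional (fixedFld F K H) (fixedExt h) := by
  have : FiniteDimensional F (fixedExt h) :=
    inferInstanceAs (FiniteDimensional F (fixedFld F K L))
  exact FiniteDimensional.right F (fixedFld F K H) (fixedExt h)

/-- The isometry class of the trace form of `K^L / K^H`. -/
noncomputable def traceClass {L H : OpenSubgroup Gal(K/F)} (h : L ≤ H) :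
    QuadClass (fixedFld F K H) :=
  QuadClass.mk (traceQuadSpace (fixedFld F K H) (fixedExt h))

/-- The stabilizer of a point of a finite `H`-set, as an open subgroup of the Galois group. -/
def stab {H : OpenSubgroup Gal(K/F)} (X : FinGSet H) (x : X) : OpenSubgroup Gal(K/F) where
  toSubgroup := (MulAction.stabilizer H x).map H.toSubgroup.subtype
  isOpen' := by
    have h := H.isOpen.isOpenMap_subtype_val _ (X.isOpen_stabilizer x)
    exact h

theorem stab_le {H : OpenSubgroup Gal(K/F)} (X : FinGSet H) (x : X) : stab X x ≤ H := by
  rintro _ ⟨h, -, rfl⟩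
  exact h.2

/-- The class of the trace form of `K^{H_x} / K^H`. -/
noncomputable def pointClass {H : OpenSubgroup Gal(K/F)} (X : FinGSet H) (x : X) :
    QuadClass (fixedFld F K H) :=
  traceClass (stab_le X x)

theorem mem_fixedExt_smul {H : OpenSubgroup Gal(K/F)} (X : FinGSet H) (g : H) (x : X) {a : K}
    (ha : a ∈ fixedExt (stab_le X x)) : g.1 a ∈ fixedExt (stab_le X (g • x)) := by
  rintro ⟨_, s, hs, rfl⟩
  have h1 : g⁻¹ * s * g ∈ MulAction.stabilizer H x := by
    rw [MulAction.mem_stabilizer_iff, mul_smul, mul_smul,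
      MulAction.mem_stabilizer_iff.1 hs, inv_smul_smul]
  have h2 : (g⁻¹ * s * g : H).1 a = a := ha ⟨_, ⟨_, h1, rfl⟩⟩
  have h3 : (s * g : H).1 a = (g * (g⁻¹ * s * g) : H).1 a := by
    rw [show g * (g⁻¹ * s * g) = s * g by group]
  change s.1 (g.1 a) = g.1 a
  change s.1 (g.1 a) = g.1 ((g⁻¹ * s * g : H).1 a) at h3
  rw [h3, h2]

/-- The isomorphism `K^{H_x} ≃ K^{H_{gx}}` over `K^H` given by `g ∈ H`. -/
def fixedExtEquiv {H : OpenSubgroup Gal(K/F)} (X : FinGSet H) (g : H) (x : X) :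
    fixedExt (stab_le X x) ≃ₐ[fixedFld F K H] fixedExt (stab_le X (g • x)) where
  toFun a := ⟨g.1 a.1, mem_fixedExt_smul X g x a.2⟩
  invFun a := ⟨(g⁻¹).1 a.1, by
    have h := mem_fixedExt_smul X g⁻¹ (g • x) a.2
    rwa [inv_smul_smul] at h⟩
  left_inv a := Subtype.ext (g.1.symm_apply_apply a.1)
  right_inv a := Subtype.ext (g.1.apply_symm_apply a.1)
  map_mul' a b := Subtype.ext (map_mul g.1 a.1 b.1)
  map_add' a b := Subtype.ext (map_add g.1 a.1 b.1)
  commutes' a := Subtype.ext (a.2 ⟨g.1, g.2⟩)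

theorem pointClass_smul {H : OpenSubgroup Gal(K/F)} (X : FinGSet H) (g : H) (x : X) :
    pointClass X (g • x) = pointClass X x :=
  (traceQuadSpace_congr (fixedExtEquiv X g x)).symm

theorem stab_eq {H : OpenSubgroup Gal(K/F)} {X Y : FinGSet H} (f : X → Y)
    (hf : Function.Injective f) (hs : ∀ (h : H) x, f (h • x) = h • f x) (x : X) :
    stab Y (f x) = stab X x := by
  refine OpenSubgroup.toSubgroup_injective ?_
  change (MulAction.stabilizer H (f x)).map _ = (MulAction.stabilizer H x).map _
  congr 1
  ext h
  rw [MulAction.mem_stabilizer_iff, MulAction.mem_stabilizer_iff, ← hs, hf.eq_iff]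

theorem pointClass_eq {H : OpenSubgroup Gal(K/F)} {X Y : FinGSet H} (f : X → Y)
    (hf : Function.Injective f) (hs : ∀ (h : H) x, f (h • x) = h • f x) (x : X) :
    pointClass Y (f x) = pointClass X x := by
  unfold pointClass
  congr 1
  exact stab_eq f hf hs x

/-- The class attached to the orbit of a point `x`, that is, to the transitive set `H / H_x`:
the class of the trace form of `K^{H_x} / K^H`. -/
noncomputable def orbitClass {H : OpenSubgroup Gal(K/F)} (X : FinGSet H) :
    MulAction.orbitRel.Quotient H X → QuadClass (fixedFld F K H) :=
  Quotient.lift (pointClass X) fun _ y ⟨g, hg⟩ => hg ▸ pointClass_smul X g y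

instance {H : Type v} [Group H] [TopologicalSpace H] (X : FinGSet H) :
    Finite (MulAction.orbitRel.Quotient H X) :=
  Quotient.finite _

/-- The sum of the trace forms `K^{H_x} / K^H` over the orbits of `X`. -/
noncomputable def setClass {H : OpenSubgroup Gal(K/F)} (X : FinGSet H) :
    QuadClass (fixedFld F K H) :=
  ∑ᶠ ω : MulAction.orbitRel.Quotient H X, orbitClass X ω

theorem setClass_iso {H : OpenSubgroup Gal(K/F)} {X Y : FinGSet H} (e : FinGSet.Iso X Y) :
    setClass X = setClass Y := by
  let E : MulAction.orbitRel.Quotient H X ≃ MulAction.orbitRel.Quotient H Y :=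
    Quotient.congr e.toEquiv fun a b => by
      constructor
      · rintro ⟨g, hg⟩
        exact ⟨g, (e.map_smul g b).symm.trans (congrArg _ hg)⟩
      · rintro ⟨g, hg⟩
        exact ⟨g, e.toEquiv.injective ((e.map_smul g b).trans hg)⟩
  refine finsum_eq_of_bijective E E.bijective fun ω => ?_
  induction ω using Quotient.inductionOn with | _ x
  exact (pointClass_eq e.toEquiv e.toEquiv.injective e.map_smul x).symm

theorem setClass_sum {H : OpenSubgroup Gal(K/F)} (X Y : FinGSet H) :
    setClass (X.sum Y) = setClass X + setClass Y := by
  let φ : MulAction.orbitRel.Quotient H X ⊕ MulAction.orbitRel.Quotient H Y →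
      MulAction.orbitRel.Quotient H (X.sum Y) :=
    Sum.elim
      (Quotient.map Sum.inl fun a b ⟨g, hg⟩ => ⟨g, congrArg Sum.inl hg⟩)
      (Quotient.map Sum.inr fun a b ⟨g, hg⟩ => ⟨g, congrArg Sum.inr hg⟩)
  have hφ : Function.Bijective φ := by
    constructor
    · rintro (p | p) (q | q) <;> induction p using Quotient.inductionOn with | _ a <;>
        induction q using Quotient.inductionOn with | _ b <;> intro h <;>
        obtain ⟨g, hg⟩ := Quotient.exact h
      · exact congrArg Sum.inl (Quotient.sound ⟨g, Sum.inl_injective hg⟩)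
      · exact (Sum.inr_ne_inl hg).elim
      · exact (Sum.inl_ne_inr hg).elim
      · exact congrArg Sum.inr (Quotient.sound ⟨g, Sum.inr_injective hg⟩)
    · intro q
      induction q using Quotient.inductionOn with | _ a
      obtain x | y := a
      · exact ⟨Sum.inl (Quotient.mk _ x), rfl⟩
      · exact ⟨Sum.inr (Quotient.mk _ y), rfl⟩
  have h1 : setClass (X.sum Y) = ∑ᶠ p, Sum.elim (orbitClass X) (orbitClass Y) p := by
    refine (finsum_eq_of_bijective φ hφ fun p => ?_).symm
    rcases p with p | p <;> induction p using Quotient.inductionOn with | _ x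
    · exact (pointClass_eq (Y := X.sum Y) Sum.inl Sum.inl_injective (fun _ _ => rfl) x).symm
    · exact (pointClass_eq (Y := X.sum Y) Sum.inr Sum.inr_injective (fun _ _ => rfl) x).symm
  have := Fintype.ofFinite (MulAction.orbitRel.Quotient H X)
  have := Fintype.ofFinite (MulAction.orbitRel.Quotient H Y)
  rw [h1, finsum_eq_sum_of_fintype, Fintype.sum_sum_type]
  simp only [setClass, finsum_eq_sum_of_fintype, Sum.elim_inl, Sum.elim_inr]

variable (F K)

/-- The Dress map `D_H : A(H) → GW(K^H)`: the additive map which sends the class of a transitive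
`H`-set `H / L` to the class of the trace form `x ↦ tr(x²)` of `K^L / K^H`. -/
noncomputable def dressMap (H : OpenSubgroup Gal(K/F)) : BurnsideRing H →+ GW (fixedFld F K H) :=
  GrothendieckRing.lift (GrothendieckAddGroup.of.comp
    { toFun := Quotient.lift setClass fun _ _ ⟨e⟩ => setClass_iso e
      map_zero' := by
        have : IsEmpty (MulAction.orbitRel.Quotient H (FinGSet.empty H)) :=
          ⟨fun q => Quotient.inductionOn q fun x => x.elim⟩
        exact finsum_of_isEmpty _
      map_add' := fun a b => Quotient.inductionOn₂ a b setClass_sum })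

/-- The trace ideal of `K / F`: the family of the kernels of the Dress maps. -/
noncomputable def traceIdeal (H : OpenSubgroup Gal(K/F)) : AddSubgroup (BurnsideRing H) :=
  (dressMap F K H).ker

end Dress

/-! ### Finite fields -/

/-- Algebraic extensions of finite fields are Galois. -/
instance (priority := 50) isGalois_of_isAlgebraic (F : Type u) (K : Type v) [Field F] [Finite F] [Field K]
    [Algebra F K] [Algebra.IsAlgebraic F K] : IsGalois F K := by
  have : Normal F K := by
    refine ⟨fun x => ?_⟩
    have : FiniteDimensional F (IntermediateField.adjoin F {x}) :=
      IntermediateField.adjoin.finiteDimensional (Algebra.IsAlgebraic.isAlgebraic x).isIntegral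
    have : Finite (IntermediateField.adjoin F {x}) := Module.finite_of_finite F
    have h := Normal.splits (inferInstance : Normal F (IntermediateField.adjoin F {x}))
      (IntermediateField.AdjoinSimple.gen F x)
    rw [IntermediateField.minpoly_gen] at h
    have h2 := h.map (algebraMap (IntermediateField.adjoin F {x}) K)
    rwa [Polynomial.map_map, ← IsScalarTower.algebraMap_eq] at h2
  exact ⟨⟩

/-- `Q` is a quadratic closure of `F` (of characteristic not two): an algebraic extension in which
every element is a square, and minimal with this property. -/
class IsQuadraticClosure (F : Type u) (Q : Type v) [Field F] [Field Q] [Algebra F Q] : Prop where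
  isAlgebraic : Algebra.IsAlgebraic F Q
  isSquare : ∀ x : Q, IsSquare x
  eq_top : ∀ E : IntermediateField F Q, (∀ x : E, IsSquare x) → E = ⊤

attribute [instance] IsQuadraticClosure.isAlgebraic
attribute [instance] IsAlgClosure.isAlgebraic

open BurnsideRing in
/-- The element `X₂` of `A(H)`, where `μ` is the exponent of two in `N`. -/
noncomputable def twoPart (N : ℕ) (H : Type v) [Group H] [TopologicalSpace H] : BurnsideRing H :=
  if 2 ≤ N.factorization 2 then t H 4 - t H 2 - 2
  else 2 * (N.factorization 2 : BurnsideRing H) * (t H 2 - 2)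

/-- The element `X₂ + ∑ (t_p - p)` of `A(H)`, the sum being over the odd primes `p ∣ N`. -/
noncomputable def finiteGenerator (N : ℕ) (H : Type v) [Group H] [TopologicalSpace H] :
    BurnsideRing H :=
  twoPart N H + ∑ p ∈ N.primeFactors.erase 2, (BurnsideRing.t H p - (p : BurnsideRing H))

/-- The number `2 ^ min(μ, 2) * ∏ p`, with `μ` the exponent of two in `N` and the product over
the odd primes `p ∣ N`. -/
def hatOrder (N : ℕ) : ℕ := 2 ^ min (N.factorization 2) 2 * ∏ p ∈ N.primeFactors.erase 2, p

section Generators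
variable (G : Type v) [Group G] [TopologicalSpace G] [IsTopologicalGroup G] [CompactSpace G]

/-- The elements `t_4 - t_2 - 2 ∈ A(H)`, for `H` open in `G` of index `2 ^ n` with `n ≥ 0`. -/
def twoAdicGenerators : Set (TambaraElement G) :=
  {x | ∃ (n : ℕ) (H : OpenSubgroup G), H.toSubgroup.index = 2 ^ n ∧
    x = ⟨H, BurnsideRing.t H 4 - BurnsideRing.t H 2 - 2⟩}

/-- The elements `t_p - p ∈ A(H)`, for `p` an odd prime and `H` open in `G` of index `p ^ n` with
`n ≥ 0`. -/
def oddGenerators : Set (TambaraElement G) :=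
  {x | ∃ (p n : ℕ) (H : OpenSubgroup G), p.Prime ∧ p ≠ 2 ∧ H.toSubgroup.index = p ^ n ∧
    x = ⟨H, BurnsideRing.t H p - (p : BurnsideRing H)⟩}

end Generators

end TraceIdeal

open TraceIdeal

/-! Over a finite field of odd characteristic a regular form is determined, even in the
Grothendieck-Witt group, by its rank and its determinant modulo squares, which form a group of order
two. The discriminant of an extension of degree `k` is the square of the determinant of a matrix of
conjugates, on which Frobenius acts by the sign of a `k`-cycle, so it is a square exactly when `k`
is odd. A topological generator acts on a transitive set with `k` elements by that same sign. Hence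
the Dress map records the rank of a virtual set and the sign of a topological generator, and the
trace ideal is the family `signKernel` of virtual sets of rank zero and trivial sign
(`traceIdeal_eq_signKernel`). What remains concerns procyclic groups only.

The family is a Tambara ideal for every compact group (`signIdeal`), so whatever its elements
generate stays inside it. Conversely (`TambaraIdeal.signKernel_le`), suppose that a Tambara ideal
inside the family contains `t_p - p` for odd primes `p`, `t_4 - t_2 - 2` and `2 (t_2 - 2)` at every
level where such transitive sets exist. Transfers then reduce each `t_k` to `k` or, for even `k`, to
`k + (t_2 - 2)`. So every virtual set is congruent to some `a + b (t_2 - 2)`; rank zero gives `a =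
0`, trivial sign gives `b` even, and such an element is in the ideal.

These basic elements must be obtained from the stated generators. Identities are tested on marks:
the numbers of fixed points of the powers `g ^ m`, `m ≠ 0`, of a topological generator determine an
element (`eq_of_mark_eq`), and restriction, transfer and norm along prime index have simple formulas
on marks. In the infinite cases restriction along an index prime to `p` preserves `t_p`, so levels
of `p`-power index suffice. In the finite case restricting the single generator to the subgroup of
order `p`, or of order `2 ^ min(μ, 2)`, isolates one summand. It is lifted to larger subgroups one
prime index at a time as `N(x) - tr(y x)` (`TambaraIdeal.mem_of_norm`), where the multiplier `y`
comes from Fermat's little theorem or is explicit when the index is the prime of the summand. -/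

namespace TraceIdeal

/-! ### Procyclic groups -/

section Procyclic
variable {G : Type v} [Group G] [TopologicalSpace G] {g : G}

/-- The element `g` is a topological generator of `G`. -/
def IsTopGen (g : G) : Prop := Dense (Subgroup.zpowers g : Set G)

theorem IsTopGen.exists_zpow_mem (hg : IsTopGen g) {W : Set G} (hW : IsOpen W) (hne : W.Nonempty) :
    ∃ k : ℤ, g ^ k ∈ W := by
  obtain ⟨x, hx, k, hk⟩ := hg.inter_open_nonempty W hW hne
  exact ⟨k, by simpa only [hk] using hx⟩

/-- Density is used once for each variable: continuous maps into a Hausdorff space that agree on the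
powers of `g` agree everywhere. -/
theorem IsTopGen.mul_comm [IsTopologicalGroup G] [T2Space G] (hg : IsTopGen g) (a b : G) :
    a * b = b * a := by
  have h1 : ∀ k : ℤ, ∀ x : G, g ^ k * x = x * g ^ k := by
    intro k x
    have : (fun x => g ^ k * x) = fun x => x * g ^ k := by
      refine Continuous.ext_on hg (by fun_prop) (by fun_prop) ?_
      rintro _ ⟨m, rfl⟩
      exact ((Commute.refl g).zpow_zpow k m)
    exact congrFun this x
  have : (fun x => x * b) = fun x => b * x := by
    refine Continuous.ext_on hg (by fun_prop) (by fun_prop) ?_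
    rintro _ ⟨m, rfl⟩
    exact h1 m b
  exact congrFun this a

variable [IsTopologicalGroup G]

theorem IsTopGen.exists_zpow_inv_mul_mem (hg : IsTopGen g) {U : Subgroup G}
    (hU : IsOpen (U : Set G)) (x : G) : ∃ k : ℤ, x⁻¹ * g ^ k ∈ U := by
  obtain ⟨k, hk⟩ := hg.exists_zpow_mem (W := (fun y => x⁻¹ * y) ⁻¹' (U : Set G))
    (hU.preimage (by fun_prop)) ⟨x, by simp⟩
  exact ⟨k, hk⟩

theorem IsTopGen.exists_zpow_smul_eq (hg : IsTopGen g) {X : Type*} [MulAction G X] (x : X)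
    (hx : IsOpen (MulAction.stabilizer G x : Set G)) (h : G) : ∃ k : ℤ, g ^ k • x = h • x := by
  obtain ⟨k, hk⟩ := hg.exists_zpow_inv_mul_mem hx h
  exact ⟨k, by rwa [MulAction.mem_stabilizer_iff, mul_smul, inv_smul_eq_iff] at hk⟩

/-- A topological generator acts on a transitive set through a single cycle. -/
theorem IsTopGen.zpow_smul_eq_iff (hg : IsTopGen g) {X : Type*} [MulAction G X]
    [MulAction.IsPretransitive G X] (x : X)
    (hx : IsOpen (MulAction.stabilizer G x : Set G)) (k : ℤ) :
    g ^ k • x = x ↔ (Nat.card X : ℤ) ∣ k := by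
  have h1 : MulAction.orbit (Subgroup.zpowers g) x = Set.univ := by
    refine Set.eq_univ_of_forall fun q => ?_
    obtain ⟨h, rfl⟩ := MulAction.exists_smul_eq G x q
    obtain ⟨j, hj⟩ := hg.exists_zpow_smul_eq x hx h
    exact ⟨⟨g ^ j, j, rfl⟩, hj⟩
  have h3 : MulAction.period g x = Nat.card X := by
    rw [MulAction.period_eq_minimalPeriod, ← Nat.card_zmod (Function.minimalPeriod _ _),
      ← Nat.card_congr (MulAction.orbitZPowersEquiv g x), h1]
    exact Nat.card_congr (Equiv.Set.univ _)
  rw [MulAction.zpow_smul_eq_iff_period_dvd, h3]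

theorem stabilizer_coe_one (U : Subgroup G) :
    MulAction.stabilizer G ((1 : G) : G ⧸ U) = U := by
  ext x
  rw [MulAction.mem_stabilizer_iff, MulAction.Quotient.smul_coe, eq_comm, QuotientGroup.eq]
  simp

/-- The powers of a topological generator in an open subgroup. -/
theorem IsTopGen.zpow_mem_iff (hg : IsTopGen g) {U : Subgroup G} (hU : IsOpen (U : Set G))
    (k : ℤ) : g ^ k ∈ U ↔ (U.index : ℤ) ∣ k := by
  have h := hg.zpow_smul_eq_iff ((1 : G) : G ⧸ U) (by rwa [stabilizer_coe_one]) k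
  rwa [← MulAction.mem_stabilizer_iff, stabilizer_coe_one] at h

/-- An open subgroup is determined by the powers of `g` in it, and these are read off from its
index. -/
theorem IsTopGen.le_iff (hg : IsTopGen g) {U V : Subgroup G} (hU : IsOpen (U : Set G))
    (hV : IsOpen (V : Set G)) : U ≤ V ↔ V.index ∣ U.index := by
  refine ⟨fun h => Subgroup.index_dvd_of_le h, fun h u hu => ?_⟩
  -- Approximating `u` modulo `U ⊓ V` keeps the power of `g` in `U` and lets membership in `V` pass
  -- back to `u`.
  obtain ⟨k, hk⟩ := hg.exists_zpow_inv_mul_mem (U := U ⊓ V) (hU.inter hV) u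
  have h1 : g ^ k ∈ U := by
    have := U.mul_mem hu hk.1
    rwa [mul_inv_cancel_left] at this
  have h2 : g ^ k ∈ V := by
    rw [hg.zpow_mem_iff hU] at h1
    rw [hg.zpow_mem_iff hV]
    exact (Int.natCast_dvd_natCast.2 h).trans h1
  have h3 := V.mul_mem h2 (V.inv_mem hk.2)
  rwa [mul_inv_rev, inv_inv, mul_inv_cancel_left] at h3

theorem IsTopGen.eq_of_index_eq (hg : IsTopGen g) {U V : Subgroup G} (hU : IsOpen (U : Set G))
    (hV : IsOpen (V : Set G)) (h : U.index = V.index) : U = V :=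
  le_antisymm ((hg.le_iff hU hV).2 (dvd_of_eq h.symm)) ((hg.le_iff hV hU).2 (dvd_of_eq h))

/-- The subgroup generated by `U` and `g ^ d` works: since `d` divides the index of `U`, the powers
of `g` in it are those with exponent divisible by `d`. -/
theorem IsTopGen.exists_index_eq [T2Space G] (hg : IsTopGen g) {U : Subgroup G}
    (hU : IsOpen (U : Set G)) {d : ℕ} (hd : d ∣ U.index) :
    ∃ V : Subgroup G, IsOpen (V : Set G) ∧ U ≤ V ∧ V.index = d := by
  have hn : U.Normal := ⟨fun n hn x => by rwa [hg.mul_comm x n, mul_inv_cancel_right]⟩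
  have ho : IsOpen ((U ⊔ Subgroup.zpowers (g ^ d) : Subgroup G) : Set G) :=
    Subgroup.isOpen_mono le_sup_left hU
  refine ⟨_, ho, le_sup_left, ?_⟩
  have key : ∀ k : ℤ, ((U ⊔ Subgroup.zpowers (g ^ d)).index : ℤ) ∣ k ↔ (d : ℤ) ∣ k := by
    intro k
    rw [← hg.zpow_mem_iff ho]
    constructor
    · intro h
      obtain ⟨u, hu, _, ⟨j, rfl⟩, huj⟩ := Subgroup.mem_sup_of_normal_left.1 h
      have h1 : g ^ (k - d * j) ∈ U := by
        rw [zpow_sub, ← huj, zpow_mul, zpow_natCast]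
        simpa using hu
      rw [hg.zpow_mem_iff hU] at h1
      have h2 := (Int.natCast_dvd_natCast.2 hd).trans h1
      exact (dvd_sub_left (dvd_mul_right _ _)).1 h2
    · rintro ⟨j, rfl⟩
      refine Subgroup.mem_sup_right ⟨j, ?_⟩
      simp [zpow_mul]
  exact Nat.dvd_antisymm (Int.natCast_dvd_natCast.1 ((key d).2 dvd_rfl))
    (Int.natCast_dvd_natCast.1 ((key _).1 dvd_rfl))

/-- The topological generator `g ^ [G : H]` of an open subgroup `H`. -/
noncomputable def genOf (hg : IsTopGen g) (H : OpenSubgroup G) : H :=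
  ⟨g ^ H.toSubgroup.index, by
    have := (hg.zpow_mem_iff H.isOpen H.toSubgroup.index).2 dvd_rfl
    rwa [zpow_natCast] at this⟩

/-- A power of `g` that lies in `H` has exponent divisible by the index of `H`, so it is a power of
`genOf hg H`. -/
theorem isTopGen_genOf (hg : IsTopGen g) (H : OpenSubgroup G) : IsTopGen (genOf hg H) := by
  refine dense_iff_inter_open.2 fun W hW ⟨x, hx⟩ => ?_
  obtain ⟨k, y, hy, hk⟩ := hg.exists_zpow_mem (H.isOpen.isOpenMap_subtype_val _ hW)
    ⟨_, x, hx, rfl⟩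
  have h1 : g ^ k ∈ H.toSubgroup := hk ▸ y.2
  obtain ⟨j, rfl⟩ := (hg.zpow_mem_iff H.isOpen k).1 h1
  refine ⟨y, hy, j, Subtype.ext ?_⟩
  rw [hk]
  change ((genOf hg H ^ j : H) : G) = _
  rw [SubgroupClass.coe_zpow, genOf, zpow_mul, zpow_natCast]

end Procyclic

/-! ### Marks -/

section Marks
open FinGSet BurnsideRing
variable {H : Type v} [Group H] [TopologicalSpace H]

theorem BurnsideRing.exists_eq_cls_sub (x : BurnsideRing H) :
    ∃ X Y : FinGSet H, x = cls X - cls Y := by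
  obtain ⟨a, b, rfl⟩ := GrothendieckRing.exists_eq_sub x
  induction a using BurnsideSemiring.ind_on with | _ X
  induction b using BurnsideSemiring.ind_on with | _ Y
  exact ⟨X, Y, rfl⟩

theorem BurnsideRing.cls_add (X Y : FinGSet H) : cls X + cls Y = cls (X.sum Y) :=
  (map_add GrothendieckRing.of (BurnsideSemiring.mk X) (BurnsideSemiring.mk Y)).symm

theorem BurnsideRing.cls_mul (X Y : FinGSet H) : cls X * cls Y = cls (X.prod Y) :=
  GrothendieckRing.of_mul_of _ _

theorem BurnsideRing.cls_eq {X Y : FinGSet H} (e : Iso X Y) : cls X = cls Y :=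
  congrArg GrothendieckRing.of (BurnsideSemiring.mk_eq e)

/-- The number of fixed points of `h` on a finite `H`-set. -/
noncomputable def fixCount (h : H) (X : FinGSet H) : ℕ := Nat.card {x : X // h • x = x}

/-- The mark at `h`: the additive extension of the number of fixed points of `h`. -/
noncomputable def mark (h : H) : BurnsideRing H →+ ℤ :=
  GrothendieckRing.lift
    { toFun := Quotient.lift (fun X => (fixCount h X : ℤ)) fun X Y ⟨e⟩ => by
        refine congrArg _ (Nat.card_congr (e.toEquiv.subtypeEquiv fun x => ?_))
        rw [← e.map_smul, e.toEquiv.apply_eq_iff_eq]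
      map_zero' := by
        change (Nat.card {x : PEmpty // _} : ℤ) = 0
        simp
      map_add' := fun a b => by
        induction a using BurnsideSemiring.ind_on with | _ X
        induction b using BurnsideSemiring.ind_on with | _ Y
        change ((Nat.card {x : X ⊕ Y // h • x = x} : ℕ) : ℤ) =
          ((Nat.card {x : X // h • x = x} : ℕ) : ℤ) + ((Nat.card {x : Y // h • x = x} : ℕ) : ℤ)
        rw [Nat.card_congr Equiv.subtypeSum, Nat.card_sum, Nat.cast_add]
        simp only [Sum.smul_inl, Sum.smul_inr, Sum.inl.injEq, Sum.inr.injEq] }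

theorem mark_cls (h : H) (X : FinGSet H) : mark h (cls X) = fixCount h X :=
  GrothendieckRing.lift_of _ _

theorem mark_mul (h : H) (x y : BurnsideRing H) : mark h (x * y) = mark h x * mark h y := by
  have key : ∀ X Y : FinGSet H, mark h (cls X * cls Y) = mark h (cls X) * mark h (cls Y) := by
    intro X Y
    rw [cls_mul, mark_cls, mark_cls, mark_cls, ← Nat.cast_mul, fixCount, fixCount, fixCount,
      ← Nat.card_prod]
    refine congrArg _ (Nat.card_congr ((Equiv.subtypeEquivRight fun x => ?_).trans
      (Equiv.subtypeProdEquivProd (p := fun x : X => h • x = x) (q := fun y : Y => h • y = y))))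
    exact Prod.ext_iff
  obtain ⟨X, Y, rfl⟩ := exists_eq_cls_sub x
  obtain ⟨Z, W, rfl⟩ := exists_eq_cls_sub y
  simp only [sub_mul, mul_sub, map_sub, key]

theorem mark_one (h : H) : mark h 1 = 1 := by
  change mark h (cls (point H)) = 1
  rw [mark_cls, fixCount, Nat.cast_eq_one, Nat.card_eq_one_iff_unique]
  exact ⟨⟨fun _ _ => Subtype.ext rfl⟩, ⟨⟨PUnit.unit, rfl⟩⟩⟩

/-- The mark at `h` as a ring homomorphism. -/
noncomputable def markHom (h : H) : BurnsideRing H →+* ℤ where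
  __ := mark h
  map_one' := mark_one h
  map_mul' := mark_mul h

theorem mark_natCast (h : H) (n : ℕ) : mark h (n : BurnsideRing H) = n :=
  map_natCast (markHom h) n

theorem mark_intCast (h : H) (n : ℤ) : mark h (n : BurnsideRing H) = n :=
  map_intCast (markHom h) n

theorem mark_ofNat (h : H) (n : ℕ) [n.AtLeastTwo] :
    mark h (OfNat.ofNat n : BurnsideRing H) = OfNat.ofNat n :=
  map_ofNat (markHom h) n

theorem mark_res {L : Type v} [Group L] [TopologicalSpace L] (i : L →* H) (hi : Continuous i)
    (l : L) (x : BurnsideRing H) : mark l (BurnsideRing.res i hi x) = mark (i l) x := by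
  obtain ⟨X, Y, rfl⟩ := exists_eq_cls_sub x
  have h : ∀ X : FinGSet H, BurnsideRing.res i hi (cls X) = cls (X.res i hi) :=
    fun X => GrothendieckRing.lift_of _ _
  simp only [map_sub, h, mark_cls]
  rfl

/-! ### Transitive sets -/

variable (H) in
/-- There is a transitive `H`-set with `k` elements, `k` positive. -/
def IsTransCard (k : ℕ) : Prop :=
  k ≠ 0 ∧ ∃ X : FinGSet H, MulAction.IsPretransitive H X ∧ Nat.card X = k

/-- Transitive sets with the same stabilizer are isomorphic. -/
theorem FinGSet.nonempty_iso_of_stabilizer_eq (X Y : FinGSet H) [MulAction.IsPretransitive H X]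
    [MulAction.IsPretransitive H Y] (x : X) (y : Y)
    (h : MulAction.stabilizer H x = MulAction.stabilizer H y) : Nonempty (Iso X Y) := by
  have h1 : ∀ a b : H, a • x = b • x ↔ a • y = b • y := by
    intro a b
    have h2 : b⁻¹ * a ∈ MulAction.stabilizer H x ↔ b⁻¹ * a ∈ MulAction.stabilizer H y := by rw [h]
    rwa [MulAction.mem_stabilizer_iff, MulAction.mem_stabilizer_iff, mul_smul, mul_smul,
      inv_smul_eq_iff, inv_smul_eq_iff] at h2
  choose c hc using fun z : X => MulAction.exists_smul_eq H x z
  refine ⟨Iso.ofBijective (fun z => c z • y) ⟨fun z w hzw => ?_, fun w => ?_⟩ fun k z => ?_⟩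
  · rw [← hc z, ← hc w]; exact (h1 _ _).2 hzw
  · obtain ⟨a, rfl⟩ := MulAction.exists_smul_eq H y w
    exact ⟨a • x, (h1 _ _).1 (hc _)⟩
  · rw [← mul_smul]
    exact (h1 _ _).1 (by rw [hc, mul_smul, hc])

variable [IsTopologicalGroup H] {g : H}

/-- The cardinality is the index of a stabilizer, and an open subgroup of a procyclic group is
determined by its index. -/
theorem cls_eq_of_card_eq (hg : IsTopGen g) (X Y : FinGSet H) [MulAction.IsPretransitive H X]
    [MulAction.IsPretransitive H Y] (h : Nat.card X = Nat.card Y) : cls X = cls Y := by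
  -- The empty set also counts as pretransitive and has no base point, so it is treated apart.
  by_cases hX : Nonempty X
  · obtain ⟨x⟩ := hX
    have hY : Nonempty Y := by
      have : Nonempty X := ⟨x⟩
      rw [← Finite.card_pos_iff, ← h]
      exact Nat.card_pos
    obtain ⟨y⟩ := hY
    obtain ⟨e⟩ := nonempty_iso_of_stabilizer_eq X Y x y
      (hg.eq_of_index_eq (X.isOpen_stabilizer x) (Y.isOpen_stabilizer y) (by
        rw [MulAction.index_stabilizer_of_transitive, MulAction.index_stabilizer_of_transitive, h]))
    exact cls_eq e
  · have h0 : IsEmpty X := not_nonempty_iff.1 hX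
    have h1 : IsEmpty Y := by
      rw [← Finite.card_eq_zero_iff, ← h]; simp
    exact (congrArg GrothendieckRing.of ((BurnsideSemiring.mk_eq_zero X h0).trans
      (BurnsideSemiring.mk_eq_zero Y h1).symm))

theorem t_eq_cls (hg : IsTopGen g) (X : FinGSet H) [hX : MulAction.IsPretransitive H X] {k : ℕ}
    (hk : Nat.card X = k) : t H k = cls X := by
  have h : ∃ X : FinGSet H, MulAction.IsPretransitive H X ∧ Nat.card X = k := ⟨X, hX, hk⟩
  rw [t, dif_pos h]
  have := h.choose_spec.1
  exact cls_eq_of_card_eq hg _ _ (h.choose_spec.2.trans hk.symm)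

/-- The generator acts as a single cycle, so `g ^ m` fixes every point or none. -/
theorem fixCount_of_transitive (hg : IsTopGen g) (X : FinGSet H) [MulAction.IsPretransitive H X]
    (m : ℕ) : fixCount (g ^ m) X = if Nat.card X ∣ m then Nat.card X else 0 := by
  have h1 : ∀ x : X, g ^ m • x = x ↔ Nat.card X ∣ m := by
    intro x
    have := hg.zpow_smul_eq_iff x (X.isOpen_stabilizer x) m
    rwa [zpow_natCast, Int.natCast_dvd_natCast] at this
  rw [fixCount]
  simp only [h1]
  split_ifs with h
  · exact Nat.card_congr (Equiv.subtypeUnivEquiv fun _ => h)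
  · rw [Finite.card_eq_zero_iff]
    exact ⟨fun x => h x.2⟩

theorem IsTransCard.mark_t (hg : IsTopGen g) {k : ℕ} (hk : IsTransCard H k) (m : ℕ) :
    mark (g ^ m) (t H k) = if k ∣ m then (k : ℤ) else 0 := by
  obtain ⟨-, X, hX, rfl⟩ := hk
  rw [t_eq_cls hg X rfl, mark_cls, fixCount_of_transitive hg]
  split_ifs <;> simp

/-- The Burnside ring of a procyclic group is additively generated by the classes `t_k`. -/
theorem closure_t_eq_top (hg : IsTopGen g) :
    AddSubgroup.closure (t H '' {k | IsTransCard H k}) = ⊤ := by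
  have key : ∀ n : ℕ, ∀ X : FinGSet H, Nat.card X = n →
      cls X ∈ AddSubgroup.closure (t H '' {k | IsTransCard H k}) := by
    intro n
    induction n using Nat.strong_induction_on with | _ n ih
    intro X hX
    by_cases hne : IsEmpty X
    · have h0 : cls X = 0 :=
        (congrArg GrothendieckRing.of (BurnsideSemiring.mk_eq_zero X hne)).trans (map_zero _)
      rw [h0]; exact zero_mem _
    · obtain ⟨x⟩ := not_isEmpty_iff.1 hne
      -- Splitting off one orbit, which is a transitive set, leaves a smaller set for the induction.
      have hp : ∀ (h : H) (y : X), h • y ∈ MulAction.orbit H x ↔ y ∈ MulAction.orbit H x :=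
        fun h y => by
          rw [← MulAction.orbit_eq_iff, MulAction.orbit_smul, MulAction.orbit_eq_iff]
      let Y := X.sub (fun y => y ∈ MulAction.orbit H x) hp
      let Z := X.sub (fun y => y ∉ MulAction.orbit H x) fun h y => not_congr (hp h y)
      have hYZ : cls X = cls Y + cls Z := by
        rw [cls_add]
        refine (cls_eq (Iso.ofBijective (X := Y.sum Z) (Y := X)
          (Sum.elim (fun y => y.1) fun y => y.1) ⟨?_, fun y => ?_⟩ ?_)).symm
        · rintro (⟨y, hy⟩ | ⟨y, hy⟩) (⟨z, hz⟩ | ⟨z, hz⟩) hyz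
          · exact congrArg Sum.inl (Subtype.ext hyz)
          · exact (hz ((show y = z from hyz) ▸ hy)).elim
          · exact (hy ((show y = z from hyz) ▸ hz)).elim
          · exact congrArg Sum.inr (Subtype.ext hyz)
        · by_cases hy : y ∈ MulAction.orbit H x
          · exact ⟨Sum.inl ⟨y, hy⟩, rfl⟩
          · exact ⟨Sum.inr ⟨y, hy⟩, rfl⟩
        · rintro h (y | y) <;> rfl
      have hY : MulAction.IsPretransitive H Y := by
        refine ⟨?_⟩
        rintro ⟨y, a, rfl⟩ ⟨z, b, rfl⟩
        refine ⟨b * a⁻¹, Subtype.ext ?_⟩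
        change (b * a⁻¹) • a • x = b • x
        rw [← mul_smul, inv_mul_cancel_right]
      have hne : Nonempty Y := ⟨⟨x, MulAction.mem_orbit_self x⟩⟩
      have hcard : Nat.card Z < n := by
        rw [← hX]
        refine Finite.card_subtype_lt (x := x) ?_
        exact not_not.2 (MulAction.mem_orbit_self x)
      rw [hYZ, ← t_eq_cls hg Y rfl]
      exact add_mem (AddSubgroup.subset_closure ⟨_, ⟨Nat.card_pos.ne', Y, hY, rfl⟩, rfl⟩)
        (ih _ hcard Z rfl)
  rw [eq_top_iff]
  intro x _
  obtain ⟨X, Y, rfl⟩ := exists_eq_cls_sub x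
  exact sub_mem (key _ X rfl) (key _ Y rfl)

/-- The marks at the powers of a topological generator determine an element. -/
theorem eq_of_mark_eq (hg : IsTopGen g) {x y : BurnsideRing H}
    (h : ∀ m : ℕ, m ≠ 0 → mark (g ^ m) x = mark (g ^ m) y) : x = y := by
  have key : ∀ x : BurnsideRing H, (∀ m : ℕ, m ≠ 0 → mark (g ^ m) x = 0) → x = 0 := by
    intro x hx
    have h1 : x ∈ Submodule.span ℤ (t H '' {k | IsTransCard H k}) := by
      rw [← Submodule.mem_toAddSubgroup, Submodule.span_int_eq_addSubgroupClosure,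
        closure_t_eq_top hg]
      trivial
    obtain ⟨l, hl, rfl⟩ := (Finsupp.mem_span_image_iff_linearCombination ℤ).1 h1
    rw [Finsupp.mem_supported] at hl
    have h2 : ∀ m : ℕ, m ≠ 0 → ∑ k ∈ l.support, l k * (if k ∣ m then (k : ℤ) else 0) = 0 := by
      intro m hm
      refine Eq.trans ?_ (hx m hm)
      rw [Finsupp.linearCombination_apply, Finsupp.sum, map_sum]
      refine Finset.sum_congr rfl fun k hk => ?_
      rw [map_zsmul, IsTransCard.mark_t hg (hl hk), smul_eq_mul]
    have h3 : l = 0 := by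
      by_contra hne
      have hs : l.support.Nonempty := Finsupp.support_nonempty_iff.2 hne
      -- The table of marks is triangular for divisibility. At the exponent `k`, the least element
      -- of the support, a nonzero term must have index dividing `k`, so only the term of `k`
      -- survives.
      set k := l.support.min' hs with hkdef
      have hk : k ∈ l.support := Finset.min'_mem _ _
      have hk0 : k ≠ 0 := (hl hk).1
      have h4 := h2 k hk0
      rw [Finset.sum_eq_single_of_mem k hk] at h4
      · rw [if_pos dvd_rfl] at h4
        rcases mul_eq_zero.1 h4 with h5 | h5
        · exact Finsupp.mem_support_iff.1 hk h5
        · exact hk0 (by exact_mod_cast h5)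
      · intro j hj hjk
        rw [if_neg, mul_zero]
        intro hd
        exact hjk (le_antisymm (Nat.le_of_dvd (Nat.pos_of_ne_zero hk0) hd)
          (Finset.min'_le _ _ hj))
    rw [h3, map_zero]
  rw [← sub_eq_zero]
  exact key _ fun m hm => by rw [map_sub, h m hm, sub_self]

end Marks

/-! ### Induced and coinduced sets in coordinates -/

section Coordinates
open FinGSet BurnsideRing
variable {L H : Type v} [Group L] [TopologicalSpace L] [Group H] [TopologicalSpace H]
  (i : L →* H)

theorem exists_cocycle (h : H) (c : H ⧸ i.range) :
    ∃ l : L, i l = (h • c).out⁻¹ * h * c.out := by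
  have h1 : (h • c).out⁻¹ * h * c.out ∈ i.range := by
    rw [mul_assoc, ← QuotientGroup.eq, QuotientGroup.out_eq']
    conv_lhs => rw [← QuotientGroup.out_eq' c]
    rfl
  exact h1

/-- The cocycle `(h c)⁻¹ h c` for the chosen representatives of the cosets. -/
noncomputable def cocycle (h : H) (c : H ⧸ i.range) : L := (exists_cocycle i h c).choose

theorem map_cocycle (h : H) (c : H ⧸ i.range) :
    i (cocycle i h c) = (h • c).out⁻¹ * h * c.out := (exists_cocycle i h c).choose_spec

/-- In coordinates a coinduced action permutes the cosets and twists by the cocycle; fixed points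
and signs are computed from this form. -/
theorem coind_smul_coord {X : FinGSet L} (f : EquivariantMap i X) (h : H) (c : H ⧸ i.range) :
    (h • f).1 c.out⁻¹ = cocycle i h (h⁻¹ • c) • f.1 (h⁻¹ • c).out⁻¹ := by
  rw [coind_smul_apply, ← f.2, map_cocycle, smul_inv_smul, mul_inv_cancel_right]

variable {i} (hi : Function.Injective i)
include hi

/-- The inverses of the chosen representatives form a fundamental domain for `L` acting on `H`, so
values on them can be prescribed freely. Injectivity of `i` makes the translating element of `L`
unique, which gives equivariance. -/
theorem bijective_coind_coord (X : FinGSet L) :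
    Function.Bijective fun (f : EquivariantMap i X) (c : H ⧸ i.range) => f.1 c.out⁻¹ := by
  refine ⟨fun f g h => EquivariantMap.ext_out i fun c => congrFun h c, fun F => ?_⟩
  have h1 : ∀ h : H, ∃ l : L, i l = h * ((h⁻¹ : H) : H ⧸ i.range).out := by
    intro h
    have : h * ((h⁻¹ : H) : H ⧸ i.range).out ∈ i.range := by
      have h2 := QuotientGroup.eq.1 (QuotientGroup.out_eq' ((h⁻¹ : H) : H ⧸ i.range)).symm
      rwa [inv_inv] at h2
    exact this
  choose l hl using h1
  refine ⟨⟨fun h => l h • F (h⁻¹ : H), fun m h => ?_⟩, funext fun c => ?_⟩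
  · have h2 : (((i m * h)⁻¹ : H) : H ⧸ i.range) = (h⁻¹ : H) := by
      rw [QuotientGroup.eq]
      exact ⟨m, by group⟩
    have h3 : l (i m * h) = m * l h := hi (by rw [map_mul, hl, hl, h2, mul_assoc])
    rw [h2, h3, mul_smul]
  · have h2 : (((c.out⁻¹)⁻¹ : H) : H ⧸ i.range) = c := by rw [inv_inv, QuotientGroup.out_eq']
    have h3 : l c.out⁻¹ = 1 := hi (by rw [hl, h2, map_one, inv_mul_cancel])
    change l c.out⁻¹ • F ((c.out⁻¹)⁻¹ : H) = F c
    rw [h2, h3, one_smul]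

theorem bijective_ind_coord (X : FinGSet L) :
    Function.Bijective fun p : (H ⧸ i.range) × X =>
      (Quotient.mk (indSetoid i X) (p.1.out, p.2)) := by
  constructor
  · rintro ⟨c, x⟩ ⟨d, y⟩ h
    obtain ⟨l, h1, h2⟩ := (ind_mk_eq i).1 h
    simp only at h1 h2
    have hcd : c = d := by
      rw [← QuotientGroup.out_eq' c, ← QuotientGroup.out_eq' d, eq_comm, QuotientGroup.eq]
      exact ⟨l, by rw [h1]; group⟩
    subst hcd
    have hl : l = 1 := hi (by rwa [map_one, ← mul_eq_left (a := c.out), eq_comm])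
    rw [h2, hl, one_smul]
  · intro q
    induction q using Quotient.inductionOn with | h a
    obtain ⟨h, x⟩ := a
    obtain ⟨⟨_, l, rfl⟩, hr⟩ := QuotientGroup.mk_out_eq_mul i.range h
    exact ⟨((h : H ⧸ i.range), l⁻¹ • x), (ind_mk_eq i).2 ⟨l, hr, by simp⟩⟩

omit hi in
theorem ind_smul_coord {X : FinGSet L} (h : H) (c : H ⧸ i.range) (x : X) :
    h • (Quotient.mk (indSetoid i X) (c.out, x)) =
      Quotient.mk (indSetoid i X) ((h • c).out, cocycle i h c • x) := by
  rw [ind_smul_mk, ind_mk_eq]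
  exact ⟨cocycle i h c, by rw [map_cocycle]; group, rfl⟩

variable [IsTopologicalGroup H] [CompactSpace H] (ho : IsOpenMap i)
  (hc : ∀ a b : H, a * b = b * a)
include hc

omit hi [IsTopologicalGroup H] [CompactSpace H] in
theorem map_smul_quotient_range (l : L) (c : H ⧸ i.range) : i l • c = c := by
  rw [← QuotientGroup.out_eq' c]
  change ((i l * c.out : H) : H ⧸ i.range) = _
  rw [eq_comm, QuotientGroup.eq, hc (i l), inv_mul_cancel_left]
  exact ⟨l, rfl⟩

/-- For commutative `H` the image of `L` fixes all cosets and commutes with their representatives,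
so `i l` acts by `l` in every coordinate. -/
theorem cocycle_map (l : L) (c : H ⧸ i.range) : cocycle i (i l) c = l :=
  hi (by rw [map_cocycle, map_smul_quotient_range hc, mul_assoc, hc (i l), inv_mul_cancel_left])

/-- As an `L`-set, `H ×_L X` is a disjoint union of copies of `X`, one for each coset, because `H`
is commutative. -/
theorem mark_map_tr (l : L) (x : BurnsideRing L) :
    mark (i l) (tr i ho x) = i.range.index * mark l x := by
  have key : ∀ X : FinGSet L, fixCount (i l) (X.ind i ho) = i.range.index * fixCount l X := by
    intro X
    rw [fixCount, fixCount, Subgroup.index, ← Nat.card_prod]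
    refine Nat.card_congr (Equiv.symm ?_)
    refine Equiv.trans ?_ ((Equiv.ofBijective _ (bijective_ind_coord hi X)).subtypeEquiv
      (p := fun p => l • p.2 = p.2) fun p => ?_)
    · exact ⟨fun p => ⟨(p.1, p.2.1), p.2.2⟩, fun p => (p.1.1, ⟨p.1.2, p.2⟩), fun _ => rfl,
        fun _ => rfl⟩
    · rw [Equiv.ofBijective_apply]
      have h1 := ind_smul_coord (i := i) (i l) p.1 p.2
      rw [map_smul_quotient_range hc, cocycle_map hi hc] at h1
      have h2 : (i l • (Quotient.mk (indSetoid i X) (p.1.out, p.2)) =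
        Quotient.mk (indSetoid i X) (p.1.out, p.2)) ↔ (p.1, l • p.2) = (p.1, p.2) := by
        rw [h1]
        exact (bijective_ind_coord hi X).1.eq_iff (a := (p.1, l • p.2)) (b := (p.1, p.2))
      rw [Prod.ext_iff] at h2
      exact ⟨fun h => h2.2 ⟨rfl, h⟩, fun h => (h2.1 h).2⟩
  obtain ⟨X, Y, rfl⟩ := exists_eq_cls_sub x
  rw [map_sub, map_sub, map_sub, tr_cls, tr_cls, mark_cls, mark_cls, mark_cls, mark_cls, key, key]
  push_cast
  ring

omit hi in
-- Such an `h` moves every coset of the commutative group `H`, hence every point of an induced set.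
theorem mark_tr_of_notMem {h : H} (hh : h ∉ i.range) (x : BurnsideRing L) :
    mark h (tr i ho x) = 0 := by
  have key : ∀ X : FinGSet L, fixCount h (X.ind i ho) = 0 := by
    intro X
    rw [fixCount, Nat.card_eq_zero]
    refine Or.inl ⟨fun ⟨q, hq⟩ => ?_⟩
    obtain ⟨⟨a, x⟩, rfl⟩ := Quotient.exists_rep q
    obtain ⟨l, h1, -⟩ := (ind_mk_eq i).1 hq
    simp only at h1
    exact hh ⟨l, by rwa [hc, mul_left_cancel_iff, eq_comm] at h1⟩
  obtain ⟨X, Y, rfl⟩ := exists_eq_cls_sub x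
  rw [map_sub, map_sub, tr_cls, tr_cls, mark_cls, mark_cls, key, key]
  simp

/-- As an `L`-set, the coinduced set is a power of `X` with one factor for each coset. -/
theorem fixCount_map_coind (l : L) (X : FinGSet L) :
    fixCount (i l) (X.coind i ho) = fixCount l X ^ i.range.index := by
  have := finite_quotient_range i ho
  rw [fixCount, fixCount, Subgroup.index, ← Nat.card_fun]
  refine Nat.card_congr (Equiv.trans
    ((Equiv.ofBijective _ (bijective_coind_coord hi X)).subtypeEquiv
      (q := fun F : H ⧸ i.range → X => ∀ c, l • F c = F c) fun f => ?_) ?_)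
  · rw [Equiv.ofBijective_apply]
    have h2 : ∀ c : H ⧸ i.range, (i l • f).1 c.out⁻¹ = l • f.1 c.out⁻¹ := by
      intro c
      have h1 := coind_smul_coord i f (i l) c
      rwa [← map_inv, map_smul_quotient_range hc, cocycle_map hi hc] at h1
    constructor
    · intro h c
      rw [← h2]
      exact congrArg (fun f : EquivariantMap i X => f.1 c.out⁻¹) h
    · intro h
      exact EquivariantMap.ext_out i fun c => (h2 c).trans (h c)
  · exact ⟨fun F c => ⟨F.1 c, F.2 c⟩, fun F => ⟨fun c => (F c).1, fun c => (F c).2⟩,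
      fun _ => rfl, fun _ => rfl⟩

/-- An element outside a subgroup of prime index `p` generates the quotient. A map fixed by `h` is
therefore determined by its value at `1`, and the only constraint on this value is that `h ^ p`,
that is `l`, fixes it. -/
theorem fixCount_coind_of_notMem (hp : i.range.index.Prime) {h : H} (hh : h ∉ i.range) {l : L}
    (hl : i l = h ^ i.range.index) (X : FinGSet L) :
    fixCount h (X.coind i ho) = fixCount l X := by
  have hn : i.range.Normal := ⟨fun n hn x => by rwa [hc x n, mul_inv_cancel_right]⟩
  set p := i.range.index with hpdef
  -- By Bézout, a power of `h` in the range with exponent prime to `p` would, together with `h ^ p`,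
  -- put `h` itself in the range.
  have hzp : ∀ k : ℤ, h ^ k ∈ i.range → ∃ j, k = p * j := by
    intro k hk
    by_contra hpk
    have hcop : IsCoprime (p : ℤ) k :=
      (Prime.coprime_iff_not_dvd (Nat.prime_iff_prime_int.1 hp)).2 hpk
    obtain ⟨a, b, hab⟩ := hcop
    refine hh ?_
    have : h = (h ^ p) ^ a * (h ^ k) ^ b := by
      rw [← zpow_natCast, ← zpow_mul, ← zpow_mul, ← zpow_add, mul_comm, mul_comm k, hab, zpow_one]
    rw [this]
    exact mul_mem (zpow_mem (MonoidHom.mem_range.2 ⟨l, hl⟩) _) (zpow_mem hk _)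
  have htop : i.range ⊔ Subgroup.zpowers h = ⊤ := by
    have h1 := Subgroup.relIndex_mul_index (H := i.range) (K := i.range ⊔ Subgroup.zpowers h)
      le_sup_left
    rw [← hpdef] at h1
    rcases (Nat.dvd_prime hp).1 (Dvd.intro_left _ h1) with h2 | h2
    · exact Subgroup.index_eq_one.1 h2
    · rw [h2] at h1
      have h3 := (Nat.mul_eq_right hp.ne_zero).1 h1
      exact (hh (Subgroup.relIndex_eq_one.1 h3
        (Subgroup.mem_sup_right (Subgroup.mem_zpowers h)))).elim
  have hrep : ∀ a : H, ∃ (m : L) (j : ℤ), a = i m * h ^ j := by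
    intro a
    have ha : a ∈ i.range ⊔ Subgroup.zpowers h := by rw [htop]; trivial
    obtain ⟨_, ⟨m, rfl⟩, _, ⟨j, rfl⟩, hj⟩ := Subgroup.mem_sup_of_normal_left.1 ha
    exact ⟨m, j, hj.symm⟩
  have hfix : ∀ f : EquivariantMap i X, h • f = f → ∀ (j : ℤ) (a : H), f.1 (a * h ^ j) = f.1 a := by
    intro f hf j a
    have h1 : h ^ j • f = f :=
      (MulAction.mem_stabilizer_iff.1 (zpow_mem (MulAction.mem_stabilizer_iff.2 hf) j))
    exact congrArg (fun f : EquivariantMap i X => f.1 a) h1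
  have hmove : ∀ f : EquivariantMap i X, ∀ m : L, f.1 (i m) = m • f.1 1 := fun f m => by
    rw [← f.2, mul_one]
  refine Nat.card_congr (Equiv.ofBijective
    (fun f : {f : EquivariantMap i X // h • f = f} => (⟨f.1.1 1, ?_⟩ : {x : X // l • x = x}))
    ⟨?_, ?_⟩)
  · have h1 := hfix f.1 f.2 p 1
    rwa [zpow_natCast, ← hl, one_mul, hmove] at h1
  · rintro ⟨f, hf⟩ ⟨f', hf'⟩ hff
    have h0 : f.1 1 = f'.1 1 := congrArg (fun x : {x : X // l • x = x} => x.1) hff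
    refine Subtype.ext (EquivariantMap.ext' i fun a => ?_)
    obtain ⟨m, j, rfl⟩ := hrep a
    exact (hfix f hf j _).trans ((hmove f m).trans
      ((congrArg (m • ·) h0).trans ((hfix f' hf' j _).trans (hmove f' m)).symm))
  · rintro ⟨x, hx⟩
    choose m j hmj using hrep
    -- The map with value `x` at `1` must take the value `m • x` at `i m * h ^ j`. This is well
    -- defined: for two such expressions of one element, `m'⁻¹ * m` is a power of `l`, which fixes
    -- `x`.
    have huniq : ∀ (m m' : L) (j j' : ℤ), i m * h ^ j = i m' * h ^ j' → m • x = m' • x := by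
      intro m m' j j' he
      have h1 : i (m'⁻¹ * m) = h ^ (j' - j) := by
        rw [map_mul, map_inv, zpow_sub, inv_mul_eq_iff_eq_mul, ← mul_assoc, ← he,
          mul_inv_cancel_right]
      obtain ⟨r, hr⟩ := hzp _ ⟨_, h1⟩
      rw [hr, zpow_mul, zpow_natCast, ← hl, ← map_zpow] at h1
      have h2 : (m'⁻¹ * m) • x = x := by
        rw [hi h1]
        exact MulAction.mem_stabilizer_iff.1 (zpow_mem (MulAction.mem_stabilizer_iff.2 hx) r)
      rwa [mul_smul, inv_smul_eq_iff] at h2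
    refine ⟨⟨⟨fun a => m a • x, fun k a => ?_⟩, EquivariantMap.ext' i fun a => ?_⟩,
      Subtype.ext ?_⟩
    · rw [← mul_smul]
      refine huniq _ _ (j (i k * a)) (j a) ?_
      rw [← hmj, map_mul, mul_assoc, ← hmj]
    · change m (a * h) • x = m a • x
      refine huniq _ _ (j (a * h)) (j a + 1) ?_
      rw [← hmj, zpow_add_one, ← mul_assoc, ← hmj]
    · change m 1 • x = x
      refine (huniq _ 1 (j 1) 0 ?_).trans (one_smul _ _)
      rw [← hmj]
      simp

end Coordinates

/-! ### Marks of norms -/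

section Norm
open FinGSet BurnsideRing

/-- As a polynomial in the number of steps, `(a + k b) ^ j` has degree at most `n`, so its `(n +
1)`-st difference vanishes. -/
theorem isPolynomial_pow {j n : ℕ} (hj : j ≤ n) :
    GrothendieckRing.IsPolynomial n fun z : ℤ => z ^ j := by
  intro a b
  have hdeg : ((Polynomial.C a + Polynomial.X * Polynomial.C b) ^ j).natDegree < n + 1 := by
    refine Nat.lt_succ_of_le (Polynomial.natDegree_pow_le_of_le j (m := 1) ?_ |>.trans (by simpa))
    compute_degree
  have h := congrFun (Polynomial.fwdDiff_iter_eq_zero_of_degree_lt hdeg) 0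
  rw [fwdDiff_iter_eq_sum_shift] at h
  have h2 : ∑ k ∈ Finset.range (n + 2), ((-1 : ℤ) ^ k * (n + 1).choose k) • (a + k • b) ^ j =
      (-1) ^ (n + 1) * ∑ k ∈ Finset.range (n + 1 + 1), ((-1 : ℤ) ^ (n + 1 - k) *
        (n + 1).choose k) • ((Polynomial.C a + Polynomial.X * Polynomial.C b) ^ j).eval
          (0 + k • (1 : ℤ)) := by
    rw [Finset.mul_sum]
    refine Finset.sum_congr rfl fun m hm => ?_
    have hm' : m ≤ n + 1 := by simpa [Nat.lt_succ_iff] using hm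
    have h3 : (-1 : ℤ) ^ (n + 1) * (-1) ^ (n + 1 - m) = (-1) ^ m := by
      conv_lhs => rw [← Nat.sub_add_cancel hm', pow_add]
      rw [Nat.sub_add_cancel hm', mul_right_comm, ← pow_add, ← two_mul, pow_mul]
      simp
    rw [← h3]
    simp
    ring
  rw [h2, h, Pi.zero_apply, mul_zero]

theorem extendAt_comp {S : Type*} [CommSemiring S] {B C : Type*} [AddCommGroup B] [AddCommGroup C]
    (n : ℕ) (f : S → B) (φ : B →+ C) (a b : S) :
    φ (GrothendieckRing.extendAt n f a b) = GrothendieckRing.extendAt n (fun s => φ (f s)) a b := by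
  simp [GrothendieckRing.extendAt, map_sum, map_zsmul]

/-- The integers already contain their differences, so the extension can be evaluated at `a - b`
directly. This carries formulas for marks of coinduced sets over to virtual sets. -/
theorem extendAt_pow {j n : ℕ} (hj : j ≤ n) (a b : ℤ) :
    GrothendieckRing.extendAt n (fun z : ℤ => z ^ j) a b = (a - b) ^ j := by
  have h := GrothendieckRing.extendAt_add_right (isPolynomial_pow hj) (a - b) b
  rwa [sub_add_cancel] at h

variable {L H : Type v} [Group L] [TopologicalSpace L] [Group H] [TopologicalSpace H]
  {i : L →* H} (hi : Function.Injective i)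
  [IsTopologicalGroup H] [CompactSpace H] (ho : IsOpenMap i)
  (hc : ∀ a b : H, a * b = b * a)
include hi hc

/-- A mark is additive, so it commutes with the finite sum that defines the extension; on sets it
turns the norm into a power map, whose extension is known. -/
theorem mark_map_norm (l : L) (x : BurnsideRing L) :
    mark (i l) (BurnsideRing.norm i ho x) = mark l x ^ i.range.index := by
  obtain ⟨a, b, rfl⟩ := GrothendieckRing.exists_eq_sub x
  have h1 : ∀ s : BurnsideSemiring L,
      mark (i l) (GrothendieckRing.of (BurnsideSemiring.coind i ho s)) =
        (mark l (GrothendieckRing.of s)) ^ i.range.index := by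
    intro s
    induction s using BurnsideSemiring.ind_on with | _ X
    have h2 := fixCount_map_coind hi ho hc l X
    change mark (i l) (cls (X.coind i ho)) = (mark l (cls X)) ^ _
    rw [mark_cls, mark_cls, h2, Nat.cast_pow]
  rw [BurnsideRing.norm, GrothendieckRing.extend_sub, extendAt_comp, map_sub, ← extendAt_pow le_rfl]
  simp only [h1, GrothendieckRing.extendAt, map_add, map_nsmul]

/-- Here the norm becomes the identity on marks; being of degree one, the identity is also
polynomial of degree at most the prime index. -/
theorem mark_norm_of_notMem (hp : i.range.index.Prime) {h : H} (hh : h ∉ i.range) {l : L}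
    (hl : i l = h ^ i.range.index) (x : BurnsideRing L) :
    mark h (BurnsideRing.norm i ho x) = mark l x := by
  obtain ⟨a, b, rfl⟩ := GrothendieckRing.exists_eq_sub x
  have h1 : ∀ s : BurnsideSemiring L,
      mark h (GrothendieckRing.of (BurnsideSemiring.coind i ho s)) =
        mark l (GrothendieckRing.of s) := by
    intro s
    induction s using BurnsideSemiring.ind_on with | _ X
    change mark h (cls (X.coind i ho)) = mark l (cls X)
    rw [mark_cls, mark_cls, fixCount_coind_of_notMem hi ho hc hp hh hl]
  have h2 := extendAt_pow hp.one_le (mark l (GrothendieckRing.of a)) (mark l (GrothendieckRing.of b))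
  rw [pow_one] at h2
  rw [BurnsideRing.norm, GrothendieckRing.extend_sub, extendAt_comp, map_sub, ← h2]
  simp only [h1, GrothendieckRing.extendAt, map_add, map_nsmul, pow_one]

end Norm

/-! ### Signs of permutations -/

section Sign

open scoped Classical in
/-- The sign of a permutation of a finite type. -/
noncomputable def permSign (α : Type*) [Finite α] : Equiv.Perm α →* ℤˣ :=
  letI := Fintype.ofFinite α
  Equiv.Perm.sign

theorem permSign_eq_sign {α : Type*} [Fintype α] [DecidableEq α] (σ : Equiv.Perm α) :
    permSign α σ = Equiv.Perm.sign σ := by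
  unfold permSign
  congr!

theorem permSign_congr {α β : Type*} [Finite α] [Finite β] (e : α ≃ β) (σ : Equiv.Perm α)
    (τ : Equiv.Perm β) (h : ∀ x, e (σ x) = τ (e x)) : permSign α σ = permSign β τ := by
  classical
  have := Fintype.ofFinite α
  have := Fintype.ofFinite β
  rw [permSign_eq_sign, permSign_eq_sign]
  exact Equiv.Perm.sign_eq_sign_of_equiv _ _ e h

theorem permSign_sumCongr {α β : Type*} [Finite α] [Finite β] (σ : Equiv.Perm α)
    (τ : Equiv.Perm β) :
    permSign (α ⊕ β) (Equiv.Perm.sumCongr σ τ) = permSign α σ * permSign β τ := by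
  classical
  have := Fintype.ofFinite α
  have := Fintype.ofFinite β
  simp only [permSign_eq_sign, Equiv.Perm.sign_sumCongr]

theorem permSign_prodCongrRight {α β : Type*} [Fintype α] [Finite β] (σ : α → Equiv.Perm β) :
    permSign (α × β) (Equiv.prodCongrRight σ) = ∏ k, permSign β (σ k) := by
  classical
  have := Fintype.ofFinite β
  simp only [permSign_eq_sign, Equiv.Perm.sign_prodCongrRight]

theorem permSign_of_sameCycle {α : Type*} [Finite α] [Nonempty α] (σ : Equiv.Perm α)
    (h : ∀ x y, σ.SameCycle x y) : permSign α σ = -(-1) ^ Nat.card α := by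
  classical
  have := Fintype.ofFinite α
  rw [permSign_eq_sign]
  -- `Equiv.Perm.IsCycle` asks for a moved point, so the one-point type needs its own argument.
  by_cases h1 : Subsingleton α
  · rw [Subsingleton.elim σ 1, Nat.card_unique]
    simp
  have hmove : ∀ x, σ x ≠ x := fun x hx =>
    h1 ⟨fun y z => ((h x y).eq_of_left hx).symm.trans ((h x z).eq_of_left hx)⟩
  obtain ⟨x⟩ := ‹Nonempty α›
  have hcyc : σ.IsCycle := ⟨x, hmove x, fun y _ => h x y⟩
  rw [hcyc.sign, Nat.card_eq_fintype_card, ← Finset.card_univ]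
  congr 3
  exact Finset.eq_univ_of_forall fun y => Equiv.Perm.mem_support.2 (hmove y)

/-- A homomorphism from a symmetric group to a group of order two depends only on the sign. -/
theorem eq_of_permSign_eq {α : Type*} [Finite α] (f : Equiv.Perm α →* ℤˣ) {σ τ : Equiv.Perm α}
    (h : permSign α σ = permSign α τ) : f σ = f τ := by
  classical
  have := Fintype.ofFinite α
  rw [permSign_eq_sign, permSign_eq_sign] at h
  by_cases hf : Function.Surjective f
  · rw [Equiv.Perm.eq_sign_of_surjective_hom hf, h]
  · have h1 : ∀ σ, f σ = 1 := by
      by_contra! hne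
      obtain ⟨ρ, hρ⟩ := hne
      refine hf fun u => ?_
      rcases Int.units_eq_one_or u with rfl | rfl
      · exact ⟨1, map_one f⟩
      · exact ⟨ρ, (Int.units_eq_one_or _).resolve_left hρ⟩
    rw [h1, h1]

/-- The action of a family of permutations on families, as a homomorphism. -/
def piPerm (ι α : Type*) : (ι → Equiv.Perm α) →* Equiv.Perm (ι → α) where
  toFun σ := Equiv.piCongrRight σ
  map_one' := rfl
  map_mul' _ _ := rfl

/-- The coordinates are changed one at a time. In a single coordinate the sign on `ι → α` is a
homomorphism from `Equiv.Perm α` to a group of order two, hence depends only on the sign there. -/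
theorem permSign_piPerm_eq {ι α : Type*} [Finite ι] [Finite α] {σ τ : ι → Equiv.Perm α}
    (h : ∀ c, permSign α (σ c) = permSign α (τ c)) :
    permSign (ι → α) (piPerm ι α σ) = permSign (ι → α) (piPerm ι α τ) := by
  classical
  have := Fintype.ofFinite ι
  have key : ∀ s : Finset ι, permSign (ι → α) (piPerm ι α (s.piecewise σ 1)) =
      permSign (ι → α) (piPerm ι α (s.piecewise τ 1)) := by
    intro s
    induction s using Finset.induction_on with
    | empty => simp
    | insert c s hc ih =>
      have hs : ∀ ρ : ι → Equiv.Perm α, (insert c s).piecewise ρ 1 =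
          Pi.mulSingle c (ρ c) * s.piecewise ρ 1 := by
        intro ρ
        funext d
        by_cases hd : d = c
        · subst hd; simp [hc]
        · simp [hd, Finset.piecewise]
      rw [hs, hs, map_mul, map_mul, map_mul, map_mul, ih]
      congr 1
      exact eq_of_permSign_eq (((permSign (ι → α)).comp (piPerm ι α)).comp
        (MonoidHom.mulSingle (fun _ => Equiv.Perm α) c)) (h c)
  have h1 := key Finset.univ
  rwa [Finset.piecewise_univ, Finset.piecewise_univ] at h1

end Sign

/-! ### Signs of actions, and their behaviour under products, induction and coinduction. -/

section SignAction
open FinGSet BurnsideRing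
variable {H : Type v} [Group H] [TopologicalSpace H]

/-- The sign of the action of `h` on a finite `H`-set. -/
noncomputable def actSign (h : H) (X : FinGSet H) : ℤˣ := permSign X (MulAction.toPerm h)

/-- The sign of `h`, as a homomorphism on the Burnside ring. -/
noncomputable def sgn (h : H) : BurnsideRing H →+ Additive ℤˣ :=
  GrothendieckRing.lift
    { toFun := Quotient.lift (fun X => Additive.ofMul (actSign h X)) fun X Y ⟨e⟩ =>
        congrArg _ (permSign_congr e.toEquiv _ _ fun x => e.map_smul h x)
      map_zero' := by
        change Additive.ofMul (permSign PEmpty _) = 0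
        exact congrArg Additive.ofMul ((congrArg (permSign PEmpty)
          (Equiv.ext fun x => x.elim)).trans (map_one (permSign PEmpty)))
      map_add' := fun a b => by
        induction a using BurnsideSemiring.ind_on with | _ X
        induction b using BurnsideSemiring.ind_on with | _ Y
        change Additive.ofMul (permSign (X ⊕ Y) _) = Additive.ofMul (permSign X _ * permSign Y _)
        rw [← permSign_sumCongr]
        refine congrArg _ (congrArg _ (Equiv.ext ?_))
        rintro (x | x) <;> rfl }

theorem sgn_cls (h : H) (X : FinGSet H) : sgn h (cls X) = Additive.ofMul (actSign h X) :=
  GrothendieckRing.lift_of _ _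

theorem sgn_res {L : Type v} [Group L] [TopologicalSpace L] (i : L →* H) (hi : Continuous i)
    (l : L) (x : BurnsideRing H) : sgn l (BurnsideRing.res i hi x) = sgn (i l) x := by
  obtain ⟨X, Y, rfl⟩ := exists_eq_cls_sub x
  have h : ∀ X : FinGSet H, BurnsideRing.res i hi (cls X) = cls (X.res i hi) :=
    fun X => GrothendieckRing.lift_of _ _
  have h2 : ∀ X : FinGSet H, actSign l (X.res i hi) = actSign (i l) X :=
    fun X => permSign_congr (Equiv.refl X) _ _ fun _ => rfl
  simp only [map_sub, h, sgn_cls, h2]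

theorem mark_one_cls (X : FinGSet H) : mark 1 (cls X) = Nat.card X := by
  rw [mark_cls, fixCount]
  exact congrArg _ (Nat.card_congr (Equiv.subtypeUnivEquiv fun x => one_smul H x))

/-- Two finite `H`-sets have the same cardinality and the same signs. -/
def SameSign (X Y : FinGSet H) : Prop :=
  Nat.card X = Nat.card Y ∧ ∀ h : H, actSign h X = actSign h Y

variable (H) in
/-- The virtual sets of rank zero on which all elements act with trivial sign. -/
noncomputable def signKernel : AddSubgroup (BurnsideRing H) :=
  (mark (1 : H)).ker ⊓ ⨅ h : H, (sgn h).ker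

theorem mem_signKernel {x : BurnsideRing H} :
    x ∈ signKernel H ↔ mark (1 : H) x = 0 ∧ ∀ h : H, sgn h x = 0 := by
  simp [signKernel, AddSubgroup.mem_inf, AddSubgroup.mem_iInf]

theorem cls_sub_mem_signKernel {X Y : FinGSet H} :
    cls X - cls Y ∈ signKernel H ↔ SameSign X Y := by
  simp only [mem_signKernel, map_sub, mark_one_cls, sgn_cls, sub_eq_zero, Nat.cast_inj, SameSign,
    Additive.ofMul.apply_eq_iff_eq]

theorem SameSign.sum {X X' Y : FinGSet H} (h : SameSign X X') : SameSign (X.sum Y) (X'.sum Y) := by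
  rw [← cls_sub_mem_signKernel] at h ⊢
  rwa [← cls_add, ← cls_add, add_sub_add_right_eq_sub]

/-- The action on `Z × Y` is the composite of the actions on the two factors. The action on `Z`
contributes its sign once for each point of `Y`; the other part moves only `Y`, so any bijection `X
≃ X'`, equivariant or not, transports it. -/
theorem SameSign.prod {X X' : FinGSet H} (h : SameSign X X') (Y : FinGSet H) :
    SameSign (X.prod Y) (X'.prod Y) := by
  have := Fintype.ofFinite Y
  refine ⟨?_, fun g => ?_⟩
  · change Nat.card (X × Y) = Nat.card (X' × Y)
    rw [Nat.card_prod, Nat.card_prod, h.1]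
  · obtain ⟨e⟩ := Finite.card_eq.1 h.1
    have key : ∀ Z : FinGSet H, actSign g (Z.prod Y) =
        permSign (Y × Z) (Equiv.prodCongrRight fun _ => MulAction.toPerm g) *
        permSign (Y × Z) (Equiv.prodCongr (MulAction.toPerm g) (Equiv.refl Z)) := by
      intro Z
      rw [← map_mul]
      exact permSign_congr (Equiv.prodComm Z Y) _ _ fun x => rfl
    rw [key, key, permSign_prodCongrRight, permSign_prodCongrRight]
    congr 1
    · exact Finset.prod_congr rfl fun _ _ => h.2 g
    · exact permSign_congr (Equiv.prodCongr (Equiv.refl Y) e) _ _ fun x => rfl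

theorem mul_mem_signKernel (y : BurnsideRing H) {x : BurnsideRing H} (hx : x ∈ signKernel H) :
    y * x ∈ signKernel H := by
  obtain ⟨X, X', rfl⟩ := exists_eq_cls_sub x
  obtain ⟨Y, Z, rfl⟩ := exists_eq_cls_sub y
  have h := cls_sub_mem_signKernel.1 hx
  have h1 : ∀ Y, (cls X - cls X') * cls Y ∈ signKernel H := fun Y => by
    rw [sub_mul, cls_mul, cls_mul, cls_sub_mem_signKernel]
    exact h.prod Y
  rw [mul_comm, mul_sub]
  exact sub_mem (h1 Y) (h1 Z)

variable {L : Type v} [Group L] [TopologicalSpace L] {i : L →* H} (hi : Function.Injective i)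
  [IsTopologicalGroup H] [CompactSpace H] (ho : IsOpenMap i)
include hi

/-- As for products, the action permutes the cosets and acts in each fibre through the cocycle. The
first part sees only the cardinality, the second contributes one sign for each coset. -/
theorem SameSign.ind {X Y : FinGSet L} (h : SameSign X Y) :
    SameSign (X.ind i ho) (Y.ind i ho) := by
  have := finite_quotient_range i ho
  have := Fintype.ofFinite (H ⧸ i.range)
  let e1 : ∀ Z : FinGSet L, (H ⧸ i.range) × Z ≃ Z.ind i ho := fun Z =>
    Equiv.ofBijective _ (bijective_ind_coord hi Z)
  refine ⟨?_, fun g => ?_⟩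
  · rw [← Nat.card_congr (e1 X), ← Nat.card_congr (e1 Y), Nat.card_prod, Nat.card_prod, h.1]
  · obtain ⟨e⟩ := Finite.card_eq.1 h.1
    have key : ∀ Z : FinGSet L, actSign g (Z.ind i ho) =
        permSign ((H ⧸ i.range) × Z) (Equiv.prodCongr (MulAction.toPerm g) (Equiv.refl Z)) *
        permSign ((H ⧸ i.range) × Z)
          (Equiv.prodCongrRight fun c => MulAction.toPerm (cocycle i g c)) := by
      intro Z
      rw [← map_mul]
      exact (permSign_congr (β := Z.ind i ho) (Equiv.ofBijective _ (bijective_ind_coord hi Z)) _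
        (MulAction.toPerm g) fun p => (ind_smul_coord g p.1 p.2).symm).symm
    rw [key, key, permSign_prodCongrRight, permSign_prodCongrRight]
    congr 1
    · exact permSign_congr (Equiv.prodCongr (Equiv.refl _) e) _ _ fun x => rfl
    · exact Finset.prod_congr rfl fun _ _ => h.2 _

/-- The permutation of coordinates sees only the cardinality of the set; the cocycle acts
coordinatewise, where `permSign_piPerm_eq` applies once both sets are identified by a bijection. -/
theorem SameSign.coind {X Y : FinGSet L} (h : SameSign X Y) :
    SameSign (X.coind i ho) (Y.coind i ho) := by
  have := finite_quotient_range i ho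
  let e1 : ∀ Z : FinGSet L, Z.coind i ho ≃ (H ⧸ i.range → Z) := fun Z =>
    Equiv.ofBijective _ (bijective_coind_coord hi Z)
  refine ⟨?_, fun g => ?_⟩
  · rw [Nat.card_congr (e1 X), Nat.card_congr (e1 Y), Nat.card_fun, Nat.card_fun, h.1]
  · obtain ⟨e⟩ := Finite.card_eq.1 h.1
    have key : ∀ Z : FinGSet L, actSign g (Z.coind i ho) =
        permSign (H ⧸ i.range → Z)
          (piPerm _ _ fun c => MulAction.toPerm (cocycle i g (g⁻¹ • c))) *
        permSign (H ⧸ i.range → Z) (Equiv.arrowCongr (MulAction.toPerm g) (Equiv.refl Z)) := by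
      intro Z
      rw [← map_mul]
      exact permSign_congr (α := Z.coind i ho) (Equiv.ofBijective _ (bijective_coind_coord hi Z))
        (MulAction.toPerm g) _ fun f => funext fun c => coind_smul_coord i f g c
    rw [key, key]
    congr 1
    · rw [permSign_congr (Equiv.arrowCongr (Equiv.refl _) e) _
        (piPerm _ Y fun c => e.permCongr (MulAction.toPerm (cocycle i g (g⁻¹ • c)))) fun f =>
          funext fun c => congrArg e (congrArg _ (e.symm_apply_apply _).symm)]
      refine permSign_piPerm_eq fun c => ?_
      rw [← permSign_congr e (MulAction.toPerm (cocycle i g (g⁻¹ • c))) _ fun x => by simp]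
      exact h.2 _
    · exact permSign_congr (Equiv.arrowCongr (Equiv.refl _) e) _ _ fun f => rfl

theorem tr_mem_signKernel {x : BurnsideRing L} (hx : x ∈ signKernel L) :
    tr i ho x ∈ signKernel H := by
  obtain ⟨X, Y, rfl⟩ := exists_eq_cls_sub x
  rw [map_sub, tr_cls, tr_cls, cls_sub_mem_signKernel]
  exact (cls_sub_mem_signKernel.1 hx).ind hi ho

/-- Writing zero as `Y - Y` makes both norms alternating sums with the same coefficients. The terms
are coinduced from `X + j Y` and `Y + j Y`, which have equal cardinality and signs, so the
difference is in the kernel term by term. -/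
theorem norm_sub_norm_zero_mem_signKernel {x : BurnsideRing L} (hx : x ∈ signKernel L) :
    BurnsideRing.norm i ho x - BurnsideRing.norm i ho 0 ∈ signKernel H := by
  obtain ⟨X, Y, rfl⟩ := exists_eq_cls_sub x
  have h := cls_sub_mem_signKernel.1 hx
  have h0 : (0 : BurnsideRing L) = cls Y - cls Y := (sub_self _).symm
  rw [h0, cls, cls, BurnsideRing.norm, GrothendieckRing.extend_sub, GrothendieckRing.extend_sub,
    GrothendieckRing.extendAt, GrothendieckRing.extendAt, ← Finset.sum_sub_distrib]
  refine sum_mem fun j _ => ?_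
  rw [← smul_sub]
  refine zsmul_mem ?_ _
  rw [← BurnsideSemiring.mk_copies, BurnsideSemiring.mk_add_mk, BurnsideSemiring.mk_add_mk]
  exact cls_sub_mem_signKernel.2 (h.sum.coind hi ho)

end SignAction

/-! ### The Tambara ideal of virtual sets of rank zero and trivial sign. -/

section SignIdeal
open FinGSet BurnsideRing
variable {G : Type v} [Group G] [TopologicalSpace G] [IsTopologicalGroup G] [CompactSpace G]

theorem res_mem_signKernel {L H : Type v} [Group L] [TopologicalSpace L] [Group H]
    [TopologicalSpace H] (i : L →* H) (hi : Continuous i) {x : BurnsideRing H}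
    (hx : x ∈ signKernel H) : BurnsideRing.res i hi x ∈ signKernel L := by
  rw [mem_signKernel] at hx ⊢
  refine ⟨?_, fun l => ?_⟩
  · rw [mark_res, map_one, hx.1]
  · rw [sgn_res, hx.2]

theorem injective_inclusion {L H : OpenSubgroup G} (h : L ≤ H) :
    Function.Injective (SubgroupClass.inclusion h) := Set.inclusion_injective h

variable (G) in
/-- The virtual sets of rank zero and trivial sign form a Tambara ideal. -/
noncomputable def signIdeal : TambaraIdeal G where
  ideal H := { signKernel H with smul_mem' := fun y _ hx => mul_mem_signKernel y hx }
  res_mem _ _ h _ hx := res_mem_signKernel _ (continuous_inclusion h) hx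
  tr_mem _ _ h _ hx :=
    tr_mem_signKernel (injective_inclusion h) (isOpenMap_inclusion h) hx
  norm_mem _ _ h _ hx := norm_sub_norm_zero_mem_signKernel
    (injective_inclusion h) (isOpenMap_inclusion h) hx
  conj_mem g H _ hx := res_mem_signKernel _ (continuous_conjHom g H) hx

end SignIdeal

/-! ### Signs for procyclic groups. -/

section SignTransitive
open FinGSet BurnsideRing
variable {H : Type v} [Group H] [TopologicalSpace H] [IsTopologicalGroup H] {g : H}

theorem actSign_of_transitive (hg : IsTopGen g) (X : FinGSet H) [MulAction.IsPretransitive H X]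
    [Nonempty X] : actSign g X = -(-1) ^ Nat.card X := by
  refine permSign_of_sameCycle _ fun x y => ?_
  obtain ⟨h, rfl⟩ := MulAction.exists_smul_eq H x y
  obtain ⟨k, hk⟩ := hg.exists_zpow_smul_eq x (X.isOpen_stabilizer x) h
  refine ⟨k, ?_⟩
  rw [← hk, ← MulAction.toPermHom_apply, ← map_zpow]
  rfl

theorem IsTransCard.sgn_t (hg : IsTopGen g) {k : ℕ} (hk : IsTransCard H k) :
    sgn g (t H k) = Additive.ofMul (-(-1) ^ k) := by
  obtain ⟨h0, X, hX, rfl⟩ := hk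
  have : Nonempty X := (Nat.card_ne_zero.1 h0).1
  rw [t_eq_cls hg X rfl, sgn_cls, actSign_of_transitive hg]

/-- The pointwise stabilizer of the finite set `X ⊔ Y` is open, so `h` acts on both sets as one and
the same power of `g`. -/
theorem sgn_eq_zsmul (hg : IsTopGen g) (h : H) (X Y : FinGSet H) :
    ∃ k : ℤ, sgn h (cls X - cls Y) = k • sgn g (cls X - cls Y) := by
  have hopen : IsOpen (⋂ z : X ⊕ Y, (fun a => h⁻¹ * a) ⁻¹'
      (MulAction.stabilizer H (z : X.sum Y) : Set H)) :=
    isOpen_iInter_of_finite fun z => ((X.sum Y).isOpen_stabilizer z).preimage (by fun_prop)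
  obtain ⟨k, hk⟩ := hg.exists_zpow_mem hopen ⟨h, by simp [one_mem]⟩
  have hk' : ∀ z : X.sum Y, g ^ k • z = h • z := by
    intro z
    have h1 := Set.mem_iInter.1 hk z
    change (h⁻¹ * g ^ k) • z = z at h1
    rwa [mul_smul, inv_smul_eq_iff] at h1
  have key : ∀ Z : FinGSet H, (∀ z : Z, g ^ k • z = h • z) →
      sgn h (cls Z) = k • sgn g (cls Z) := by
    intro Z hZ
    have h2 : (MulAction.toPerm h : Equiv.Perm Z) = MulAction.toPerm g ^ k := by
      rw [← MulAction.toPermHom_apply, ← MulAction.toPermHom_apply, ← map_zpow]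
      exact Equiv.ext fun z => (hZ z).symm
    rw [sgn_cls, sgn_cls, actSign, h2, map_zpow, ofMul_zpow]
    rfl
  refine ⟨k, ?_⟩
  rw [map_sub, map_sub, smul_sub, key X fun x => Sum.inl_injective (hk' (Sum.inl x)),
    key Y fun x => Sum.inr_injective (hk' (Sum.inr x))]

theorem mem_signKernel_iff_of_isTopGen (hg : IsTopGen g) {x : BurnsideRing H} :
    x ∈ signKernel H ↔ mark (1 : H) x = 0 ∧ sgn g x = 0 := by
  rw [mem_signKernel]
  refine ⟨fun h => ⟨h.1, h.2 g⟩, fun h => ⟨h.1, fun a => ?_⟩⟩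
  obtain ⟨X, Y, rfl⟩ := exists_eq_cls_sub x
  obtain ⟨k, hk⟩ := sgn_eq_zsmul hg a X Y
  rw [hk, h.2, smul_zero]

end SignTransitive

/-! ### The Burnside Tambara functor of a procyclic group -/

section ProcyclicTambara
open FinGSet BurnsideRing
variable {G : Type v} [Group G] [TopologicalSpace G] [IsTopologicalGroup G] [CompactSpace G]

theorem index_ne_zero (H : OpenSubgroup G) : H.toSubgroup.index ≠ 0 := by
  have := Subgroup.quotient_finite_of_isOpen H.toSubgroup H.isOpen
  exact Nat.card_ne_zero.2 ⟨inferInstance, this⟩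

theorem relIndex_mul_index {L H : OpenSubgroup G} (h : L ≤ H) :
    L.toSubgroup.relIndex H.toSubgroup * H.toSubgroup.index = L.toSubgroup.index :=
  Subgroup.relIndex_mul_index h

theorem relIndex_ne_zero {L H : OpenSubgroup G} (h : L ≤ H) :
    L.toSubgroup.relIndex H.toSubgroup ≠ 0 := by
  intro h0
  have h1 := relIndex_mul_index h
  rw [h0, zero_mul] at h1
  exact index_ne_zero L h1.symm

theorem index_range_inclusion {L H : OpenSubgroup G} (h : L ≤ H) :
    (SubgroupClass.inclusion h : L →* H).range.index = L.toSubgroup.relIndex H.toSubgroup :=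
  congrArg Subgroup.index (Subgroup.inclusion_range (H := L.toSubgroup) (K := H.toSubgroup) h)

theorem isTransCard_iff_exists_subgroup {H : Type v} [Group H] [TopologicalSpace H]
    [IsTopologicalGroup H] [CompactSpace H] {k : ℕ} :
    IsTransCard H k ↔ ∃ U : OpenSubgroup H, U.toSubgroup.index = k := by
  constructor
  · rintro ⟨h0, X, hX, rfl⟩
    obtain ⟨x⟩ := (Nat.card_ne_zero.1 h0).1
    exact ⟨⟨MulAction.stabilizer H x, X.isOpen_stabilizer x⟩,
      MulAction.index_stabilizer_of_transitive H x⟩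
  · rintro ⟨U, rfl⟩
    exact ⟨index_ne_zero U, coset U, inferInstanceAs (MulAction.IsPretransitive H (H ⧸ _)), rfl⟩

variable [T2Space G] {g : G} (hg : IsTopGen g)
include hg

/-- Indices multiply in towers. For the converse, divisibility of indices means inclusion, so an
open subgroup of `G` of the required index lies in `H`. -/
theorem isTransCard_iff {H : OpenSubgroup G} {k : ℕ} :
    IsTransCard H k ↔ IsTransCard G (k * H.toSubgroup.index) := by
  rw [isTransCard_iff_exists_subgroup, isTransCard_iff_exists_subgroup]
  constructor
  · rintro ⟨U, rfl⟩
    refine ⟨⟨U.toSubgroup.map H.toSubgroup.subtype,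
      H.isOpen.isOpenMap_subtype_val _ U.isOpen⟩, ?_⟩
    change (U.toSubgroup.map H.toSubgroup.subtype).index = _
    exact Subgroup.index_map_subtype _
  · rintro ⟨L, hL⟩
    have hLH : L.toSubgroup ≤ H.toSubgroup :=
      (hg.le_iff L.isOpen H.isOpen).2 (hL ▸ dvd_mul_left _ _)
    refine ⟨⟨L.toSubgroup.subgroupOf H.toSubgroup, L.isOpen.preimage continuous_subtype_val⟩, ?_⟩
    have h1 := relIndex_mul_index (L := L) (H := H) hLH
    rw [hL] at h1
    exact Nat.eq_of_mul_eq_mul_right (Nat.pos_of_ne_zero (index_ne_zero H)) h1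

theorem IsTransCard.of_dvd {k d : ℕ} (hk : IsTransCard G k) (hd : d ∣ k) : IsTransCard G d := by
  rw [isTransCard_iff_exists_subgroup] at hk ⊢
  obtain ⟨U, rfl⟩ := hk
  obtain ⟨V, hV, -, hVd⟩ := hg.exists_index_eq U.isOpen hd
  exact ⟨⟨V, hV⟩, hVd⟩

theorem isTransCard_of_dvd {H : OpenSubgroup G} {k d : ℕ} (hk : IsTransCard H k) (hd : d ∣ k) :
    IsTransCard H d :=
  hk.of_dvd (isTopGen_genOf hg H) hd

theorem exists_relIndex_eq {H : OpenSubgroup G} {k : ℕ} (hk : IsTransCard H k) :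
    ∃ L : OpenSubgroup G, L ≤ H ∧ L.toSubgroup.relIndex H.toSubgroup = k := by
  obtain ⟨L, hL⟩ := isTransCard_iff_exists_subgroup.1 ((isTransCard_iff hg).1 hk)
  have hLH : L ≤ H := (hg.le_iff L.isOpen H.isOpen).2 (hL ▸ dvd_mul_left _ _)
  refine ⟨L, hLH, ?_⟩
  have h1 := relIndex_mul_index (L := L) (H := H) hLH
  rw [hL] at h1
  exact Nat.eq_of_mul_eq_mul_right (Nat.pos_of_ne_zero (index_ne_zero H)) h1

theorem exists_ge_of_dvd_index (H : OpenSubgroup G) {d : ℕ} (hd : d ∣ H.toSubgroup.index) :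
    ∃ L : OpenSubgroup G, H ≤ L ∧ L.toSubgroup.index = d := by
  obtain ⟨V, hV, hHV, hVd⟩ := hg.exists_index_eq H.isOpen hd
  exact ⟨⟨V, hV⟩, hHV, hVd⟩

theorem isTransCard_mul_iff {L H : OpenSubgroup G} (h : L ≤ H) {k : ℕ} :
    IsTransCard L k ↔ IsTransCard H (L.toSubgroup.relIndex H.toSubgroup * k) := by
  rw [isTransCard_iff hg, isTransCard_iff hg, ← relIndex_mul_index h]
  ring_nf

omit [CompactSpace G] [T2Space G] in
theorem inclusion_genOf {L H : OpenSubgroup G} (h : L ≤ H) :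
    (SubgroupClass.inclusion h : L →* H) (genOf hg L) =
      genOf hg H ^ L.toSubgroup.relIndex H.toSubgroup := by
  refine Subtype.ext ?_
  change g ^ L.toSubgroup.index = ((genOf hg H ^ _ : H) : G)
  rw [SubgroupClass.coe_pow, genOf, ← pow_mul, mul_comm, Subgroup.relIndex_mul_index h]

omit [CompactSpace G] [T2Space G] in
theorem genOf_pow_mem_range_iff {L H : OpenSubgroup G} (h : L ≤ H) (m : ℕ) :
    genOf hg H ^ m ∈ (SubgroupClass.inclusion h : L →* H).range ↔
      L.toSubgroup.relIndex H.toSubgroup ∣ m := by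
  have h1 := (isTopGen_genOf hg H).zpow_mem_iff
    (isOpen_range (SubgroupClass.inclusion h : L →* H) (L.isOpen.isOpenMap_inclusion h)) m
  rwa [zpow_natCast, Int.natCast_dvd_natCast,
    show (SubgroupClass.inclusion h : L →* H).range.index = L.toSubgroup.relIndex H.toSubgroup from
      congrArg Subgroup.index (Subgroup.inclusion_range h)] at h1

omit hg in
theorem IsTopGen.mul_comm_coe (hg : IsTopGen g) (H : OpenSubgroup G) (a b : H) : a * b = b * a :=
  Subtype.ext (hg.mul_comm a.1 b.1)

/-- The mark at the `m`-th power of the topological generator of `H`. -/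
noncomputable def markAt (hg : IsTopGen g) (H : OpenSubgroup G) (m : ℕ) : BurnsideRing H →+* ℤ :=
  markHom (genOf hg H ^ m)

theorem eq_of_markAt_eq {H : OpenSubgroup G} {x y : BurnsideRing H}
    (h : ∀ m : ℕ, m ≠ 0 → markAt hg H m x = markAt hg H m y) : x = y :=
  eq_of_mark_eq (isTopGen_genOf hg H) h

theorem markAt_t {H : OpenSubgroup G} {k : ℕ} (hk : IsTransCard H k) (m : ℕ) :
    markAt hg H m (t H k) = if k ∣ m then (k : ℤ) else 0 :=
  hk.mark_t (isTopGen_genOf hg H) m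

omit [IsTopologicalGroup G] [CompactSpace G] [T2Space G] hg in
theorem isTransCard_one (H : OpenSubgroup G) : IsTransCard H 1 :=
  ⟨one_ne_zero, point H, ⟨fun _ _ => ⟨1, rfl⟩⟩, Nat.card_eq_one_iff_unique.2
    ⟨⟨fun _ _ => rfl⟩, ⟨PUnit.unit⟩⟩⟩

theorem t_one (H : OpenSubgroup G) : t H 1 = 1 :=
  eq_of_markAt_eq hg fun m _ => by
    rw [markAt_t hg (isTransCard_one H), map_one, if_pos (one_dvd _), Nat.cast_one]

section
variable {L H : OpenSubgroup G} (h : L ≤ H)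
include h

theorem markAt_resA (m : ℕ) (x : BurnsideRing H) : markAt hg L m (resA h x) =
    markAt hg H (L.toSubgroup.relIndex H.toSubgroup * m) x := by
  refine (mark_res _ _ _ _).trans ?_
  rw [map_pow, inclusion_genOf hg h, ← pow_mul]
  rfl

theorem markAt_mul_trA (m : ℕ) (x : BurnsideRing L) :
    markAt hg H (L.toSubgroup.relIndex H.toSubgroup * m) (trA h x) =
      L.toSubgroup.relIndex H.toSubgroup * markAt hg L m x := by
  have h1 := mark_map_tr (injective_inclusion h) (isOpenMap_inclusion h) (hg.mul_comm_coe H)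
    (genOf hg L ^ m) x
  rw [map_pow, inclusion_genOf hg h, ← pow_mul, index_range_inclusion] at h1
  exact h1

theorem markAt_trA_of_not_dvd {m : ℕ} (hm : ¬ L.toSubgroup.relIndex H.toSubgroup ∣ m)
    (x : BurnsideRing L) : markAt hg H m (trA h x) = 0 :=
  mark_tr_of_notMem (isOpenMap_inclusion h) (hg.mul_comm_coe H)
    (mt (genOf_pow_mem_range_iff hg h m).1 hm) x

theorem markAt_mul_normA (m : ℕ) (x : BurnsideRing L) :
    markAt hg H (L.toSubgroup.relIndex H.toSubgroup * m) (normA h x) =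
      markAt hg L m x ^ L.toSubgroup.relIndex H.toSubgroup := by
  have h1 := mark_map_norm (injective_inclusion h) (isOpenMap_inclusion h) (hg.mul_comm_coe H)
    (genOf hg L ^ m) x
  rw [map_pow, inclusion_genOf hg h, ← pow_mul, index_range_inclusion] at h1
  exact h1

theorem markAt_normA_of_not_dvd (hp : (L.toSubgroup.relIndex H.toSubgroup).Prime) {m : ℕ}
    (hm : ¬ L.toSubgroup.relIndex H.toSubgroup ∣ m) (x : BurnsideRing L) :
    markAt hg H m (normA h x) = markAt hg L m x := by
  refine mark_norm_of_notMem (injective_inclusion h) (isOpenMap_inclusion h) (hg.mul_comm_coe H)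
    (by rwa [index_range_inclusion]) (mt (genOf_pow_mem_range_iff hg h m).1 hm) ?_ x
  rw [map_pow, inclusion_genOf hg h, index_range_inclusion, ← pow_mul, ← pow_mul, mul_comm]

theorem normA_zero (hp : (L.toSubgroup.relIndex H.toSubgroup).Prime) :
    normA h (0 : BurnsideRing L) = 0 := by
  refine eq_of_markAt_eq hg fun m _ => ?_
  by_cases hm : L.toSubgroup.relIndex H.toSubgroup ∣ m
  · obtain ⟨m, rfl⟩ := hm
    rw [markAt_mul_normA hg h, map_zero, map_zero, zero_pow hp.ne_zero]
  · rw [markAt_normA_of_not_dvd hg h hp hm, map_zero, map_zero]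

theorem trA_t {k : ℕ} (hk : IsTransCard L k) :
    trA h (t L k) = t H (L.toSubgroup.relIndex H.toSubgroup * k) := by
  have hk' := (isTransCard_mul_iff hg h).1 hk
  refine eq_of_markAt_eq hg fun m _ => ?_
  rw [markAt_t hg hk']
  by_cases hm : L.toSubgroup.relIndex H.toSubgroup ∣ m
  · obtain ⟨m, rfl⟩ := hm
    rw [markAt_mul_trA hg h, markAt_t hg hk]
    simp only [Nat.mul_dvd_mul_iff_left (Nat.pos_of_ne_zero (relIndex_ne_zero h))]
    split_ifs <;> simp
  · rw [markAt_trA_of_not_dvd hg h hm, if_neg fun h => hm ((dvd_mul_right _ _).trans h)]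

theorem trA_natCast (n : ℕ) :
    trA h (n : BurnsideRing L) = n * t H (L.toSubgroup.relIndex H.toSubgroup) := by
  rw [← nsmul_one, map_nsmul, ← t_one hg L,
    trA_t hg h (isTransCard_one L), mul_one, nsmul_eq_mul]

/-- Restriction multiplies the exponent of the generator by the index, which does not affect
divisibility by a `k` prime to that index. -/
theorem resA_t_of_coprime {k : ℕ} (hk : IsTransCard H k)
    (hr : (L.toSubgroup.relIndex H.toSubgroup).Coprime k) (hkL : IsTransCard L k) :
    resA h (t H k) = t L k :=
  eq_of_markAt_eq hg fun m _ => by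
    simp only [markAt_resA, markAt_t hg hk, markAt_t hg hkL, hr.symm.dvd_mul_left]

theorem resA_natCast (n : ℕ) : resA h (n : BurnsideRing H) = (n : BurnsideRing L) :=
  eq_of_markAt_eq hg fun m _ => by rw [markAt_resA, map_natCast, map_natCast]

/-- A criterion for membership in a Tambara ideal, using the norm along a subgroup of prime
index. -/
theorem TambaraIdeal.mem_of_norm (I : TambaraIdeal G)
    (hp : (L.toSubgroup.relIndex H.toSubgroup).Prime) {x : BurnsideRing L} (hx : x ∈ I.ideal L)
    (y : BurnsideRing L) {x' : BurnsideRing H}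
    (h1 : ∀ m, ¬ L.toSubgroup.relIndex H.toSubgroup ∣ m → markAt hg H m x' = markAt hg L m x)
    (h2 : ∀ m, markAt hg L m x ^ L.toSubgroup.relIndex H.toSubgroup =
      markAt hg H (L.toSubgroup.relIndex H.toSubgroup * m) x' +
        L.toSubgroup.relIndex H.toSubgroup * (markAt hg L m y * markAt hg L m x)) :
    x' ∈ I.ideal H := by
  -- At exponents not divisible by the index the transfer vanishes and the norm has the marks of
  -- `x`; at the other exponents `h2` is the required equation of marks.
  have h3 : x' = normA h x - normA h 0 - trA h (y * x) := by
    rw [normA_zero hg h hp, sub_zero, eq_sub_iff_add_eq]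
    refine eq_of_markAt_eq hg fun m _ => ?_
    by_cases hm : L.toSubgroup.relIndex H.toSubgroup ∣ m
    · obtain ⟨m, rfl⟩ := hm
      rw [map_add, markAt_mul_normA hg h, markAt_mul_trA hg h, map_mul, h2]
    · rw [map_add, markAt_normA_of_not_dvd hg h hp hm, markAt_trA_of_not_dvd hg h hm, h1 m hm,
        add_zero]
  rw [h3]
  exact sub_mem (I.norm_mem L H h x hx) (I.tr_mem L H h _ (Ideal.mul_mem_left _ _ hx))

end

/-! ### Membership of the basic elements in a Tambara ideal -/

section Basic
variable {H : OpenSubgroup G} (I : TambaraIdeal G)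

/-- The factor `-(t_2 - 2)` has mark `2` at odd exponents and `0` at even ones. It cuts `t_4 - t_2 -
2` down to the odd exponents, where the mark `-2` becomes `-4`. -/
theorem TambaraIdeal.two_mul_mem (h4 : IsTransCard H 4) (hI : t H 4 - t H 2 - 2 ∈ I.ideal H) :
    2 * (t H 2 - 2) ∈ I.ideal H := by
  have h : 2 * (t H 2 - 2) = -(t H 2 - 2) * (t H 4 - t H 2 - 2) := by
    refine eq_of_markAt_eq hg fun m _ => ?_
    have h42 : 4 ∣ m → 2 ∣ m := fun h => dvd_trans (by norm_num) h
    simp only [map_mul, map_sub, map_neg, map_ofNat, markAt_t hg h4,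
      markAt_t hg (isTransCard_of_dvd hg h4 (by norm_num : 2 ∣ 4))]
    split_ifs <;> simp_all
  rw [h]
  exact Ideal.mul_mem_left _ _ hI

/-- Transfer of `t_p - p` from a subgroup of index `m` gives `t_{pm} ≡ p t_m`, and transfer of `t_4
- t_2 - 2` gives `t_{4m} ≡ t_{2m} + 2 t_m`. Induction brings everything down to `t_1` and `t_2`, and
multiples of `t_2 - 2` count only modulo two. -/
theorem TambaraIdeal.t_sub_mem
    (hA : ∀ (H : OpenSubgroup G) (p : ℕ), p.Prime → p ≠ 2 → IsTransCard H p →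
      t H p - (p : BurnsideRing H) ∈ I.ideal H)
    (hB : ∀ H : OpenSubgroup G, IsTransCard H 4 → t H 4 - t H 2 - 2 ∈ I.ideal H)
    (hC : ∀ H : OpenSubgroup G, IsTransCard H 2 → 2 * (t H 2 - 2) ∈ I.ideal H)
    (H : OpenSubgroup G) {k : ℕ} (hk : IsTransCard H k) :
    t H k - (k : BurnsideRing H) - (if Even k then t H 2 - 2 else 0) ∈ I.ideal H := by
  induction k using Nat.strong_induction_on with | _ k ih
  have hk0 := hk.1
  by_cases hodd : ∃ p, p.Prime ∧ p ≠ 2 ∧ p ∣ k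
  · obtain ⟨p, hp, hp2, m, rfl⟩ := hodd
    have hm : IsTransCard H m := isTransCard_of_dvd hg hk (dvd_mul_left _ _)
    have hmk : m < p * m := lt_mul_of_one_lt_left (Nat.pos_of_ne_zero hm.1) hp.one_lt
    obtain ⟨L, hLH, hr⟩ := exists_relIndex_eq hg hm
    have hpL : IsTransCard L p := by
      rw [isTransCard_mul_iff hg hLH, hr, mul_comm]; exact hk
    have h1 := I.tr_mem L H hLH _ (hA L p hp hp2 hpL)
    rw [map_sub, trA_t hg hLH hpL, trA_natCast hg hLH, hr, mul_comm m p] at h1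
    have h2 := Ideal.mul_mem_left _ (p : BurnsideRing H) (ih m hmk hm)
    -- With `p = 2 j + 1`, the multiple `p (t_2 - 2)` differs from `t_2 - 2` by `j` times `2 (t_2 -
    -- 2)`.
    obtain ⟨j, rfl⟩ := hp.odd_of_ne_two hp2
    have heven : Even ((2 * j + 1) * m) ↔ Even m := by
      rw [Nat.even_mul]; simp
    have h3 := add_mem h1 h2
    by_cases he : Even m
    · rw [if_pos he] at h3
      rw [if_pos (heven.2 he)]
      have h2k : IsTransCard H 2 := isTransCard_of_dvd hg hm he.two_dvd
      have h4 := add_mem h3 (Ideal.mul_mem_left _ (j : BurnsideRing H) (hC H h2k))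
      convert h4 using 1
      push_cast
      ring
    · rw [if_neg he] at h3
      rw [if_neg (mt heven.1 he)]
      convert h3 using 1
      push_cast
      ring
  · push Not at hodd
    have hpow : k = 2 ^ k.primeFactorsList.length := Nat.eq_prime_pow_of_unique_prime_dvd hk0
      fun {d} hd hdk => by_contra fun h => hodd d hd h hdk
    generalize k.primeFactorsList.length = e at hpow
    rcases e with _ | _ | e
    · have h1 : k = 1 := hpow
      subst h1
      rw [t_one hg H]
      simp
    · have h1 : k = 2 := hpow
      subst h1
      simp
    · have hk4 : k = 2 ^ e * 4 := by rw [hpow]; ring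
      subst hk4
      have he0 : 0 < 2 ^ e := by positivity
      have hm : IsTransCard H (2 ^ e) := isTransCard_of_dvd hg hk (dvd_mul_right _ _)
      have h2m : IsTransCard H (2 ^ e * 2) :=
        isTransCard_of_dvd hg hk (mul_dvd_mul_left _ (by norm_num))
      have h2k : IsTransCard H 2 := isTransCard_of_dvd hg h2m (dvd_mul_left _ _)
      obtain ⟨L, hLH, hr⟩ := exists_relIndex_eq hg hm
      have h4L : IsTransCard L 4 := by rw [isTransCard_mul_iff hg hLH, hr]; exact hk
      have h2L : IsTransCard L 2 := isTransCard_of_dvd hg h4L (by norm_num)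
      have h1 := I.tr_mem L H hLH _ (hB L h4L)
      rw [map_sub, map_sub, trA_t hg hLH h4L, trA_t hg hLH h2L,
        show (2 : BurnsideRing L) = ((2 : ℕ) : BurnsideRing L) from rfl, trA_natCast hg hLH, hr]
        at h1
      have h2 := ih (2 ^ e * 2) (by omega) h2m
      have h3 := Ideal.mul_mem_left _ (2 : BurnsideRing H) (ih (2 ^ e) (by omega) hm)
      have h5 := add_mem (add_mem h1 h2) h3
      have e2 : Even (2 ^ e * 2) := ⟨2 ^ e, by ring⟩
      have e4 : Even (2 ^ e * 4) := ⟨2 ^ e * 2, by ring⟩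
      rw [if_pos e2] at h5
      rw [if_pos e4]
      -- If `2 ^ e` is even, three copies of `t_2 - 2` have accumulated and two are removed; if it
      -- is `1`, there is only one.
      by_cases he : Even (2 ^ e)
      · rw [if_pos he] at h5
        have h6 := add_mem h5 (hC H h2k)
        convert h6 using 1
        push_cast
        ring
      · rw [if_neg he] at h5
        convert h5 using 1
        push_cast
        ring

/-- The classes `t_k` generate additively. The last clause guards against the default value: without
a transitive set of two elements `t H 2` is `0` and `t_2 - 2` degenerates to the constant `-2`. -/
theorem TambaraIdeal.exists_sub_mem
    (hA : ∀ (H : OpenSubgroup G) (p : ℕ), p.Prime → p ≠ 2 → IsTransCard H p →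
      t H p - (p : BurnsideRing H) ∈ I.ideal H)
    (hB : ∀ H : OpenSubgroup G, IsTransCard H 4 → t H 4 - t H 2 - 2 ∈ I.ideal H)
    (hC : ∀ H : OpenSubgroup G, IsTransCard H 2 → 2 * (t H 2 - 2) ∈ I.ideal H)
    (H : OpenSubgroup G) (x : BurnsideRing H) :
    ∃ a b : ℤ, x - a - b * (t H 2 - 2) ∈ I.ideal H ∧ (¬ IsTransCard H 2 → b = 0) := by
  have hx : x ∈ AddSubgroup.closure (t H '' {k | IsTransCard H k}) := by
    rw [closure_t_eq_top (isTopGen_genOf hg H)]; trivial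
  induction hx using AddSubgroup.closure_induction with
  | mem x hx =>
    obtain ⟨k, hk, rfl⟩ := hx
    have h := I.t_sub_mem hg hA hB hC H hk
    by_cases he : Even k
    · rw [if_pos he] at h
      refine ⟨k, 1, by simpa using h, fun h2 => ?_⟩
      exact (h2 (isTransCard_of_dvd hg hk he.two_dvd)).elim
    · rw [if_neg he] at h
      exact ⟨k, 0, by simpa using h, fun _ => rfl⟩
  | zero => exact ⟨0, 0, by simp, fun _ => rfl⟩
  | add x y _ _ hx hy =>
    obtain ⟨a, b, h1, h2⟩ := hx
    obtain ⟨a', b', h1', h2'⟩ := hy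
    refine ⟨a + a', b + b', ?_, fun h => by rw [h2 h, h2' h, add_zero]⟩
    convert add_mem h1 h1' using 1
    push_cast
    ring
  | neg x _ hx =>
    obtain ⟨a, b, h1, h2⟩ := hx
    refine ⟨-a, -b, ?_, fun h => by rw [h2 h, neg_zero]⟩
    convert neg_mem h1 using 1
    push_cast
    ring

/-- A Tambara ideal with the basic elements contains all virtual sets of rank zero and trivial
sign. -/
theorem TambaraIdeal.signKernel_le
    (hA : ∀ (H : OpenSubgroup G) (p : ℕ), p.Prime → p ≠ 2 → IsTransCard H p →
      t H p - (p : BurnsideRing H) ∈ I.ideal H)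
    (hB : ∀ H : OpenSubgroup G, IsTransCard H 4 → t H 4 - t H 2 - 2 ∈ I.ideal H)
    (hC : ∀ H : OpenSubgroup G, IsTransCard H 2 → 2 * (t H 2 - 2) ∈ I.ideal H)
    (hI : ∀ (H : OpenSubgroup G) (x : BurnsideRing H), x ∈ I.ideal H → x ∈ signKernel H)
    (H : OpenSubgroup G) {x : BurnsideRing H} (hx : x ∈ signKernel H) : x ∈ I.ideal H := by
  obtain ⟨a, b, h1, h2⟩ := I.exists_sub_mem hg hA hB hC H x
  have hgen := isTopGen_genOf hg H
  have h3 := sub_mem hx (hI H _ h1)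
  rw [sub_sub, sub_sub_cancel, mem_signKernel_iff_of_isTopGen hgen] at h3
  obtain ⟨h4, h5⟩ := h3
  -- Rank zero forces `a = 0`, and trivial sign forces `b` to be even because a generator acts on
  -- two points by a transposition.
  have h6 : b * (t H 2 - 2) ∈ I.ideal H ∧ a = 0 := by
    by_cases h2H : IsTransCard H 2
    · have hm := h2H.mark_t hgen 0
      rw [pow_zero, if_pos (dvd_zero _)] at hm
      rw [map_add, mark_intCast, mark_mul, map_sub, hm, mark_ofNat] at h4
      have ha : a = 0 := by simpa using h4
      rw [ha, Int.cast_zero, zero_add, ← zsmul_eq_mul, map_zsmul, map_sub, h2H.sgn_t hgen] at h5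
      have hs : sgn (genOf hg H) (2 : BurnsideRing H) = 0 := by
        rw [← one_add_one_eq_two, map_add, ← two_nsmul, ← ofMul_toMul (sgn _ 1), ← ofMul_pow]
        simp
      rw [hs, sub_zero] at h5
      have hb : Even b := by
        rw [← ofMul_zpow] at h5
        have h7 : (-(-1 : ℤˣ) ^ 2) ^ b = 1 := h5
        by_contra hb
        rw [Int.not_even_iff_odd] at hb
        rw [even_two.neg_one_pow, hb.neg_one_zpow] at h7
        exact absurd h7 (by decide)
      obtain ⟨c, rfl⟩ := hb
      refine ⟨?_, ha⟩
      convert Ideal.mul_mem_left _ (c : BurnsideRing H) (hC H h2H) using 1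
      push_cast
      ring
    · rw [h2 h2H] at h4 ⊢
      rw [Int.cast_zero, zero_mul, add_zero, mark_intCast] at h4
      exact ⟨by simp, h4⟩
  have h8 := add_mem h1 h6.1
  rwa [h6.2, Int.cast_zero, sub_zero, sub_add_cancel] at h8

omit [T2Space G] hg in
theorem mem_tambaraSpan {S : Set (TambaraElement G)} {H : OpenSubgroup G} {x : BurnsideRing H}
    (hx : (⟨H, x⟩ : TambaraElement G) ∈ S) : x ∈ (tambaraSpan S).ideal H := by
  change x ∈ ⨅ (I : TambaraIdeal G) (_ : I.Contains S), I.ideal H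
  simp only [Submodule.mem_iInf]
  exact fun I hI => hI _ hx

omit [T2Space G] hg in
theorem tambaraSpan_le {S : Set (TambaraElement G)} {I : TambaraIdeal G} (hI : I.Contains S)
    {H : OpenSubgroup G} {x : BurnsideRing H} (hx : x ∈ (tambaraSpan S).ideal H) :
    x ∈ I.ideal H := by
  change x ∈ ⨅ (I : TambaraIdeal G) (_ : I.Contains S), I.ideal H at hx
  simp only [Submodule.mem_iInf] at hx
  exact hx I hI

omit I in
/-- A criterion for generating the ideal of virtual sets of rank zero and trivial sign. -/
theorem isGeneratedBy_signKernel {S : Set (TambaraElement G)}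
    (hS : ∀ s ∈ S, s.2 ∈ signKernel s.1)
    (hA : ∀ (H : OpenSubgroup G) (p : ℕ), p.Prime → p ≠ 2 → IsTransCard H p →
      t H p - (p : BurnsideRing H) ∈ (tambaraSpan S).ideal H)
    (hB : ∀ H : OpenSubgroup G, IsTransCard H 4 → t H 4 - t H 2 - 2 ∈ (tambaraSpan S).ideal H)
    (hC : ∀ H : OpenSubgroup G, IsTransCard H 2 → 2 * (t H 2 - 2) ∈ (tambaraSpan S).ideal H) :
    IsGeneratedBy (fun H : OpenSubgroup G => signKernel H) S := by
  have h : ∀ (H : OpenSubgroup G) (x : BurnsideRing H), x ∈ (tambaraSpan S).ideal H →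
      x ∈ signKernel H := fun H x hx => tambaraSpan_le (I := signIdeal G) hS hx
  intro H
  ext x
  exact ⟨fun hx => (tambaraSpan S).signKernel_le hg hA hB hC h H hx, h H x⟩

end Basic

end ProcyclicTambara

open Algebra

/-! ### Quadratic forms over finite fields -/

section Diagonal
variable {E : Type v} [Field E] [NeZero (2 : E)]

theorem polar_weightedSumSquares {ι : Type} [Fintype ι] (w : ι → Eˣ) (x y : ι → E) :
    QuadraticMap.polar (QuadraticMap.weightedSumSquares E w) x y =
      ∑ i, 2 * (w i : E) * (x i * y i) := by
  simp only [QuadraticMap.polar, QuadraticMap.weightedSumSquares_apply, ← Finset.sum_sub_distrib,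
    Pi.add_apply, Units.smul_def, smul_eq_mul]
  exact Finset.sum_congr rfl fun i _ => by ring

/-- The diagonal form with coefficients `w`. -/
noncomputable def diagForm {ι : Type} [Fintype ι] (w : ι → Eˣ) : QuadSpace E where
  carrier := ι → E
  form := QuadraticMap.weightedSumSquares E w
  regular := polarBilin_nondegenerate <| by
    classical
    intro x hx
    funext i
    have h := hx (Pi.single i 1)
    rw [QuadraticMap.polarBilin_apply_apply, polar_weightedSumSquares,
      Finset.sum_eq_single i (fun j _ hj => by simp [hj]) (by simp)] at h
    simpa [NeZero.ne] using h

/-- The isometry class of a diagonal form. -/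
noncomputable def diag {ι : Type} [Fintype ι] (w : ι → Eˣ) : QuadClass E :=
  QuadClass.mk (diagForm w)

variable {ι κ : Type} [Fintype ι] [Fintype κ]

theorem diag_eq_of_isometryEquiv {w : ι → Eˣ} {w' : κ → Eˣ}
    (e : (QuadraticMap.weightedSumSquares E w).IsometryEquiv
      (QuadraticMap.weightedSumSquares E w')) : diag w = diag w' :=
  QuadClass.mk_eq (V := diagForm w) (W := diagForm w') e

theorem diag_sumElim (w : ι → Eˣ) (w' : κ → Eˣ) : diag (Sum.elim w w') = diag w + diag w' := by
  let e : (QuadraticMap.weightedSumSquares E (Sum.elim w w')).IsometryEquiv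
      ((QuadraticMap.weightedSumSquares E w).prod (QuadraticMap.weightedSumSquares E w')) :=
    ⟨LinearEquiv.sumArrowLequivProdArrow ι κ E E, fun x => by
      simp [QuadraticMap.weightedSumSquares_apply]⟩
  exact QuadClass.mk_eq (V := diagForm (Sum.elim w w')) (W := (diagForm w).sum (diagForm w')) e

theorem diag_comp_equiv (e : κ ≃ ι) (w : ι → Eˣ) : diag (w ∘ e) = diag w :=
  (diag_eq_of_isometryEquiv ⟨LinearEquiv.funCongrLeft E E e, fun x => by
    simp only [QuadraticMap.weightedSumSquares_apply]
    exact e.sum_comp fun i => w i • (x i * x i)⟩).symm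

/-- The class of the one-dimensional form `u x²`. -/
noncomputable def unitClass (u : Eˣ) : QuadClass E := diag fun _ : Unit => u

theorem diag_cons {n : ℕ} (w : Fin (n + 1) → Eˣ) :
    diag w = unitClass (w 0) + diag (Fin.tail w) := by
  rw [unitClass, ← diag_sumElim]
  let e : Unit ⊕ Fin n ≃ Fin (n + 1) :=
    (Equiv.sumComm _ _).trans ((Equiv.optionEquivSumPUnit (Fin n)).symm.trans
      (finSuccEquiv n).symm)
  rw [← diag_comp_equiv e w]
  congr 1
  funext i
  rcases i with i | i
  · simp [e]
  · simp [e, Fin.tail]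

theorem diag_fin_zero (w : Fin 0 → Eˣ) : diag w = 0 := by
  let e : (QuadraticMap.weightedSumSquares E w).IsometryEquiv
      (0 : QuadraticForm E PUnit.{v + 1}) :=
    ⟨0, fun x => by simp [QuadraticMap.weightedSumSquares_apply]⟩
  exact QuadClass.mk_eq (V := diagForm w) (W := QuadSpace.zero E) e

theorem unitClass_mul_sq (u s : Eˣ) : unitClass (u * s ^ 2) = unitClass u :=
  diag_eq_of_isometryEquiv ⟨LinearEquiv.smulOfUnit s, fun x => by
    have h : ∀ i, LinearEquiv.smulOfUnit s x i = s * x i := fun i => rfl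
    simp [QuadraticMap.weightedSumSquares_apply, Units.smul_def, h]
    ring⟩

theorem unitClass_eq_of_isSquare {u v : Eˣ} (h : IsSquare (u * v)) : unitClass u = unitClass v := by
  obtain ⟨s, hs⟩ := h
  have h1 : u = v * (v⁻¹ * s) ^ 2 := by
    rw [mul_pow, pow_two s, ← hs, pow_two, mul_assoc, mul_comm u v, inv_mul_cancel_left,
      mul_inv_cancel_left]
  rw [h1, unitClass_mul_sq]

/-- The map `(x, y) ↦ (a x + b y, b x - a y)` multiplies `x ^ 2 + y ^ 2` by `u`, and its square is
multiplication by `u`, which gives the inverse. -/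
theorem unitClass_add_self {u : Eˣ} {a b : E} (hab : a ^ 2 + b ^ 2 = u) :
    unitClass u + unitClass u = unitClass 1 + unitClass 1 := by
  rw [unitClass, unitClass, ← diag_sumElim, ← diag_sumElim]
  have hu : (u : E) ≠ 0 := u.ne_zero
  let f : E → (Unit ⊕ Unit → E) → Unit ⊕ Unit → E := fun c x =>
    Sum.elim (fun _ => c * (a * x (Sum.inl ()) + b * x (Sum.inr ())))
      fun _ => c * (b * x (Sum.inl ()) - a * x (Sum.inr ()))
  have hf : ∀ c d : E, c * d * u = 1 → ∀ x, f c (f d x) = x := by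
    intro c d hcd x
    funext i
    rcases i with ⟨⟩ | ⟨⟩
    · simp only [f, Sum.elim_inl, Sum.elim_inr]
      linear_combination x (Sum.inl ()) * (c * d * hab + hcd)
    · simp only [f, Sum.elim_inl, Sum.elim_inr]
      linear_combination x (Sum.inr ()) * (c * d * hab + hcd)
  refine diag_eq_of_isometryEquiv ⟨⟨⟨⟨f 1, fun x y => ?_⟩, fun c x => ?_⟩, f (u⁻¹ : E),
    hf _ _ (by field_simp), hf _ _ (by field_simp)⟩, fun x => ?_⟩
  · funext i
    rcases i with ⟨⟩ | ⟨⟩ <;> simp [f] <;> ring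
  · funext i
    rcases i with ⟨⟩ | ⟨⟩ <;> simp [f] <;> ring
  · simp only [QuadraticMap.weightedSumSquares_apply, Fintype.sum_sum_type, Units.smul_def]
    simp [f]
    linear_combination (x (Sum.inl ()) ^ 2 + x (Sum.inr ()) ^ 2) * hab

/-- A regular quadratic form is diagonalizable. -/
theorem exists_diag_eq (x : QuadClass E) : ∃ (n : ℕ) (w : Fin n → Eˣ), x = diag w := by
  induction x using QuadClass.ind_on with | _ V
  have : Invertible (2 : E) := invertibleOfNonzero (NeZero.ne _)
  obtain ⟨w, ⟨e⟩⟩ := V.form.equivalent_weightedSumSquares_units_of_nondegenerate' (by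
    intro x hx
    refine V.regular.1 x fun y => ?_
    have h := hx y
    rw [← QuadraticMap.two_nsmul_associated E]
    rw [LinearMap.smul_apply, LinearMap.smul_apply]
    exact (congrArg (2 • ·) h).trans (smul_zero _))
  exact ⟨_, w, QuadClass.mk_eq (W := diagForm w) e⟩

/-- The Gram determinants of a form in two bases differ by a square. -/
theorem exists_det_polar_eq {V : Type*} [AddCommGroup V] [Module E V] [DecidableEq ι]
    (Q : QuadraticForm E V) (b c : Module.Basis ι E V) : ∃ s : E,
    (Matrix.of fun i j => QuadraticMap.polar Q (c i) (c j)).det =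
      s ^ 2 * (Matrix.of fun i j => QuadraticMap.polar Q (b i) (b j)).det := by
  refine ⟨(b.toMatrix c).det, ?_⟩
  have h := LinearMap.BilinForm.toMatrix_mul_basis_toMatrix b c (B := Q.polarBilin)
  have h1 : ∀ b : Module.Basis ι E V, (Matrix.of fun i j => QuadraticMap.polar Q (b i) (b j)) =
      LinearMap.BilinForm.toMatrix b Q.polarBilin := by
    intro b
    ext i j
    simp [LinearMap.BilinForm.toMatrix_apply]
  rw [h1, h1, ← h, Matrix.det_mul, Matrix.det_mul, Matrix.det_transpose]
  ring

theorem of_polar_weightedSumSquares [DecidableEq ι] (w : ι → Eˣ) :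
    (Matrix.of fun i j => QuadraticMap.polar (QuadraticMap.weightedSumSquares E w)
      (Pi.basisFun E ι i) (Pi.basisFun E ι j)) = Matrix.diagonal fun i => 2 * (w i : E) := by
  ext i j
  rw [Matrix.of_apply, polar_weightedSumSquares, Matrix.diagonal_apply]
  by_cases hij : i = j
  · subst hij
    simp [Pi.single_apply]
  · simp [Pi.single_apply, hij, Ne.symm hij]

/-- The determinant of a diagonalization. -/
theorem exists_prod_eq [DecidableEq ι] {V : Type*} [AddCommGroup V] [Module E V]
    {Q : QuadraticForm E V} (b : Module.Basis ι E V) {w : ι → Eˣ}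
    (e : Q.IsometryEquiv (QuadraticMap.weightedSumSquares E w)) :
    ∃ s : E, 2 ^ Fintype.card ι * ∏ i, (w i : E) =
      s ^ 2 * (Matrix.of fun i j => QuadraticMap.polar Q (b i) (b j)).det := by
  obtain ⟨s, hs⟩ := exists_det_polar_eq Q b ((Pi.basisFun E ι).map e.toLinearEquiv.symm)
  refine ⟨s, hs ▸ ?_⟩
  have h3 : ∀ z, Q (e.toLinearEquiv.symm z) = QuadraticMap.weightedSumSquares E w z :=
    e.symm.map_app
  have h2 : ∀ x y : ι → E, QuadraticMap.polar Q (e.toLinearEquiv.symm x)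
      (e.toLinearEquiv.symm y) = QuadraticMap.polar (QuadraticMap.weightedSumSquares E w) x y := by
    intro x y
    rw [QuadraticMap.polar, QuadraticMap.polar, ← map_add, h3, h3, h3]
  simp only [Module.Basis.map_apply, h2]
  rw [of_polar_weightedSumSquares, Matrix.det_diagonal, Finset.prod_mul_distrib,
    Finset.prod_const, Finset.card_univ]

/-- Isometric diagonal forms have the same determinant up to squares. -/
theorem isSquare_prod_mul_prod {w w' : ι → Eˣ} (h : diag w = diag w') :
    IsSquare ((∏ i, w i) * ∏ i, w' i) := by
  classical
  obtain ⟨e⟩ : (QuadraticMap.weightedSumSquares E w).Equivalent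
    (QuadraticMap.weightedSumSquares E w') := Quotient.exact h
  obtain ⟨s, hs⟩ := exists_prod_eq (Pi.basisFun E ι) e
  rw [of_polar_weightedSumSquares, Matrix.det_diagonal, Finset.prod_mul_distrib,
    Finset.prod_const, Finset.card_univ] at hs
  have h2 : (∏ i, (w' i : E)) = s ^ 2 * ∏ i, (w i : E) := by
    refine mul_left_cancel₀ (pow_ne_zero (Fintype.card ι) (NeZero.ne (2 : E))) ?_
    rw [hs]; ring
  have hs0 : s ≠ 0 := by
    rintro rfl
    refine Finset.prod_ne_zero_iff.2 (fun i _ => (w' i).ne_zero) (h2.trans ?_)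
    simp
  refine ⟨Units.mk0 s hs0 * ∏ i, w i, Units.ext ?_⟩
  push_cast
  rw [h2, Units.val_mk0]
  ring

end Diagonal

/-! ### Classification of forms over a finite field by rank and determinant. -/

section Finite
variable {E : Type v} [Field E] [Finite E] [NeZero (2 : E)]

theorem ringChar_ne_two : ringChar E ≠ 2 := by
  intro h
  have h1 := ringChar.Nat.cast_ringChar (R := E)
  rw [h] at h1
  exact NeZero.ne (2 : E) (by exact_mod_cast h1)

variable (E) in
theorem exists_unit_nonsquare : ∃ d : Eˣ, ¬ IsSquare d := by
  obtain ⟨a, ha⟩ := FiniteField.exists_nonsquare (F := E) ringChar_ne_two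
  have ha0 : a ≠ 0 := by rintro rfl; exact ha (IsSquare.zero)
  refine ⟨Units.mk0 a ha0, fun ⟨s, hs⟩ => ha ⟨s, ?_⟩⟩
  simpa using congrArg Units.val hs

theorem isSquare_mul_of_not {u v : Eˣ} (hu : ¬ IsSquare u) (hv : ¬ IsSquare v) :
    IsSquare (u * v) := by
  have := Fintype.ofFinite E
  classical
  have key : ∀ u : Eˣ, IsSquare u ↔ quadraticChar E u = 1 := fun u => by
    rw [quadraticChar_one_iff_isSquare u.ne_zero]
    refine ⟨fun ⟨s, hs⟩ => ⟨s, by simpa using congrArg Units.val hs⟩, fun ⟨s, hs⟩ => ?_⟩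
    have hs0 : s ≠ 0 := by rintro rfl; simp at hs
    exact ⟨Units.mk0 s hs0, Units.ext hs⟩
  have key2 : ∀ u : Eˣ, ¬ IsSquare u → quadraticChar E u = -1 := fun u hu =>
    (quadraticChar_dichotomy u.ne_zero).resolve_left (mt (key u).2 hu)
  rw [key, Units.val_mul, map_mul, key2 u hu, key2 v hv]
  norm_num

open Polynomial in
theorem exists_sq_add_sq_eq (u : E) : ∃ a b : E, a ^ 2 + b ^ 2 = u := by
  have := Fintype.ofFinite E
  obtain ⟨a, b, h⟩ := FiniteField.exists_root_sum_quadratic (R := E) (f := X ^ 2)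
    (g := X ^ 2 - C u) (degree_X_pow 2) (degree_X_pow_sub_C two_pos u)
    (FiniteField.odd_card_of_char_ne_two ringChar_ne_two)
  refine ⟨a, b, ?_⟩
  simp at h
  linear_combination h

/-- If one coefficient is a square, the other absorbs the change of square class. If neither is,
both lie in the same square class, and since `u` is a sum of two squares `unitClass_add_self`
applies. -/
theorem unitClass_add (u v : Eˣ) :
    unitClass u + unitClass v = unitClass 1 + unitClass (u * v) := by
  by_cases hu : IsSquare u
  · rw [unitClass_eq_of_isSquare (u := u) (v := 1) (by simpa),
      unitClass_eq_of_isSquare (u := v) (v := u * v) (by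
        rw [mul_left_comm]
        exact hu.mul (IsSquare.mul_self v))]
  by_cases hv : IsSquare v
  · rw [add_comm, unitClass_eq_of_isSquare (u := v) (v := 1) (by simpa),
      unitClass_eq_of_isSquare (u := u) (v := u * v) (by
        rw [← mul_assoc]
        exact (IsSquare.mul_self u).mul hv)]
  have huv := isSquare_mul_of_not hu hv
  obtain ⟨a, b, hab⟩ := exists_sq_add_sq_eq (u : E)
  rw [← unitClass_eq_of_isSquare huv, unitClass_add_self hab,
    unitClass_eq_of_isSquare (u := u * v) (v := 1) (by simpa)]

/-- Over a finite field a regular form is determined by its rank and determinant. -/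
theorem diag_eq_nsmul_add {n : ℕ} (w : Fin (n + 1) → Eˣ) :
    diag w = n • unitClass 1 + unitClass (∏ i, w i) := by
  induction n with
  | zero =>
    rw [diag_cons, diag_fin_zero, add_zero, zero_nsmul]
    exact (congrArg unitClass (by simp)).trans (zero_add _).symm
  | succ n ih =>
    rw [diag_cons, ih, add_left_comm, unitClass_add, Fin.prod_univ_succ w, succ_nsmul]
    exact (add_assoc _ _ _).symm

theorem unitClass_eq_of_not_isSquare {u v : Eˣ} (hu : ¬ IsSquare u) (hv : ¬ IsSquare v) :
    unitClass u = unitClass v :=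
  unitClass_eq_of_isSquare (isSquare_mul_of_not hu hv)

/-! ### The Grothendieck-Witt group of a finite field -/

theorem gw_of_eq_of_iff {a b : QuadClass E} : (GrothendieckAddGroup.of a : GW E) =
    GrothendieckAddGroup.of b ↔ ∃ c, c + a = c + b := by
  change AddLocalization.mk a 0 = AddLocalization.mk b 0 ↔ _
  rw [AddLocalization.mk_eq_mk_iff, AddLocalization.r_iff_exists]
  simp

/-- Equality in the Grothendieck group is isometry after adding some form `c`. Diagonalizing `c` and
comparing determinants would make `d` a square. -/
theorem gw_of_unitClass_ne {d : Eˣ} (hd : ¬ IsSquare d) :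
    (GrothendieckAddGroup.of (unitClass d) : GW E) ≠ GrothendieckAddGroup.of (unitClass 1) := by
  rw [Ne, gw_of_eq_of_iff]
  rintro ⟨c, hc⟩
  obtain ⟨n, w, rfl⟩ := exists_diag_eq c
  rw [unitClass, unitClass, ← diag_sumElim, ← diag_sumElim] at hc
  have h := isSquare_prod_mul_prod hc
  simp only [Fintype.prod_sum_type, Sum.elim_inl, Sum.elim_inr, Finset.univ_unique,
    Finset.prod_const, Finset.card_singleton, pow_one, mul_one] at h
  obtain ⟨s, hs⟩ := h
  refine hd ⟨s * (∏ i, w i)⁻¹, ?_⟩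
  rw [mul_mul_mul_comm, ← hs, mul_comm (∏ i, w i) d, mul_assoc d, mul_assoc d, mul_mul_mul_comm,
    mul_inv_cancel, mul_one, mul_one]

/-- The rank of a quadratic form. -/
noncomputable def gwRank (E : Type v) [Field E] : GW E →+ ℤ :=
  GrothendieckAddGroup.lift
    { toFun := Quotient.lift (fun V : QuadSpace E => (Module.finrank E V : ℤ)) fun V W ⟨e⟩ =>
        congrArg _ e.toLinearEquiv.finrank_eq
      map_zero' := by
        change ((Module.finrank E PUnit.{v + 1} : ℕ) : ℤ) = 0
        rw [Module.finrank_zero_of_subsingleton, Nat.cast_zero]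
      map_add' := fun a b => by
        induction a using QuadClass.ind_on with | _ V
        induction b using QuadClass.ind_on with | _ W
        change ((Module.finrank E (V × W) : ℕ) : ℤ) = (Module.finrank E V : ℤ) + Module.finrank E W
        rw [Module.finrank_prod, Nat.cast_add] }

theorem gwRank_of (V : QuadSpace E) :
    gwRank E (GrothendieckAddGroup.of (QuadClass.mk V)) = Module.finrank E V :=
  DFunLike.congr_fun (GrothendieckAddGroup.lift.symm_apply_apply _) (QuadClass.mk V)

theorem gwRank_unitClass (u : Eˣ) : gwRank E (GrothendieckAddGroup.of (unitClass u)) = 1 := by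
  refine (gwRank_of (diagForm fun _ : Unit => u)).trans ?_
  change ((Module.finrank E (Unit → E) : ℕ) : ℤ) = 1
  simp

end Finite

/-! ### Trace forms of finite fields -/

section TraceForm
variable {E M : Type v} [Field E] [Field M] [Algebra E M] [FiniteDimensional E M]

/-- The matrix of conjugates of a basis. -/
noncomputable def conjMatrix [IsGalois E M] {ι : Type*} (b : Module.Basis ι E M) :
    Matrix Gal(M/E) ι M :=
  Matrix.of fun σ i => σ (b i)

/-- An automorphism permutes the rows of the matrix of conjugates by left multiplication. -/
theorem map_det_conjMatrix [IsGalois E M] (b : Module.Basis Gal(M/E) E M) (φ : Gal(M/E))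
    [DecidableEq Gal(M/E)] :
    φ (conjMatrix b).det = ((permSign Gal(M/E) (Equiv.mulLeft φ) : ℤ) : M) * (conjMatrix b).det := by
  have h1 : φ (conjMatrix b).det = ((conjMatrix b).map φ).det :=
    RingHom.map_det (φ : M →+* M) (conjMatrix b)
  have h2 : (conjMatrix b).map φ = (conjMatrix b).submatrix (Equiv.mulLeft φ) id := by
    ext σ i
    rfl
  rw [h1, h2, Matrix.det_permute, permSign_eq_sign]

/-- The trace is the sum of the conjugates, so the trace matrix is the transposed matrix of
conjugates times the matrix itself. -/
theorem det_conjMatrix_sq [IsGalois E M] (b : Module.Basis Gal(M/E) E M)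
    [DecidableEq Gal(M/E)] : algebraMap E M (discr E b) = (conjMatrix b).det ^ 2 := by
  have h : (algebraMap E M).mapMatrix (traceMatrix E b) = (conjMatrix b).transpose * conjMatrix b := by
    ext i j
    rw [RingHom.mapMatrix_apply, Matrix.map_apply, traceMatrix_apply, traceForm_apply,
      trace_eq_sum_automorphisms, Matrix.mul_apply]
    exact Finset.sum_congr rfl fun σ _ => map_mul σ _ _
  rw [discr_def, RingHom.map_det, h, Matrix.det_mul, Matrix.det_transpose, pow_two]

variable [Finite E] [NeZero (2 : E)]

theorem zpowers_frobenius_eq_top [Fintype E] (σ : Gal(M/E)) :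
    ∃ n : ℕ, FiniteField.frobeniusAlgEquivOfAlgebraic E M ^ n = σ := by
  have : Finite M := Module.finite_of_finite E
  obtain ⟨n, hn⟩ := (FiniteField.bijective_frobeniusAlgEquivOfAlgebraic_pow E M).2 σ
  exact ⟨n, hn⟩

/-- Frobenius generates the Galois group, so left multiplication by it is a single cycle. -/
theorem permSign_mulLeft_frobenius [Fintype E] :
    permSign Gal(M/E) (Equiv.mulLeft (FiniteField.frobeniusAlgEquivOfAlgebraic E M)) =
      -(-1) ^ Module.finrank E M := by
  have : Finite M := Module.finite_of_finite E
  rw [permSign_of_sameCycle, IsGalois.card_aut_eq_finrank]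
  intro σ τ
  obtain ⟨n, hn⟩ := zpowers_frobenius_eq_top (E := E) (τ * σ⁻¹)
  refine ⟨n, ?_⟩
  rw [zpow_natCast, Equiv.pow_mulLeft, hn]
  simp

/-- The discriminant of an extension of finite fields is a square if and only if the degree is
odd. -/
theorem isSquare_discr_iff (b : Module.Basis Gal(M/E) E M) [DecidableEq Gal(M/E)] :
    IsSquare (discr E b) ↔ Odd (Module.finrank E M) := by
  have := Fintype.ofFinite E
  have : Finite M := Module.finite_of_finite E
  set φ := FiniteField.frobeniusAlgEquivOfAlgebraic E M with hφ
  have h1 := map_det_conjMatrix b φ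
  rw [permSign_mulLeft_frobenius] at h1
  have h2 := det_conjMatrix_sq b
  have h0 : (conjMatrix b).det ≠ 0 := by
    intro h
    rw [h, zero_pow two_ne_zero, map_eq_zero] at h2
    exact discr_not_zero_of_basis E b h2
  -- The determinant of the matrix of conjugates is a square root of the discriminant in `M`. The
  -- discriminant is a square in `E` exactly when this root lies in `E`, that is, when Frobenius
  -- fixes it instead of changing its sign; the two differ since `2 ≠ 0`.
  constructor
  · rintro ⟨c, hc⟩
    rw [hc, map_mul, ← pow_two, sq_eq_sq_iff_eq_or_eq_neg] at h2
    have h3 : φ (conjMatrix b).det = (conjMatrix b).det := by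
      rcases h2 with h2 | h2
      · rw [← h2, AlgEquiv.commutes]
      · rw [eq_neg_iff_add_eq_zero, add_comm, ← eq_neg_iff_add_eq_zero] at h2
        rw [h2, map_neg, AlgEquiv.commutes]
    rw [h3] at h1
    by_contra hodd
    rw [Nat.not_odd_iff_even] at hodd
    rw [hodd.neg_one_pow] at h1
    have h4 : (2 : M) * (conjMatrix b).det = 0 := by
      push_cast at h1
      linear_combination h1
    have h5 : (2 : M) ≠ 0 := by
      have := (map_ne_zero (algebraMap E M)).2 (NeZero.ne (2 : E))
      rwa [map_ofNat] at this
    exact (mul_ne_zero h5 h0) h4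
  · intro hodd
    rw [hodd.neg_one_pow] at h1
    have h3 : φ (conjMatrix b).det = (conjMatrix b).det := by
      rw [h1]; simp
    have h4 : (conjMatrix b).det ∈ Set.range (algebraMap E M) := by
      rw [IsGalois.mem_range_algebraMap_iff_fixed]
      intro σ
      obtain ⟨n, rfl⟩ := zpowers_frobenius_eq_top (E := E) σ
      have h5 : φ ∈ MulAction.stabilizer Gal(M/E) (conjMatrix b).det := h3
      exact MulAction.mem_stabilizer_iff.1 (pow_mem h5 n)
    obtain ⟨c, hc⟩ := h4
    refine ⟨c, (algebraMap E M).injective ?_⟩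
    rw [h2, ← hc, map_mul, pow_two]

/-- The class of the trace form of an extension of finite fields. -/
theorem mk_traceQuadSpace {d : Eˣ} (hd : ¬ IsSquare d) {k : ℕ} (hk : Module.finrank E M = k + 1) :
    QuadClass.mk (traceQuadSpace E M) =
      k • unitClass 1 + unitClass (if Even (k + 1) then d else 1) := by
  classical
  obtain ⟨n, w, hw⟩ := exists_diag_eq (QuadClass.mk (traceQuadSpace E M))
  obtain ⟨e⟩ : (traceForm E M).toQuadraticMap.Equivalent
    (QuadraticMap.weightedSumSquares E w) := Quotient.exact hw
  have hn : n = k + 1 := by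
    rw [← hk, e.toLinearEquiv.finrank_eq, Module.finrank_fintype_fun_eq_card, Fintype.card_fin]
  subst hn
  rw [hw, diag_eq_nsmul_add]
  congr 1
  have hcard : Nat.card Gal(M/E) = k + 1 := by
    rw [← hk]
    exact IsGalois.card_aut_eq_finrank E M
  let eG : Fin (k + 1) ≃ Gal(M/E) := (Finite.equivFinOfCardEq hcard).symm
  let b : Module.Basis (Fin (k + 1)) E M :=
    (Module.finBasisOfFinrankEq E M hk)
  obtain ⟨s, hs⟩ := exists_prod_eq b e
  -- The polar form is twice the bilinear trace form; the resulting power of two cancels against the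
  -- one on the diagonal side.
  have hpol : (Matrix.of fun i j => QuadraticMap.polar (traceForm E M).toQuadraticMap (b i) (b j)) =
      (2 : E) • traceMatrix E b := by
    ext i j
    rw [Matrix.of_apply, LinearMap.BilinMap.polar_toQuadraticMap, Matrix.smul_apply,
      traceMatrix_apply, traceForm_apply, traceForm_apply, mul_comm (b j), smul_eq_mul, two_mul]
  rw [hpol, Matrix.det_smul, Fintype.card_fin] at hs
  have h2 : (∏ i, (w i : E)) = s ^ 2 * discr E (b.reindex eG) := by
    refine mul_left_cancel₀ (pow_ne_zero (k + 1) (NeZero.ne (2 : E))) ?_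
    rw [hs, Module.Basis.coe_reindex, discr_reindex, discr_def]
    ring
  have hs0 : s ≠ 0 := by
    rintro rfl
    refine Finset.prod_ne_zero_iff.2 (fun i _ => (w i).ne_zero) (h2.trans ?_)
    simp
  have h3 : IsSquare (∏ i, w i) ↔ Odd (k + 1) := by
    have hsq := isSquare_discr_iff (b.reindex eG)
    rw [hk] at hsq
    rw [← hsq]
    constructor
    · rintro ⟨r, hr⟩
      refine ⟨r * s⁻¹, ?_⟩
      have h4 := congrArg Units.val hr
      push_cast at h4
      rw [h2] at h4
      field_simp
      linear_combination h4
    · rintro ⟨r, hr⟩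
      rw [hr] at h2
      have hr0 : r ≠ 0 := by
        rintro rfl
        refine Finset.prod_ne_zero_iff.2 (fun i _ => (w i).ne_zero) (h2.trans ?_)
        simp
      refine ⟨Units.mk0 s hs0 * Units.mk0 r hr0, Units.ext ?_⟩
      push_cast
      rw [h2, Units.val_mk0, Units.val_mk0]
      ring
  split_ifs with he
  · exact unitClass_eq_of_not_isSquare (by rwa [h3, Nat.not_odd_iff_even]) hd
  · exact unitClass_eq_of_isSquare (by rwa [mul_one, h3, ← Nat.not_even_iff_odd])

end TraceForm

/-! ### The Dress map over a finite field -/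

section DressMap
open FinGSet BurnsideRing
variable {F : Type u} {K : Type v} [Field F] [Field K] [Algebra F K] [IsGalois F K]
  [NeZero (2 : F)]

theorem finrank_fixedFld (H : OpenSubgroup Gal(K/F)) :
    Module.finrank F (fixedFld F K H) = H.toSubgroup.index := by
  rw [IntermediateField.finrank_eq_fixingSubgroup_index,
    InfiniteGalois.fixingSubgroup_fixedField ⟨H.toSubgroup, H.isClosed⟩]

theorem finrank_fixedExt {L H : OpenSubgroup Gal(K/F)} (h : L ≤ H) :
    Module.finrank (fixedFld F K H) (fixedExt h) = L.toSubgroup.relIndex H.toSubgroup := by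
  have h1 : Module.finrank F (fixedFld F K H) * Module.finrank (fixedFld F K H) (fixedExt h) =
      Module.finrank F (fixedFld F K L) := Module.finrank_mul_finrank F (fixedFld F K H) (fixedExt h)
  rw [finrank_fixedFld, finrank_fixedFld, ← Subgroup.relIndex_mul_index (show L.toSubgroup ≤ _ from h),
    mul_comm] at h1
  refine Nat.eq_of_mul_eq_mul_right (Nat.pos_of_ne_zero ?_) h1
  rw [← finrank_fixedFld]
  exact Module.finrank_pos.ne'

theorem relIndex_stab {H : OpenSubgroup Gal(K/F)} (X : FinGSet H) [MulAction.IsPretransitive H X]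
    (x : X) : (stab X x).toSubgroup.relIndex H.toSubgroup = Nat.card X := by
  rw [← MulAction.index_stabilizer_of_transitive H x]
  exact congrArg Subgroup.index
    (Subgroup.comap_map_eq_self_of_injective H.toSubgroup.subtype_injective _)

theorem dressMap_cls {H : OpenSubgroup Gal(K/F)} (X : FinGSet H) :
    dressMap F K H (cls X) = GrothendieckAddGroup.of (setClass X) :=
  GrothendieckRing.lift_of _ _

theorem setClass_of_transitive {H : OpenSubgroup Gal(K/F)} (X : FinGSet H)
    [MulAction.IsPretransitive H X] (x : X) : setClass X = pointClass X x := by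
  have := (MulAction.pretransitive_iff_subsingleton_quotient H X).1 inferInstance
  let _ : Unique (MulAction.orbitRel.Quotient H X) :=
    ⟨⟨Quotient.mk _ x⟩, fun _ => Subsingleton.elim _ _⟩
  exact finsum_unique _

end DressMap

/-! ### The Dress map in terms of rank and sign. -/

section DressFinite
open FinGSet BurnsideRing
variable {F : Type u} {K : Type v} [Field F] [Field K] [Algebra F K] [Finite F]
  [Algebra.IsAlgebraic F K] [NeZero (2 : F)]

/-- The form `⟨d⟩ + ⟨d⟩` has square determinant, so it is `⟨1⟩ + ⟨1⟩`. This makes `signClass` a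
homomorphism. -/
theorem two_nsmul_of_unitClass_sub {E : Type v} [Field E] [Finite E] [NeZero (2 : E)] (d : Eˣ) :
    (GrothendieckAddGroup.of (unitClass d) - GrothendieckAddGroup.of (unitClass 1) : GW E) +
      (GrothendieckAddGroup.of (unitClass d) - GrothendieckAddGroup.of (unitClass 1)) = 0 := by
  have h1 : unitClass d + unitClass d = unitClass 1 + unitClass 1 := by
    rw [unitClass_add d d, unitClass_eq_of_isSquare (u := d * d) (v := 1) ⟨d, mul_one _⟩]
  have h2 := congrArg (GrothendieckAddGroup.of (M := QuadClass E)) h1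
  rw [map_add, map_add] at h2
  rw [sub_add_sub_comm, h2, sub_self]

/-- The homomorphism from the group of signs which sends `-1` to the class `⟨d⟩ - ⟨1⟩`. -/
noncomputable def signClass {E : Type v} [Field E] [Finite E] [NeZero (2 : E)] (d : Eˣ) :
    Additive ℤˣ →+ GW E :=
  AddMonoidHom.mk' (fun s => if s = 0 then 0 else
    GrothendieckAddGroup.of (unitClass d) - GrothendieckAddGroup.of (unitClass 1)) <| by
    have h := two_nsmul_of_unitClass_sub d
    have hs : ∀ s : Additive ℤˣ, s = 0 ∨ s = Additive.ofMul (-1) := fun s =>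
      Int.units_eq_one_or s.toMul
    have h1 : Additive.ofMul (-1 : ℤˣ) ≠ 0 := by decide
    have h2 : Additive.ofMul (-1 : ℤˣ) + Additive.ofMul (-1 : ℤˣ) = 0 := by decide
    generalize (GrothendieckAddGroup.of (unitClass d) -
      GrothendieckAddGroup.of (unitClass 1) : GW E) = ν at h ⊢
    intro a b
    rcases hs a with rfl | rfl <;> rcases hs b with rfl | rfl <;> simp [h1, h2, h]

theorem dressMap_cls_of_transitive {H : OpenSubgroup Gal(K/F)} (X : FinGSet H)
    [MulAction.IsPretransitive H X] {d : (fixedFld F K H)ˣ} (hd : ¬ IsSquare d) {k : ℕ}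
    (hk : Nat.card X = k + 1) :
    dressMap F K H (cls X) = GrothendieckAddGroup.of
      (k • unitClass 1 + unitClass (if Even (k + 1) then d else 1)) := by
  have : Finite (fixedFld F K H) := Module.finite_of_finite F
  obtain ⟨x⟩ : Nonempty X := (Nat.card_pos_iff.1 (by omega)).1
  rw [dressMap_cls, setClass_of_transitive X x]
  congr 1
  exact mk_traceQuadSpace hd (by rw [finrank_fixedExt, relIndex_stab, hk])

/-- The Dress map is determined by the rank and by the sign of a topological generator. -/
theorem dressMap_eq {H : OpenSubgroup Gal(K/F)} {g : H} (hg : IsTopGen g)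
    [Finite (fixedFld F K H)] {d : (fixedFld F K H)ˣ} (hd : ¬ IsSquare d) (x : BurnsideRing H) :
    dressMap F K H x =
      mark 1 x • GrothendieckAddGroup.of (unitClass 1) + signClass d (sgn g x) := by
  have hx : x ∈ AddSubgroup.closure (t H '' {k | IsTransCard H k}) := by
    rw [closure_t_eq_top hg]; trivial
  induction hx using AddSubgroup.closure_induction with
  | zero => simp
  | add x y _ _ hx hy => rw [map_add, map_add, map_add, map_add, hx, hy, add_smul]; abel
  | neg x _ hx => rw [map_neg, map_neg, map_neg, map_neg, hx, neg_smul]; abel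
  | mem x hx =>
    obtain ⟨k, hk, rfl⟩ := hx
    have hm := hk.mark_t hg 0
    rw [pow_zero, if_pos (dvd_zero _)] at hm
    rw [hm, hk.sgn_t hg]
    obtain ⟨h0, X, hX, rfl⟩ := hk
    obtain ⟨k, hk⟩ := Nat.exists_eq_succ_of_ne_zero h0
    rw [t_eq_cls hg X rfl, dressMap_cls_of_transitive X hd hk, hk, map_add, map_nsmul,
      Nat.cast_succ, add_smul, one_smul, natCast_zsmul, add_assoc]
    congr 1
    change _ = _ + (if Additive.ofMul (-(-1 : ℤˣ) ^ (k + 1)) = 0 then _ else _)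
    -- A cycle of length `k + 1` is odd exactly when `k + 1` is even, which is when the trace form
    -- has nonsquare determinant.
    by_cases he : Even (k + 1)
    · have h1 : Additive.ofMul (-1 : ℤˣ) ≠ 0 := by decide
      rw [if_pos he, he.neg_one_pow, if_neg h1, add_sub_cancel]
    · rw [if_neg he, (Nat.not_even_iff_odd.1 he).neg_one_pow, neg_neg, if_pos ofMul_one, add_zero]

/-- The trace ideal of an algebraic extension of a finite field consists of the virtual sets of
rank zero and trivial sign. -/
theorem traceIdeal_eq_signKernel {g : Gal(K/F)} (hg : IsTopGen g) :
    traceIdeal F K = fun H : OpenSubgroup Gal(K/F) => signKernel H := by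
  funext H
  have : Finite (fixedFld F K H) := Module.finite_of_finite F
  obtain ⟨d, hd⟩ := exists_unit_nonsquare (fixedFld F K H)
  have hgen := isTopGen_genOf hg H
  ext x
  rw [mem_signKernel_iff_of_isTopGen hgen]
  change dressMap F K H x = 0 ↔ _
  rw [dressMap_eq hgen hd]
  constructor
  · intro h
    have h1 := congrArg (gwRank (fixedFld F K H)) h
    -- The class `⟨d⟩ - ⟨1⟩` has rank zero, so the rank isolates the first term. The sign is then
    -- detected because this class is nonzero.
    have h2 : ∀ s, gwRank (fixedFld F K H) (signClass d s) = 0 := by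
      intro s
      change gwRank _ (if s = 0 then _ else _) = 0
      split_ifs
      · exact map_zero _
      · rw [map_sub, gwRank_unitClass, gwRank_unitClass, sub_self]
    rw [map_add, map_zsmul, h2, gwRank_unitClass, map_zero, add_zero, smul_eq_mul, mul_one] at h1
    refine ⟨h1, ?_⟩
    rw [h1, zero_smul, zero_add] at h
    by_contra hs
    change (if _ then _ else _) = _ at h
    rw [if_neg hs, sub_eq_zero] at h
    exact gw_of_unitClass_ne hd h
  · rintro ⟨h1, h2⟩
    rw [h1, h2, zero_smul, map_zero, add_zero]

end DressFinite

/-! ### Galois groups of algebraic extensions of finite fields -/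

section FiniteFieldGalois
open FinGSet BurnsideRing
variable {F : Type u} {K : Type v} [Field F] [Field K] [Algebra F K] [Finite F]

/-- The Frobenius automorphism is a topological generator of the Galois group. -/
theorem isTopGen_frobenius [Fintype F] [Algebra.IsAlgebraic F K] :
    IsTopGen (FiniteField.frobeniusAlgEquivOfAlgebraic F K) := by
  refine dense_iff_inter_open.2 fun W hW ⟨σ, hσ⟩ => ?_
  have h1 : (fun τ => σ * τ) ⁻¹' W ∈ nhds (1 : Gal(K/F)) :=
    (hW.preimage (by fun_prop)).mem_nhds (by simpa using hσ)
  -- The neighbourhood contains all automorphisms that fix some finite normal subextension `E`, and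
  -- on the finite field `E` the automorphism `σ` is a power of Frobenius.
  obtain ⟨E, hfin, hnorm, hE⟩ := (krullTopology_mem_nhds_one_iff_of_normal F K _).1 h1
  have : Finite E := Module.finite_of_finite F
  obtain ⟨p, hp⟩ := CharP.exists F
  have : Fact p.Prime := ⟨CharP.char_is_prime F p⟩
  obtain ⟨n, hn⟩ := FiniteField.exists_forall_apply_eq_pow F p E (AlgEquiv.restrictNormal σ E)
  refine ⟨FiniteField.frobeniusAlgEquivOfAlgebraic F K ^ n, ?_, n, zpow_natCast _ _⟩
  have h2 : σ⁻¹ * FiniteField.frobeniusAlgEquivOfAlgebraic F K ^ n ∈ E.fixingSubgroup := by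
    rw [IntermediateField.mem_fixingSubgroup_iff]
    intro x hx
    have h3 := congrArg (algebraMap E K) (hn ⟨x, hx⟩)
    rw [AlgEquiv.restrictNormal_commutes, map_pow] at h3
    rw [AlgEquiv.mul_apply, AlgEquiv.coe_pow,
      FiniteField.coe_frobeniusAlgEquivOfAlgebraic_iterate, Fintype.card_eq_nat_card]
    change σ⁻¹ ((algebraMap E K ⟨x, hx⟩) ^ _) = _
    rw [← h3]
    exact σ.symm_apply_apply _
  have h4 := hE h2
  rwa [Set.mem_preimage, mul_inv_cancel_left] at h4

variable (F K) in
theorem exists_isTopGen [Algebra.IsAlgebraic F K] : ∃ g : Gal(K/F), IsTopGen g := by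
  have := Fintype.ofFinite F
  exact ⟨_, isTopGen_frobenius⟩

omit [Finite F] in
theorem isTransCard_gal [IsGalois F K] (E : IntermediateField F K) [FiniteDimensional F E] :
    IsTransCard Gal(K/F) (Module.finrank F E) := by
  rw [isTransCard_iff_exists_subgroup]
  exact ⟨⟨E.fixingSubgroup, E.fixingSubgroup_isOpen⟩,
    (IntermediateField.finrank_eq_fixingSubgroup_index K E).symm⟩

/-- The indices of the open subgroups of the Galois group of a finite extension. -/
theorem isTransCard_gal_iff_dvd [FiniteDimensional F K] {k : ℕ} :
    IsTransCard Gal(K/F) k ↔ k ∣ Module.finrank F K := by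
  constructor
  · rw [isTransCard_iff_exists_subgroup]
    rintro ⟨U, rfl⟩
    rw [← IsGalois.card_aut_eq_finrank]
    exact U.toSubgroup.index_dvd_card
  · intro h
    obtain ⟨g, hg⟩ := exists_isTopGen F K
    refine IsTransCard.of_dvd hg (isTransCard_iff_exists_subgroup.2
      ⟨⟨⊥, isOpen_discrete _⟩, ?_⟩) h
    rw [← IsGalois.card_aut_eq_finrank]
    exact Subgroup.index_bot

/-- The absolute Galois group of a finite field has open subgroups of every index. -/
theorem isTransCard_gal_of_isAlgClosure [IsAlgClosure F K] {k : ℕ} (hk : k ≠ 0) :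
    IsTransCard Gal(K/F) k := by
  have : NeZero k := ⟨hk⟩
  have := IsAlgClosure.isAlgClosed (K := K) F
  obtain ⟨p, hp⟩ := CharP.exists F
  have : Fact p.Prime := ⟨CharP.char_is_prime F p⟩
  let _ : Algebra (ZMod p) F := ZMod.algebra F p
  -- The image in `K` of the extension of degree `k` is an intermediate field whose fixing subgroup
  -- has index `k`.
  let f : FiniteField.Extension F p k →ₐ[F] K := IsAlgClosed.lift
  let e : FiniteField.Extension F p k ≃ₐ[F] f.fieldRange := AlgEquiv.ofInjectiveField f
  have : FiniteDimensional F f.fieldRange := Module.Finite.equiv e.toLinearEquiv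
  have h := isTransCard_gal f.fieldRange
  rwa [← e.toLinearEquiv.finrank_eq, FiniteField.finrank_extension] at h

end FiniteFieldGalois

/-! ### The Galois group of the quadratic closure. -/

section QuadraticClosure
open FinGSet BurnsideRing
variable {F : Type u} {Q : Type v} [Field F] [Finite F] [Field Q] [Algebra F Q]
  [IsQuadraticClosure F Q]

/-- The elements of `Q` which are fixed by some `φ ^ (2 ^ n)`. -/
def twoPowerFixed (φ : Gal(Q/F)) : IntermediateField F Q where
  carrier := {x | ∃ n : ℕ, ∀ m ≥ n, (φ ^ 2 ^ m) x = x}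
  mul_mem' := by
    rintro x y ⟨n, hn⟩ ⟨n', hn'⟩
    exact ⟨max n n', fun m hm => by
      rw [map_mul, hn m (le_of_max_le_left hm), hn' m (le_of_max_le_right hm)]⟩
  add_mem' := by
    rintro x y ⟨n, hn⟩ ⟨n', hn'⟩
    exact ⟨max n n', fun m hm => by
      rw [map_add, hn m (le_of_max_le_left hm), hn' m (le_of_max_le_right hm)]⟩
  algebraMap_mem' x := ⟨0, fun m _ => AlgEquiv.commutes _ x⟩
  inv_mem' := by
    rintro x ⟨n, hn⟩
    exact ⟨n, fun m hm => by rw [map_inv₀, hn m hm]⟩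

/-- A square root `y` of an element fixed by `φ ^ 2 ^ m` is sent by it to `y` or `-y`, hence is
fixed by `φ ^ 2 ^ (m + 1)`. The subfield is therefore closed under square roots, and minimality of
`Q` applies. -/
theorem twoPowerFixed_eq_top (φ : Gal(Q/F)) : twoPowerFixed φ = ⊤ := by
  refine IsQuadraticClosure.eq_top _ ?_
  rintro ⟨x, n, hn⟩
  obtain ⟨y, hy⟩ := IsQuadraticClosure.isSquare F x
  refine ⟨⟨y, n + 1, fun m hm => ?_⟩, Subtype.ext hy⟩
  obtain ⟨m, rfl⟩ := Nat.exists_eq_add_of_le' (show 1 ≤ m by omega)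
  have h1 := hn m (by omega)
  rw [hy, map_mul, mul_self_eq_mul_self_iff] at h1
  rw [pow_succ, pow_mul, pow_two, AlgEquiv.mul_apply]
  rcases h1 with h1 | h1
  · rw [h1, h1]
  · rw [h1, map_neg, h1, neg_neg]

variable [NeZero (2 : F)]

/-- The fixed field of `U` is finite, so a single `g ^ 2 ^ N` fixes all of it and lies in `U`; the
index of `U` then divides `2 ^ N`. -/
theorem exists_index_eq_two_pow {g : Gal(Q/F)} (hg : IsTopGen g) (U : OpenSubgroup Gal(Q/F)) :
    ∃ n : ℕ, U.toSubgroup.index = 2 ^ n := by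
  have hfin : Finite (fixedFld F Q U) := Module.finite_of_finite F
  have h1 : ∀ x : fixedFld F Q U, ∃ n : ℕ, ∀ m ≥ n, (g ^ 2 ^ m) x.1 = x.1 := fun x => by
    have h2 : x.1 ∈ twoPowerFixed g := by rw [twoPowerFixed_eq_top]; trivial
    exact h2
  choose n hn using h1
  obtain ⟨N, hN⟩ := (Set.finite_range n).bddAbove
  have h3 : g ^ 2 ^ N ∈ (fixedFld F Q U).fixingSubgroup := by
    rw [IntermediateField.mem_fixingSubgroup_iff]
    exact fun x hx => hn ⟨x, hx⟩ N (hN ⟨_, rfl⟩)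
  rw [InfiniteGalois.fixingSubgroup_fixedField ⟨U.toSubgroup, U.isClosed⟩] at h3
  have h4 := (hg.zpow_mem_iff U.isOpen ((2 ^ N : ℕ) : ℤ)).1 (by rwa [zpow_natCast])
  rw [Int.natCast_dvd_natCast, Nat.dvd_prime_pow Nat.prime_two] at h4
  obtain ⟨k, -, hk⟩ := h4
  exact ⟨k, hk⟩

/-- The indices of the open subgroups of the Galois group of the quadratic closure. -/
theorem isTransCard_quadraticClosure_iff {k : ℕ} :
    IsTransCard Gal(Q/F) k ↔ ∃ n : ℕ, k = 2 ^ n := by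
  obtain ⟨g, hg⟩ := exists_isTopGen F Q
  constructor
  · rw [isTransCard_iff_exists_subgroup]
    rintro ⟨U, rfl⟩
    exact exists_index_eq_two_pow hg U
  · rintro ⟨n, rfl⟩
    induction n with
    | zero => exact isTransCard_iff_exists_subgroup.2 ⟨⊤, Subgroup.index_top⟩
    | succ n ih =>
      obtain ⟨U, hU⟩ := isTransCard_iff_exists_subgroup.1 ih
      have hfin : Finite (fixedFld F Q U) := Module.finite_of_finite F
      obtain ⟨d, hd⟩ := exists_unit_nonsquare (fixedFld F Q U)
      -- A square root of a nonsquare of the fixed field is moved by `U`, so its stabilizer cuts `U`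
      -- down strictly. The new index is a larger power of two, and divisors of indices are again
      -- indices.
      obtain ⟨y, hy⟩ := IsQuadraticClosure.isSquare F (d : fixedFld F Q U).1
      have hyU : y ∉ fixedFld F Q U := by
        intro h
        refine hd ⟨Units.mk0 ⟨y, h⟩ ?_, Units.ext (Subtype.ext hy)⟩
        intro h0
        have hy0 : y = 0 := congrArg Subtype.val h0
        rw [hy0, mul_zero] at hy
        exact d.ne_zero (Subtype.ext hy)
      let V : OpenSubgroup Gal(Q/F) :=
        U ⊓ ⟨MulAction.stabilizer Gal(Q/F) y, stabilizer_isOpen_of_isIntegral y⟩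
      have hVU : V.toSubgroup ≤ U.toSubgroup := fun σ hσ => hσ.1
      obtain ⟨m, hm⟩ := exists_index_eq_two_pow hg V
      have hne : V.toSubgroup.index ≠ U.toSubgroup.index := by
        intro h
        refine hyU fun σ => ?_
        have h1 : σ.1 ∈ V.toSubgroup := by
          rw [hg.eq_of_index_eq V.isOpen U.isOpen h]
          exact σ.2
        exact h1.2
      have hdvd := Subgroup.index_dvd_of_le hVU
      rw [hm, hU] at hne hdvd
      have hnm : n ≤ m := (Nat.pow_dvd_pow_iff_le_right' (b := 0)).1 hdvd
      have hlt : n + 1 ≤ m := lt_of_le_of_ne hnm fun h => hne (h ▸ rfl)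
      exact (isTransCard_iff_exists_subgroup.2 ⟨V, hm⟩).of_dvd hg (pow_dvd_pow 2 hlt)

end QuadraticClosure

/-! ### The basic elements of the sign kernel -/

section BasicElements
open FinGSet BurnsideRing
variable {H : Type v} [Group H] [TopologicalSpace H] [IsTopologicalGroup H] {g : H}

theorem sgn_one (h : H) : sgn h (1 : BurnsideRing H) = 0 := by
  refine (sgn_cls h (point H)).trans ?_
  have h1 : actSign h (point H) = 1 := by
    have h2 : (MulAction.toPerm h : Equiv.Perm (point H)) = 1 := by
      ext x
      rfl
    rw [actSign, h2, map_one]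
  rw [h1, ofMul_one]

theorem sgn_natCast (h : H) (n : ℕ) : sgn h (n : BurnsideRing H) = 0 := by
  rw [← nsmul_one, map_nsmul, sgn_one, smul_zero]

theorem IsTransCard.mark_one_t (hg : IsTopGen g) {k : ℕ} (hk : IsTransCard H k) :
    mark 1 (t H k) = k := by
  have h := hk.mark_t hg 0
  rwa [pow_zero, if_pos (dvd_zero _)] at h

theorem t_sub_natCast_mem_signKernel (hg : IsTopGen g) {k : ℕ} (hk : IsTransCard H k)
    (hodd : Odd k) : t H k - (k : BurnsideRing H) ∈ signKernel H := by
  rw [mem_signKernel_iff_of_isTopGen hg, map_sub, map_sub, hk.mark_one_t hg, mark_natCast, sub_self,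
    sgn_natCast, hk.sgn_t hg, hodd.neg_one_pow, neg_neg, ofMul_one, sub_zero]
  exact ⟨rfl, rfl⟩

theorem two_mul_t_two_sub_mem_signKernel (hg : IsTopGen g) (h2 : IsTransCard H 2) :
    2 * (t H 2 - 2) ∈ signKernel H := by
  have hs : sgn g (2 : BurnsideRing H) = 0 := sgn_natCast g 2
  rw [two_mul, mem_signKernel_iff_of_isTopGen hg, map_add, map_add, map_sub, map_sub,
    h2.mark_one_t hg, mark_ofNat, hs, h2.sgn_t hg]
  exact ⟨by norm_num, by decide⟩

/-- A generator acts on both transitive sets by odd permutations, so the signs cancel, and the rank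
is `4 - 2 - 2`. -/
theorem t_four_sub_mem_signKernel (hg : IsTopGen g) (h4 : IsTransCard H 4) (h2 : IsTransCard H 2) :
    t H 4 - t H 2 - 2 ∈ signKernel H := by
  have hs : sgn g (2 : BurnsideRing H) = 0 := sgn_natCast g 2
  rw [mem_signKernel_iff_of_isTopGen hg, map_sub, map_sub, map_sub, map_sub, h2.mark_one_t hg,
    h4.mark_one_t hg, mark_ofNat, hs, h2.sgn_t hg, h4.sgn_t hg]
  exact ⟨by norm_num, by decide⟩

end BasicElements

/-! ### Generators for infinite procyclic groups -/

section Infinite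
open FinGSet BurnsideRing
variable {G : Type v} [Group G] [TopologicalSpace G] [IsTopologicalGroup G] [CompactSpace G]
  [T2Space G] {g : G} (hg : IsTopGen g)
include hg

/-- The open subgroup containing `H` whose index is the `p`-part of the index of `H`. -/
theorem exists_ge_prime_part (H : OpenSubgroup G) {p : ℕ} (hp : p.Prime) :
    ∃ (n : ℕ) (L : OpenSubgroup G) (_ : H ≤ L), L.toSubgroup.index = p ^ n ∧
      (H.toSubgroup.relIndex L.toSubgroup).Coprime p := by
  obtain ⟨n, m, hm, hnm⟩ := Nat.exists_eq_pow_mul_and_not_dvd (index_ne_zero H) p hp.ne_one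
  obtain ⟨L, hHL, hL⟩ := exists_ge_of_dvd_index hg H (hnm ▸ dvd_mul_right (p ^ n) m)
  refine ⟨n, L, hHL, hL, ?_⟩
  have h1 := relIndex_mul_index hHL
  rw [hL, hnm, mul_comm] at h1
  rw [Nat.eq_of_mul_eq_mul_left (pow_pos hp.pos n) h1, Nat.coprime_comm, hp.coprime_iff_not_dvd]
  exact hm

theorem isTransCard_of_le {H L : OpenSubgroup G} (h : H ≤ L) {k : ℕ} (hk : IsTransCard H k) :
    IsTransCard L k :=
  isTransCard_of_dvd hg ((isTransCard_mul_iff hg h).1 hk) (dvd_mul_left _ _)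

/-- Every open subgroup has odd index in one of index `2 ^ n`, and restriction along odd index
preserves `t_4` and `t_2`. -/
theorem t_four_sub_mem_span {S : Set (TambaraElement G)} (hS : twoAdicGenerators G ⊆ S)
    {H : OpenSubgroup G} (h4 : IsTransCard H 4) :
    t H 4 - t H 2 - 2 ∈ (tambaraSpan S).ideal H := by
  obtain ⟨n, L, hHL, hL, hc⟩ := exists_ge_prime_part hg H Nat.prime_two
  have h2 := isTransCard_of_dvd hg h4 (show 2 ∣ 4 by norm_num)
  have h1 := (tambaraSpan S).res_mem H L hHL _ (mem_tambaraSpan (hS ⟨n, L, hL, rfl⟩))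
  rw [map_sub, map_sub, resA_t_of_coprime hg hHL (isTransCard_of_le hg hHL h4) (hc.pow_right 2) h4,
    resA_t_of_coprime hg hHL (isTransCard_of_le hg hHL h2) hc h2] at h1
  have h3 := resA_natCast hg hHL 2
  rw [Nat.cast_ofNat, Nat.cast_ofNat] at h3
  rwa [h3] at h1

/-- The same argument with the `p`-part of the index: restriction along an index prime to `p`
preserves `t_p`. -/
theorem t_sub_natCast_mem_span {S : Set (TambaraElement G)} (hS : oddGenerators G ⊆ S)
    {H : OpenSubgroup G} {p : ℕ} (hp : p.Prime) (hp2 : p ≠ 2) (hpH : IsTransCard H p) :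
    t H p - (p : BurnsideRing H) ∈ (tambaraSpan S).ideal H := by
  obtain ⟨n, L, hHL, hL, hc⟩ := exists_ge_prime_part hg H hp
  have h1 := (tambaraSpan S).res_mem H L hHL _ (mem_tambaraSpan (hS ⟨p, n, L, hp, hp2, hL, rfl⟩))
  rwa [map_sub, resA_t_of_coprime hg hHL (isTransCard_of_le hg hHL hpH) hc hpH,
    resA_natCast hg hHL] at h1

theorem twoAdicGenerators_subset_signKernel (h4 : ∀ H : OpenSubgroup G, IsTransCard H 4)
    {s : TambaraElement G} (hs : s ∈ twoAdicGenerators G) : s.2 ∈ signKernel s.1 := by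
  obtain ⟨n, H, -, rfl⟩ := hs
  exact t_four_sub_mem_signKernel (isTopGen_genOf hg H) (h4 H)
    (isTransCard_of_dvd hg (h4 H) (by norm_num))

theorem isGeneratedBy_twoAdicGenerators (h : ∀ k, IsTransCard G k ↔ ∃ n : ℕ, k = 2 ^ n) :
    IsGeneratedBy (fun H : OpenSubgroup G => signKernel H) (twoAdicGenerators G) := by
  have hH : ∀ H : OpenSubgroup G, ∃ n : ℕ, H.toSubgroup.index = 2 ^ n := fun H =>
    (h _).1 (isTransCard_iff_exists_subgroup.2 ⟨H, rfl⟩)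
  have h4 : ∀ H : OpenSubgroup G, IsTransCard H 4 := fun H => by
    obtain ⟨n, hn⟩ := hH H
    rw [isTransCard_iff hg, hn, h]
    exact ⟨n + 2, by ring⟩
  refine isGeneratedBy_signKernel hg (fun s hs => twoAdicGenerators_subset_signKernel hg h4 hs)
    (fun H p hp hp2 hpH => ?_) (fun H h4 => t_four_sub_mem_span hg subset_rfl h4)
    (fun H _ => (tambaraSpan _).two_mul_mem hg (h4 H) (t_four_sub_mem_span hg subset_rfl (h4 H)))
  -- All indices are powers of two, so no transitive set has odd prime cardinality.
  rw [isTransCard_iff hg, h] at hpH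
  obtain ⟨n, hn⟩ := hpH
  have h1 : p ∣ 2 ^ n := hn ▸ dvd_mul_right _ _
  exact (hp2 ((Nat.prime_dvd_prime_iff_eq hp Nat.prime_two).1 (hp.dvd_of_dvd_pow h1))).elim

theorem isGeneratedBy_twoAdicGenerators_union (h : ∀ k, k ≠ 0 → IsTransCard G k) :
    IsGeneratedBy (fun H : OpenSubgroup G => signKernel H)
      (twoAdicGenerators G ∪ oddGenerators G) := by
  have hH : ∀ (H : OpenSubgroup G) k, k ≠ 0 → IsTransCard H k := fun H k hk => by
    rw [isTransCard_iff hg]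
    exact h _ (mul_ne_zero hk (index_ne_zero H))
  have h4 : ∀ H : OpenSubgroup G, IsTransCard H 4 := fun H => hH H 4 (by norm_num)
  refine isGeneratedBy_signKernel hg ?_
    (fun H p hp hp2 hpH => t_sub_natCast_mem_span hg Set.subset_union_right hp hp2 hpH)
    (fun H h4 => t_four_sub_mem_span hg Set.subset_union_left h4)
    (fun H _ => (tambaraSpan _).two_mul_mem hg (h4 H)
      (t_four_sub_mem_span hg Set.subset_union_left (h4 H)))
  rintro s (hs | ⟨p, n, H, hp, hp2, -, rfl⟩)
  · exact twoAdicGenerators_subset_signKernel hg h4 hs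
  · exact t_sub_natCast_mem_signKernel (isTopGen_genOf hg H) (hH H p hp.ne_zero)
      (hp.odd_of_ne_two hp2)

end Infinite

/-! ### Finite cyclic groups -/

section FiniteCyclic
open FinGSet BurnsideRing
variable {G : Type v} [Group G] [TopologicalSpace G] [IsTopologicalGroup G] [CompactSpace G]
  [T2Space G] [Finite G] {g : G} (hg : IsTopGen g)

theorem card_mul_relIndex {L H : OpenSubgroup G} (h : L ≤ H) :
    Nat.card L * L.toSubgroup.relIndex H.toSubgroup = Nat.card H := by
  have h1 := Subgroup.relIndex_mul_relIndex ⊥ L.toSubgroup H.toSubgroup bot_le h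
  rwa [Subgroup.relIndex_bot_left, Subgroup.relIndex_bot_left] at h1

theorem card_mul_index (H : OpenSubgroup G) : Nat.card H * H.toSubgroup.index = Nat.card G :=
  Subgroup.card_mul_index H.toSubgroup

include hg

theorem le_iff_card_dvd {L H : OpenSubgroup G} : L ≤ H ↔ Nat.card L ∣ Nat.card H := by
  refine ⟨fun h => ⟨_, (card_mul_relIndex h).symm⟩, fun ⟨m, hm⟩ => ?_⟩
  refine (hg.le_iff L.isOpen H.isOpen).2 ⟨m, ?_⟩
  have h1 := card_mul_index L
  rw [← card_mul_index H, hm, mul_assoc] at h1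
  rw [Nat.eq_of_mul_eq_mul_left Nat.card_pos h1, mul_comm]

variable (hG : ∀ k, IsTransCard G k ↔ k ∣ Nat.card G)
include hG

theorem isTransCard_iff_dvd_card {H : OpenSubgroup G} {k : ℕ} :
    IsTransCard H k ↔ k ∣ Nat.card H := by
  rw [isTransCard_iff hg, hG, ← card_mul_index H]
  exact Nat.mul_dvd_mul_iff_right (Nat.pos_of_ne_zero (index_ne_zero H))

theorem exists_card_eq {d : ℕ} (hd : d ∣ Nat.card G) : ∃ H : OpenSubgroup G, Nat.card H = d := by
  obtain ⟨m, hm⟩ := hd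
  have hm0 : 0 < m := Nat.pos_of_ne_zero (by
    rintro rfl
    exact Nat.card_pos.ne' hm)
  obtain ⟨H, hH⟩ := isTransCard_iff_exists_subgroup.1 ((hG m).2 ⟨d, by rw [hm, mul_comm]⟩)
  refine ⟨H, Nat.eq_of_mul_eq_mul_right hm0 ?_⟩
  rw [← hm, ← hH, card_mul_index]

/-- Induction along chains of subgroups of prime index. -/
theorem mem_ideal_of_prime_steps (I : TambaraIdeal G) (x : ∀ H : OpenSubgroup G, BurnsideRing H)
    {L₀ : OpenSubgroup G} (h₀ : x L₀ ∈ I.ideal L₀)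
    (hstep : ∀ (L H : OpenSubgroup G) (_ : L ≤ H), L₀ ≤ L →
      (L.toSubgroup.relIndex H.toSubgroup).Prime → x L ∈ I.ideal L → x H ∈ I.ideal H)
    {H : OpenSubgroup G} (hH : L₀ ≤ H) : x H ∈ I.ideal H := by
  obtain ⟨m, hm⟩ : ∃ m, L₀.toSubgroup.relIndex H.toSubgroup = m := ⟨_, rfl⟩
  induction m using Nat.strong_induction_on generalizing H with | _ m ih
  by_cases h1 : m = 1
  · subst h1
    have : H = L₀ := le_antisymm (Subgroup.relIndex_eq_one.1 hm) hH
    subst this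
    exact h₀
  · obtain ⟨ℓ, hℓ, k, rfl⟩ := Nat.exists_prime_and_dvd h1
    have hc := card_mul_relIndex hH
    rw [hm] at hc
    -- The intermediate subgroup is chosen by its order so that its index in `H` is the prime `ℓ`.
    obtain ⟨L, hL⟩ := exists_card_eq hg hG (d := Nat.card L₀ * k)
      ((Dvd.intro_left ℓ (by rw [← hc]; ring)).trans ⟨_, (card_mul_index H).symm⟩)
    have hLH : L ≤ H := (le_iff_card_dvd hg).2 ⟨ℓ, by rw [← hc, hL]; ring⟩
    have hL0 : L₀ ≤ L := (le_iff_card_dvd hg).2 ⟨k, hL⟩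
    have hr := card_mul_relIndex hLH
    have hk : L₀.toSubgroup.relIndex L.toSubgroup = k :=
      Nat.eq_of_mul_eq_mul_left Nat.card_pos ((card_mul_relIndex hL0).trans hL)
    have hℓ' : L.toSubgroup.relIndex H.toSubgroup = ℓ := by
      refine Nat.eq_of_mul_eq_mul_left (Nat.card_pos (α := L)) (hr.trans ?_)
      rw [← hc, hL]; ring
    have hk0 : 0 < k := by
      rw [← hk]
      exact Nat.pos_of_ne_zero (relIndex_ne_zero hL0)
    exact hstep L H hLH hL0 (hℓ'.symm ▸ hℓ)
      (ih k (lt_mul_of_one_lt_left hk0 hℓ.one_lt) hL0 hk)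

omit hG in
/-- Lifting along a subgroup of prime index of an element with marks `0` and `c`. -/
theorem mem_ideal_of_two_marks (I : TambaraIdeal G) {L H : OpenSubgroup G} (h : L ≤ H) {k : ℕ} {c : ℤ}
    (hp : (L.toSubgroup.relIndex H.toSubgroup).Prime)
    (hk : (L.toSubgroup.relIndex H.toSubgroup).Coprime k)
    (hc : IsCoprime c (L.toSubgroup.relIndex H.toSubgroup))
    {x : BurnsideRing L} {x' : BurnsideRing H}
    (h1 : ∀ m, markAt hg L m x = if k ∣ m then 0 else c)
    (h2 : ∀ m, markAt hg H m x' = if k ∣ m then 0 else c) (hx : x ∈ I.ideal L) :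
    x' ∈ I.ideal H := by
  -- With `ℓ` the index, Fermat's little theorem gives `c ^ ℓ = c + ℓ y c` for an integer `y`, which
  -- is the norm criterion where the mark is `c`.
  obtain ⟨y, hy⟩ := (Int.ModEq.pow_card_sub_one_eq_one hp hc).symm.dvd
  refine I.mem_of_norm hg h hp hx (y : BurnsideRing L) (fun m _ => by rw [h1, h2]) fun m => ?_
  rw [h1, h2, map_intCast, Int.cast_id]
  simp only [hk.symm.dvd_mul_left]
  split_ifs with hm
  · rw [zero_pow hp.ne_zero]; simp
  · rw [← mul_assoc, ← hy, ← mul_pow_sub_one hp.ne_zero]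
    ring

/-- The nonzero mark `-p` is prime to every step of prime index other than `p`, where Fermat
applies; a step of index `p` needs its own multiplier. -/
theorem t_sub_natCast_mem_of_le (I : TambaraIdeal G) {p : ℕ} (hp : p.Prime)
    {L₀ : OpenSubgroup G} (hL₀ : p ∣ Nat.card L₀)
    (h₀ : t L₀ p - (p : BurnsideRing L₀) ∈ I.ideal L₀) {H : OpenSubgroup G} (hH : L₀ ≤ H) :
    t H p - (p : BurnsideRing H) ∈ I.ideal H := by
  have hmark : ∀ H : OpenSubgroup G, L₀ ≤ H → ∀ m,
      markAt hg H m (t H p - (p : BurnsideRing H)) = if p ∣ m then 0 else -(p : ℤ) := by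
    intro H hH m
    rw [map_sub, map_natCast, markAt_t hg ((isTransCard_iff_dvd_card hg hG).2
      (hL₀.trans ((le_iff_card_dvd hg).1 hH)))]
    split_ifs <;> simp
  refine mem_ideal_of_prime_steps hg hG I (fun H => t H p - (p : BurnsideRing H)) h₀
    (fun L H h hL hℓ hx => ?_) hH
  by_cases hpl : L.toSubgroup.relIndex H.toSubgroup = p
  -- At multiples of `p` the lifted element has mark zero, so the multiplier must satisfy `(-p) ^ p
  -- = p y (-p)`.
  · refine I.mem_of_norm hg h hℓ hx (((-(-(p : ℤ)) ^ (p - 2) : ℤ)) : BurnsideRing L)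
      (fun m _ => by rw [hmark L hL, hmark H (hL.trans h)]) fun m => ?_
    rw [hmark L hL, hmark H (hL.trans h), map_intCast, Int.cast_id, hpl, if_pos (dvd_mul_right _ _)]
    split_ifs with hm
    · rw [zero_pow hp.ne_zero]; simp
    · obtain ⟨q, rfl⟩ := Nat.exists_eq_add_of_le' hp.two_le
      rw [Nat.add_sub_cancel, pow_add]
      ring
  · have hc : (L.toSubgroup.relIndex H.toSubgroup).Coprime p := (Nat.coprime_primes hℓ hp).2 hpl
    exact mem_ideal_of_two_marks hg I h hℓ hc (Nat.isCoprime_iff_coprime.2 hc.symm).neg_left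
      (hmark L hL) (hmark H (hL.trans h)) hx

omit [Finite G] hG in
/-- The marks of `2 (t_2 - 2)`. -/
theorem markAt_two_mul_t_two_sub {H : OpenSubgroup G} (h2 : IsTransCard H 2) (m : ℕ) :
    markAt hg H m (2 * (t H 2 - 2)) = if 2 ∣ m then 0 else -4 := by
  rw [map_mul, map_sub, map_ofNat, markAt_t hg h2]
  split_ifs <;> simp

/-- Above a subgroup of even order a step of index two would make `4` divide the order of `G`. All
steps therefore have odd index, to which the mark `-4` is prime. -/
theorem two_mul_t_two_sub_mem_of_le (I : TambaraIdeal G) {L₀ : OpenSubgroup G}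
    (hL₀ : 2 ∣ Nat.card L₀) (h₀ : 2 * (t L₀ 2 - 2) ∈ I.ideal L₀) {H : OpenSubgroup G} (hH : L₀ ≤ H)
    (hodd : ¬ 4 ∣ Nat.card G) : 2 * (t H 2 - 2) ∈ I.ideal H := by
  have hmark : ∀ H : OpenSubgroup G, L₀ ≤ H → ∀ m,
      markAt hg H m (2 * (t H 2 - 2)) = if 2 ∣ m then 0 else -4 := by
    exact fun H hH => markAt_two_mul_t_two_sub hg ((isTransCard_iff_dvd_card hg hG).2
      (hL₀.trans ((le_iff_card_dvd hg).1 hH)))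
  refine mem_ideal_of_prime_steps hg hG I (fun H => 2 * (t H 2 - 2)) h₀
    (fun L H h hL hℓ hx => ?_) hH
  have hl2 : L.toSubgroup.relIndex H.toSubgroup ≠ 2 := by
    intro hl
    refine hodd ((mul_dvd_mul (hL₀.trans ((le_iff_card_dvd hg).1 hL)) (dvd_of_eq hl.symm)).trans ?_)
    rw [card_mul_relIndex h, ← card_mul_index H]
    exact dvd_mul_right _ _
  have hc : (L.toSubgroup.relIndex H.toSubgroup).Coprime 2 :=
    (Nat.coprime_primes hℓ Nat.prime_two).2 hl2
  have hc4 : IsCoprime (4 : ℤ) (L.toSubgroup.relIndex H.toSubgroup) :=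
    Nat.isCoprime_iff_coprime.2 (hc.pow_right 2).symm
  exact mem_ideal_of_two_marks hg I h hℓ hc hc4.neg_left (hmark L hL) (hmark H (hL.trans h)) hx

omit [Finite G] hG in
/-- The marks of `t_4 - t_2 - 2`. -/
theorem markAt_t_four_sub {H : OpenSubgroup G} (h4 : IsTransCard H 4) (m : ℕ) :
    markAt hg H m (t H 4 - t H 2 - 2) = if 4 ∣ m then 0 else if 2 ∣ m then -4 else -2 := by
  have h42 : 4 ∣ m → 2 ∣ m := fun h => dvd_trans (by norm_num) h
  rw [map_sub, map_sub, map_ofNat, markAt_t hg h4,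
    markAt_t hg (isTransCard_of_dvd hg h4 (by norm_num : 2 ∣ 4))]
  split_ifs <;> simp_all

/-- For a step of index two the multiplier `-2` fits both nonzero marks: `(-4) ^ 2 = 0 + 2 * 8` and
`(-2) ^ 2 = -4 + 2 * 4`. For odd index Fermat is needed for the marks `-2` and `-4` at once, so the
multiplier must take two prescribed values. -/
theorem t_four_sub_mem_of_le (I : TambaraIdeal G) {L₀ : OpenSubgroup G}
    (hL₀ : 4 ∣ Nat.card L₀) (h₀ : t L₀ 4 - t L₀ 2 - 2 ∈ I.ideal L₀) {H : OpenSubgroup G}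
    (hH : L₀ ≤ H) : t H 4 - t H 2 - 2 ∈ I.ideal H := by
  have h4 : ∀ {H : OpenSubgroup G}, L₀ ≤ H → IsTransCard H 4 := fun hH =>
    (isTransCard_iff_dvd_card hg hG).2 (hL₀.trans ((le_iff_card_dvd hg).1 hH))
  refine mem_ideal_of_prime_steps hg hG I (fun H => t H 4 - t H 2 - 2) h₀
    (fun L H h hL hℓ hx => ?_) hH
  have hLH := hL.trans h
  by_cases hl2 : L.toSubgroup.relIndex H.toSubgroup = 2
  · refine I.mem_of_norm hg h hℓ hx (-2) (fun m _ => ?_) fun m => ?_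
    · rw [markAt_t_four_sub hg (h4 hL), markAt_t_four_sub hg (h4 hLH)]
    · rw [markAt_t_four_sub hg (h4 hL), markAt_t_four_sub hg (h4 hLH), hl2, map_neg, map_ofNat,
        if_pos (dvd_mul_right 2 m)]
      split_ifs <;> omega
  · have hc : (L.toSubgroup.relIndex H.toSubgroup).Coprime 2 :=
      (Nat.coprime_primes hℓ Nat.prime_two).2 hl2
    have hc2 : IsCoprime (2 : ℤ) (L.toSubgroup.relIndex H.toSubgroup) :=
      Nat.isCoprime_iff_coprime.2 hc.symm
    have hc4' : (L.toSubgroup.relIndex H.toSubgroup).Coprime 4 := hc.pow_right 2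
    have hc4 : IsCoprime (4 : ℤ) (L.toSubgroup.relIndex H.toSubgroup) :=
      Nat.isCoprime_iff_coprime.2 hc4'.symm
    obtain ⟨a, ha⟩ := (Int.ModEq.pow_card_sub_one_eq_one hℓ hc2.neg_left).symm.dvd
    obtain ⟨b, hb⟩ := (Int.ModEq.pow_card_sub_one_eq_one hℓ hc4.neg_left).symm.dvd
    -- The element `a + w t_2` has mark `a` at odd and `a + 2 w` at even exponents, so `a` and `b`
    -- must agree modulo two. They do: `ℓ (b - a)` is a difference of even powers and `ℓ` is odd.
    obtain ⟨w, hw⟩ : ∃ w, b = a + w * 2 := by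
      have h2 : (2 : ℤ) ∣ L.toSubgroup.relIndex H.toSubgroup * (b - a) := by
        rw [mul_sub, ← ha, ← hb, sub_sub_sub_cancel_right]
        have h0 : L.toSubgroup.relIndex H.toSubgroup - 1 ≠ 0 := by
          have := hℓ.two_le
          omega
        exact dvd_sub (dvd_pow (by norm_num) h0) (dvd_pow (by norm_num) h0)
      obtain ⟨w, hw⟩ := hc2.dvd_of_dvd_mul_left h2
      exact ⟨w, by rw [← sub_eq_iff_eq_add', hw, mul_comm]⟩
    refine I.mem_of_norm hg h hℓ hx (a + w * t L 2) (fun m _ => ?_) fun m => ?_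
    · rw [markAt_t_four_sub hg (h4 hL), markAt_t_four_sub hg (h4 hLH)]
    · rw [markAt_t_four_sub hg (h4 hL), markAt_t_four_sub hg (h4 hLH), map_add, map_mul,
        map_intCast, map_intCast, markAt_t hg (isTransCard_of_dvd hg (h4 hL) (by norm_num : 2 ∣ 4)),
        Int.cast_id, Int.cast_id]
      simp only [hc.symm.dvd_mul_left, hc4'.symm.dvd_mul_left]
      split_ifs with h4m h2m
      · rw [zero_pow hℓ.ne_zero]; simp
      · rw [zero_pow hℓ.ne_zero]; simp
      · rw [Nat.cast_ofNat, ← hw, ← mul_assoc, ← hb, ← mul_pow_sub_one hℓ.ne_zero]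
        ring
      · rw [mul_zero, add_zero, ← mul_assoc, ← ha, ← mul_pow_sub_one hℓ.ne_zero]
        ring

/-- If `4` does not divide the order of `H`, then `H` has index two in some `L` whose order it
divides. Restriction to `H` doubles exponents and leaves of `t_4 - t_2 - 2` the marks `0` and `-4`,
those of `2 (t_2 - 2)`. -/
theorem two_mul_mem_of_t_four_sub_mem (I : TambaraIdeal G)
    (hG4 : 4 ∣ Nat.card G)
    (hB : ∀ H : OpenSubgroup G, IsTransCard H 4 → t H 4 - t H 2 - 2 ∈ I.ideal H)
    {H : OpenSubgroup G} (h2 : IsTransCard H 2) : 2 * (t H 2 - 2) ∈ I.ideal H := by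
  by_cases h4 : IsTransCard H 4
  · exact I.two_mul_mem hg h4 (hB H h4)
  · rw [isTransCard_iff_dvd_card hg hG] at h4
    have h2' := (isTransCard_iff_dvd_card hg hG).1 h2
    have hi : 2 ∣ H.toSubgroup.index := by
      by_contra hi
      have hc : Nat.Coprime 4 H.toSubgroup.index :=
        ((Nat.prime_two.coprime_iff_not_dvd).2 hi).pow_left 2
      exact h4 (hc.dvd_of_dvd_mul_right (by rwa [card_mul_index]))
    obtain ⟨j, hj⟩ := hi
    obtain ⟨L, hL⟩ := exists_card_eq hg hG (d := Nat.card H * 2)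
      ⟨j, by rw [← card_mul_index H, hj, mul_assoc]⟩
    have hHL : H ≤ L := (le_iff_card_dvd hg).2 ⟨2, hL⟩
    have hr : H.toSubgroup.relIndex L.toSubgroup = 2 :=
      Nat.eq_of_mul_eq_mul_left Nat.card_pos ((card_mul_relIndex hHL).trans hL)
    have h4L : IsTransCard L 4 := (isTransCard_iff_dvd_card hg hG).2 (hL ▸ mul_dvd_mul_right h2' 2)
    have h1 := I.res_mem H L hHL _ (hB L h4L)
    convert h1 using 1
    refine eq_of_markAt_eq hg fun m _ => ?_
    rw [markAt_resA hg hHL, markAt_t_four_sub hg h4L, hr, if_pos (dvd_mul_right 2 m), map_mul, map_sub,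
      map_ofNat, markAt_t hg h2]
    split_ifs <;> omega

end FiniteCyclic

/-! ### The generator for a finite cyclic group -/

section FiniteGenerator
open FinGSet BurnsideRing

theorem two_le_factorization_iff {N : ℕ} (hN : N ≠ 0) : 2 ≤ N.factorization 2 ↔ 4 ∣ N :=
  (Nat.prime_two.pow_dvd_iff_le_factorization hN (k := 2)).symm

theorem one_le_factorization_iff {N : ℕ} (hN : N ≠ 0) : 1 ≤ N.factorization 2 ↔ 2 ∣ N :=
  (Nat.prime_two.pow_dvd_iff_le_factorization hN (k := 1)).symm

theorem prime_of_mem_erase {N p : ℕ} (hp : p ∈ N.primeFactors.erase 2) :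
    p.Prime ∧ p ≠ 2 ∧ p ∣ N :=
  ⟨Nat.prime_of_mem_primeFactors (Finset.mem_of_mem_erase hp), Finset.ne_of_mem_erase hp,
    Nat.dvd_of_mem_primeFactors (Finset.mem_of_mem_erase hp)⟩

theorem coprime_prod_of_notMem {q N : ℕ} {s : Finset ℕ} (hs : s ⊆ N.primeFactors) (hq : q.Prime)
    (hqs : q ∉ s) : q.Coprime (∏ p ∈ s, p) :=
  Nat.Coprime.prod_right fun _ hp =>
    (Nat.coprime_primes hq (Nat.prime_of_mem_primeFactors (hs hp))).2 fun h => hqs (h ▸ hp)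

theorem hatOrder_dvd {N : ℕ} (hN : N ≠ 0) : hatOrder N ∣ N := by
  refine Nat.Coprime.mul_dvd_of_dvd_of_dvd (Nat.Coprime.pow_left _
    (coprime_prod_of_notMem (Finset.erase_subset _ _) Nat.prime_two (Finset.notMem_erase _ _))) ?_ ?_
  · exact (Nat.prime_two.pow_dvd_iff_le_factorization hN).2 (min_le_left _ _)
  · exact (Finset.prod_dvd_prod_of_subset _ _ _ (Finset.erase_subset _ _)).trans
      (Nat.prod_primeFactors_dvd N)

variable {G : Type v} [Group G] [TopologicalSpace G] [IsTopologicalGroup G] [CompactSpace G]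
  [T2Space G] [Finite G] {g : G} (hg : IsTopGen g) (hG : ∀ k, IsTransCard G k ↔ k ∣ Nat.card G)
include hg hG

/-- This makes the two-part disappear on restriction to a subgroup of odd prime order. -/
theorem markAt_twoPart_of_dvd {H : OpenSubgroup G}
    (hH : 2 ^ min ((Nat.card G).factorization 2) 2 ∣ Nat.card H) {m : ℕ}
    (hm : 2 ^ min ((Nat.card G).factorization 2) 2 ∣ m) :
    markAt hg H m (twoPart (Nat.card G) H) = 0 := by
  rw [← isTransCard_iff_dvd_card hg hG] at hH
  unfold twoPart
  generalize (Nat.card G).factorization 2 = μ at *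
  rcases μ with _ | _ | μ
  · simp
  · have h := markAt_two_mul_t_two_sub hg hH m
    rw [if_pos (show 2 ∣ m from hm)] at h
    simpa using h
  · rw [if_pos (by omega)]
    have h0 : min (μ + 1 + 1) 2 = 2 := by omega
    rw [h0] at hH hm
    rw [markAt_t_four_sub hg hH, if_pos (show 4 ∣ m from hm)]

/-- An odd factor does not change divisibility by `2` or `4`, so the two-part survives restriction
along odd index. -/
theorem markAt_mul_twoPart {L H : OpenSubgroup G} (h : L ≤ H)
    (hL : 2 ^ min ((Nat.card G).factorization 2) 2 ∣ Nat.card L) {r : ℕ} (hr : Nat.Coprime 2 r)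
    (m : ℕ) :
    markAt hg H (r * m) (twoPart (Nat.card G) H) = markAt hg L m (twoPart (Nat.card G) L) := by
  have hH := hL.trans ((le_iff_card_dvd hg).1 h)
  rw [← isTransCard_iff_dvd_card hg hG] at hH hL
  unfold twoPart
  have hr4 : Nat.Coprime 4 r := hr.pow_left 2
  generalize (Nat.card G).factorization 2 = μ at *
  rcases μ with _ | _ | μ
  · simp
  · have h1 := markAt_two_mul_t_two_sub hg hH (r * m)
    have h2 := markAt_two_mul_t_two_sub hg hL m
    simp only [hr.dvd_mul_left] at h1
    simpa using h1.trans h2.symm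
  · have h0 : min (μ + 1 + 1) 2 = 2 := by omega
    rw [h0] at hH hL
    rw [if_pos (by omega), if_pos (by omega), markAt_t_four_sub hg hH, markAt_t_four_sub hg hL]
    simp only [hr.dvd_mul_left, hr4.dvd_mul_left]

theorem markAt_sum_t_sub {H : OpenSubgroup G} {s : Finset ℕ} (hs : ∀ p ∈ s, p ∣ Nat.card H) (m : ℕ) :
    markAt hg H m (∑ p ∈ s, (t H p - (p : BurnsideRing H))) =
      ∑ p ∈ s, if p ∣ m then 0 else -(p : ℤ) := by
  rw [map_sum]
  refine Finset.sum_congr rfl fun p hp => ?_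
  rw [map_sub, map_natCast, markAt_t hg ((isTransCard_iff_dvd_card hg hG).2 (hs p hp))]
  split_ifs <;> simp

variable {H₀ : OpenSubgroup G} (hH₀ : Nat.card H₀ = hatOrder (Nat.card G)) (I : TambaraIdeal G)
  (hI : finiteGenerator (Nat.card G) H₀ ∈ I.ideal H₀)
include hH₀

theorem dvd_card_of_mem {p : ℕ} (hp : p ∈ (Nat.card G).primeFactors.erase 2) : p ∣ Nat.card H₀ := by
  rw [hH₀]
  exact (Finset.dvd_prod_of_mem _ hp).mul_left _

include hI

/-- The index in `H₀` of the subgroup of order `p` is divisible by the power of two and by all other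
odd primes of `hatOrder`, so restriction kills every summand but `t_p - p`. This is then lifted to
`H`. -/
theorem t_sub_natCast_mem {p : ℕ} (hp : p.Prime) (hp2 : p ≠ 2) {H : OpenSubgroup G}
    (hpH : IsTransCard H p) : t H p - (p : BurnsideRing H) ∈ I.ideal H := by
  have hpH' := (isTransCard_iff_dvd_card hg hG).1 hpH
  have hpG : p ∣ Nat.card G := hpH'.trans ⟨_, (card_mul_index H).symm⟩
  have hmem : p ∈ (Nat.card G).primeFactors.erase 2 :=
    Finset.mem_erase.2 ⟨hp2, Nat.mem_primeFactors.2 ⟨hp, hpG, Nat.card_pos.ne'⟩⟩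
  obtain ⟨L, hL⟩ := exists_card_eq hg hG hpG
  have hLH : L ≤ H := (le_iff_card_dvd hg).2 (hL ▸ hpH')
  have hL0 : L ≤ H₀ := (le_iff_card_dvd hg).2 (hL ▸ dvd_card_of_mem hg hG hH₀ hmem)
  refine t_sub_natCast_mem_of_le hg hG I hp (dvd_of_eq hL.symm) ?_ hLH
  set O := ∏ q ∈ ((Nat.card G).primeFactors.erase 2).erase p, q with hO
  have hr : L.toSubgroup.relIndex H₀.toSubgroup =
      2 ^ min ((Nat.card G).factorization 2) 2 * O := by
    have h1 := card_mul_relIndex hL0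
    rw [hL, hH₀, hatOrder, ← Finset.mul_prod_erase _ _ hmem, mul_left_comm] at h1
    exact Nat.eq_of_mul_eq_mul_left hp.pos h1
  -- As `hatOrder` contains `p` only once, the index is prime to `p` and the remaining summand is
  -- unchanged.
  have hc : p.Coprime (L.toSubgroup.relIndex H₀.toSubgroup) := by
    rw [hr]
    exact ((Nat.coprime_primes hp Nat.prime_two).2 hp2).pow_right _ |>.mul_right
      (coprime_prod_of_notMem ((Finset.erase_subset _ _).trans (Finset.erase_subset _ _)) hp
        (Finset.notMem_erase _ _))
  have h1 := I.res_mem L H₀ hL0 _ hI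
  convert h1 using 1
  refine eq_of_markAt_eq hg fun m _ => ?_
  have h2 := markAt_twoPart_of_dvd hg hG (H := H₀) (m := L.toSubgroup.relIndex H₀.toSubgroup * m)
    (by rw [hH₀]; exact dvd_mul_right _ _) (by rw [hr, mul_assoc]; exact dvd_mul_right _ _)
  rw [markAt_resA hg hL0, finiteGenerator, map_add, h2, zero_add,
    markAt_sum_t_sub hg hG fun q hq => dvd_card_of_mem hg hG hH₀ hq,
    Finset.sum_eq_single_of_mem p hmem, map_sub, map_natCast,
    markAt_t hg ((isTransCard_iff_dvd_card hg hG).2 (dvd_of_eq hL.symm))]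
  · simp only [hc.dvd_mul_left]
    split_ifs <;> simp
  · intro q hq hqp
    refine if_pos (dvd_mul_of_dvd_left ?_ _)
    rw [hr]
    exact (Finset.dvd_prod_of_mem _ (Finset.mem_erase.2 ⟨hqp, hq⟩)).mul_left _

/-- The index of this subgroup in `H₀` is the product of the odd primes: each kills its own summand
on restriction, and being odd together they preserve the two-part. -/
theorem exists_twoPart_mem : ∃ L : OpenSubgroup G,
    Nat.card L = 2 ^ min ((Nat.card G).factorization 2) 2 ∧ twoPart (Nat.card G) L ∈ I.ideal L := by
  have hdvd : 2 ^ min ((Nat.card G).factorization 2) 2 ∣ Nat.card H₀ := by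
    rw [hH₀]; exact dvd_mul_right _ _
  obtain ⟨L, hL⟩ := exists_card_eq hg hG (hdvd.trans ⟨_, (card_mul_index H₀).symm⟩)
  have hL0 : L ≤ H₀ := (le_iff_card_dvd hg).2 (hL ▸ hdvd)
  refine ⟨L, hL, ?_⟩
  have hr : L.toSubgroup.relIndex H₀.toSubgroup = ∏ p ∈ (Nat.card G).primeFactors.erase 2, p := by
    have h1 := card_mul_relIndex hL0
    rw [hL, hH₀, hatOrder] at h1
    exact Nat.eq_of_mul_eq_mul_left (by positivity) h1
  have h1 := I.res_mem L H₀ hL0 _ hI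
  convert h1 using 1
  refine eq_of_markAt_eq hg fun m _ => ?_
  rw [markAt_resA hg hL0, finiteGenerator, map_add,
    markAt_sum_t_sub hg hG fun q hq => dvd_card_of_mem hg hG hH₀ hq,
    Finset.sum_eq_zero, add_zero, markAt_mul_twoPart hg hG hL0 (dvd_of_eq hL.symm)]
  · rw [hr]
    exact coprime_prod_of_notMem (Finset.erase_subset _ _) Nat.prime_two (Finset.notMem_erase _ _)
  · intro q hq
    refine if_pos (dvd_mul_of_dvd_left ?_ _)
    rw [hr]
    exact Finset.dvd_prod_of_mem _ hq

theorem t_four_sub_mem {H : OpenSubgroup G} (h4 : IsTransCard H 4) :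
    t H 4 - t H 2 - 2 ∈ I.ideal H := by
  have h4' := (isTransCard_iff_dvd_card hg hG).1 h4
  have hμ := (two_le_factorization_iff Nat.card_pos.ne').2
    (h4'.trans ⟨_, (card_mul_index H).symm⟩)
  obtain ⟨L, hL, hLI⟩ := exists_twoPart_mem hg hG hH₀ I hI
  rw [twoPart, if_pos hμ] at hLI
  rw [min_eq_right hμ] at hL
  exact t_four_sub_mem_of_le hg hG I (dvd_of_eq hL.symm) hLI
    ((le_iff_card_dvd hg).2 (hL ▸ h4'))

theorem two_mul_t_two_sub_mem {H : OpenSubgroup G} (h2 : IsTransCard H 2) :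
    2 * (t H 2 - 2) ∈ I.ideal H := by
  by_cases h4 : 4 ∣ Nat.card G
  · exact two_mul_mem_of_t_four_sub_mem hg hG I h4
      (fun H h => t_four_sub_mem hg hG hH₀ I hI h) h2
  · have h2' := (isTransCard_iff_dvd_card hg hG).1 h2
    have hμ := (one_le_factorization_iff Nat.card_pos.ne').2
      (h2'.trans ⟨_, (card_mul_index H).symm⟩)
    have hμ' := mt (two_le_factorization_iff Nat.card_pos.ne').1 h4
    -- Here `μ = 1`, so the two-part is `2 (t_2 - 2)` itself and is lifted directly.
    have hμ1 : (Nat.card G).factorization 2 = 1 := by omega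
    obtain ⟨L, hL, hLI⟩ := exists_twoPart_mem hg hG hH₀ I hI
    rw [twoPart, if_neg hμ', hμ1, Nat.cast_one, mul_one] at hLI
    rw [hμ1] at hL
    exact two_mul_t_two_sub_mem_of_le hg hG I (dvd_of_eq hL.symm) hLI
      ((le_iff_card_dvd hg).2 (hL ▸ h2')) h4

omit hI in
theorem finiteGenerator_mem_signKernel : finiteGenerator (Nat.card G) H₀ ∈ signKernel H₀ := by
  have hgen := isTopGen_genOf hg H₀
  refine add_mem ?_ (sum_mem fun p hp => ?_)
  · have hdvd : IsTransCard H₀ (2 ^ min ((Nat.card G).factorization 2) 2) := by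
      rw [isTransCard_iff_dvd_card hg hG, hH₀]
      exact dvd_mul_right _ _
    unfold twoPart
    generalize (Nat.card G).factorization 2 = μ at *
    rcases μ with _ | _ | μ
    · simp
    · simpa using two_mul_t_two_sub_mem_signKernel hgen hdvd
    · have h0 : min (μ + 1 + 1) 2 = 2 := by omega
      rw [h0] at hdvd
      rw [if_pos (by omega)]
      exact t_four_sub_mem_signKernel hgen hdvd (isTransCard_of_dvd hg hdvd (by norm_num))
  · obtain ⟨hp1, hp2, -⟩ := prime_of_mem_erase hp
    exact t_sub_natCast_mem_signKernel hgen
      ((isTransCard_iff_dvd_card hg hG).2 (dvd_card_of_mem hg hG hH₀ hp)) (hp1.odd_of_ne_two hp2)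

omit hI I in
theorem isGeneratedBy_finiteGenerator :
    IsGeneratedBy (fun H : OpenSubgroup G => signKernel H)
      {⟨H₀, finiteGenerator (Nat.card G) H₀⟩} := by
  have hI := mem_tambaraSpan (Set.mem_singleton
    (⟨H₀, finiteGenerator (Nat.card G) H₀⟩ : TambaraElement G))
  refine isGeneratedBy_signKernel hg ?_
    (fun H p hp hp2 h => t_sub_natCast_mem hg hG hH₀ _ hI hp hp2 h)
    (fun H h => t_four_sub_mem hg hG hH₀ _ hI h) (fun H h => two_mul_t_two_sub_mem hg hG hH₀ _ hI h)
  rintro s rfl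
  exact finiteGenerator_mem_signKernel hg hG hH₀

end FiniteGenerator

end TraceIdeal

/-! ### The three extensions: finite, quadratically closed, algebraically closed. -/

theorem mainTheorem6 {F : Type u} [Field F] [Finite F] [NeZero (2 : F)] :
    (∀ (K : Type v) [Field K] [Algebra F K] [FiniteDimensional F K],
      IsStronglyPrincipal (traceIdeal F K) ∧
      ∃ H : OpenSubgroup Gal(K/F), Nat.card H = hatOrder (Module.finrank F K) ∧
        IsGeneratedBy (traceIdeal F K) {⟨H, finiteGenerator (Module.finrank F K) H⟩}) ∧
    (∀ (Q : Type v) [Field Q] [Algebra F Q] [IsQuadraticClosure F Q],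
      IsGeneratedBy (traceIdeal F Q) (twoAdicGenerators Gal(Q/F))) ∧
    (∀ (K : Type v) [Field K] [Algebra F K] [IsAlgClosure F K],
      IsGeneratedBy (traceIdeal F K)
        (twoAdicGenerators Gal(K/F) ∪ oddGenerators Gal(K/F))) := by
  refine ⟨fun K _ _ _ => ?_, fun Q _ _ _ => ?_, fun K _ _ _ => ?_⟩
  · obtain ⟨g, hg⟩ := exists_isTopGen F K
    have hcard := IsGalois.card_aut_eq_finrank F K
    have hG : ∀ k, IsTransCard Gal(K/F) k ↔ k ∣ Nat.card Gal(K/F) := fun k => by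
      rw [hcard, isTransCard_gal_iff_dvd]
    obtain ⟨H, hH⟩ := exists_card_eq hg hG (hatOrder_dvd Nat.card_pos.ne')
    have h := isGeneratedBy_finiteGenerator hg hG hH
    rw [← traceIdeal_eq_signKernel hg] at h
    rw [← hcard]
    exact ⟨⟨H, _, h⟩, H, hH, h⟩
  · obtain ⟨g, hg⟩ := exists_isTopGen F Q
    rw [traceIdeal_eq_signKernel hg]
    exact isGeneratedBy_twoAdicGenerators hg fun k => isTransCard_quadraticClosure_iff
  · obtain ⟨g, hg⟩ := exists_isTopGen F K
    rw [traceIdeal_eq_signKernel hg]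
    exact isGeneratedBy_twoAdicGenerators_union hg fun k hk => isTransCard_gal_of_isAlgClosure hk
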